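/- Let $\mathcal{M}$ be a (planar) multicategory with object set $\mathcal{M}_0$. For a set $X$, an *exchange* is an element of the free monoid $X^{\circ\bullet}=(X\times\{\circ,\bullet\})^*$; write $\lambda$ for the empty one. **Free cornering.** Let $F(\mathcal{M})$ be the free strict monoidal category on $\mathcal{M}$: objects are lists of objects of $\mathcal{M}$, morphisms $\Gamma_1,\dots,\Gamma_n\to A_1,\dots,A_n$ are sequences $(f_1,\dots,f_n)$ with $f_i\in\mathcal{M}(\Gamma_i;A_i)$, and $\otimes$ is concatenation. Cells of a single-object double category have a left, top, bottom and right boundary, and we write $a:(U;A;B;W)$ for them in this order. The *free cornering* $\ulcorner\mathbb{A}\lrcorner$ of a strict monoidal category $\mathbb{A}$ is the single-object strict double category with horizontal edge monoid $(\mathbb{A}_0,\otimes,I)$, vertical edge monoid $\mathbb{A}_0^{\circ\bullet}$, and cells generated under vertical composition $\cdot$, horizontal composition $\mid$ and identities $1_A:(\lambda;A;A;\lambda)$, $id_U:(U;I;I;U)$ by a cell $\ulcorner f\lrcorner:(\lambda;A;B;\lambda)$ for each $f\in\mathbb{A}(A,B)$ and corner cells $A\urcorner:(A^\circ;I;A;\lambda)$,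 $A\llcorner:(\lambda;A;I;A^\circ)$, $A\ulcorner:(\lambda;I;A;A^\bullet)$, $A\lrcorner:(A^\bullet;A;I;\lambda)$ for each object $A$, subject to the axioms of a double category and to $$\ulcorner f\lrcorner\cdot\ulcorner g\lrcorner=\ulcorner fg\lrcorner,\quad \ulcorner f\lrcorner\mid\ulcorner g\lrcorner=\ulcorner f\otimes g\lrcorner,\quad 1_A=\ulcorner 1_A\lrcorner,$$ $$A\llcorner\mid A\urcorner=1_A=A\ulcorner\mid A\lrcorner,\quad A\urcorner\cdot A\llcorner=id_{A^\circ},\quad A\ulcorner\cdot A\lrcorner=id_{A^\bullet}.$$ **Terms.** Terms over $\mathcal{M}$ are the derivations of sequents $\Gamma\Vdash t:(U,B,W)$, with $\Gamma\in\mathcal{M}_0^*$ (variables without repetition), $U,W\in\mathcal{M}_0^{\circ\bullet}$, $B\in\mathcal{M}_0$, by the following rules, in which $\Gamma\vdash v:A$ means $v\in\mathcal{M}(\Gamma;A)$: - $\Gamma\Vdash[v]:(\lambda,A,\lambda)$ if $\Gamma\vdash v:A$; - $\Gamma_1,\dots,\Gamma_n\Vdash\mathsf{let}\ x_1,\dots,x_n\downarrow(t_1\mid\cdots\mid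 t_n)\ \mathsf{in}\ t:(U_0V,B,U_nW)$ if $\Gamma_i\Vdash t_i:(U_{i-1},A_i,U_i)$ for all $i$ and $x_1{:}A_1,\dots,x_n{:}A_n\Vdash t:(V,B,W)$, where $n\ge1$, or $n=0$ and $U_0=\lambda$; - $\Delta,\Gamma\Vdash\mathsf{putR}(v,t):(U,B,A^\circ W)$ and $\Gamma,\Delta\Vdash\mathsf{putL}(v,t):(A^\bullet U,B,W)$ if $\Delta\Vdash t:(U,B,W)$ and $\Gamma\vdash v:A$; - $\Gamma\Vdash\mathsf{getL}(x.t):(A^\circ U,B,W)$ if $x{:}A,\Gamma\Vdash t:(U,B,W)$, and $\Gamma\Vdash\mathsf{getR}(x.t):(U,B,A^\bullet W)$ if $\Gamma,x{:}A\Vdash t:(U,B,W)$. Value substitution $t[v_1,\dots,v_n/x_1,\dots,x_n]$ is defined by recursion on $t$, through composition in $\mathcal{M}$. Let $\to$ be the least relation closed under the term constructors that contains (with $\bar x$ for $x_1,\dots,x_n$) - $\mathsf{let}\ \bar x\downarrow([v_1]\mid\cdots\mid[v_n])\ \mathsf{in}\ t\to t[v_1,\dots,v_n/\bar x]$; - $\mathsf{let}\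 \bar x\downarrow(\bar a\mid\mathsf{putR}(v,t)\mid\mathsf{getL}(y.s)\mid\bar b)\ \mathsf{in}\ r\to\mathsf{let}\ \bar x\downarrow(\bar a\mid t\mid s[v/y]\mid\bar b)\ \mathsf{in}\ r$; - $\mathsf{let}\ \bar x\downarrow(\bar a\mid\mathsf{getR}(y.t)\mid\mathsf{putL}(v,s)\mid\bar b)\ \mathsf{in}\ r\to\mathsf{let}\ \bar x\downarrow(\bar a\mid t[v/y]\mid s\mid\bar b)\ \mathsf{in}\ r$; - $\mathsf{let}\ \bar x\downarrow(\mathsf{putL}(v,t)\mid\bar a)\ \mathsf{in}\ r\to\mathsf{putL}(v,\mathsf{let}\ \bar x\downarrow(t\mid\bar a)\ \mathsf{in}\ r)$, and likewise $\mathsf{let}\ \bar x\downarrow(\mathsf{getL}(y.t)\mid\bar a)\ \mathsf{in}\ r\to\mathsf{getL}(y.\mathsf{let}\ \bar x\downarrow(t\mid\bar a)\ \mathsf{in}\ r)$; - $\mathsf{let}\ \bar x\downarrow(\bar a\mid\mathsf{putR}(v,t))\ \mathsf{in}\ r\to\mathsf{putR}(v,\mathsf{let}\ \bar x\downarrow(\bar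 a\mid t)\ \mathsf{in}\ r)$, and likewise $\mathsf{let}\ \bar x\downarrow(\bar a\mid\mathsf{getR}(y.t))\ \mathsf{in}\ r\to\mathsf{getR}(y.\mathsf{let}\ \bar x\downarrow(\bar a\mid t)\ \mathsf{in}\ r)$; - $\mathsf{putR}(v,\mathsf{putL}(w,t))\to\mathsf{putL}(w,\mathsf{putR}(v,t))$, $\ \mathsf{putR}(v,\mathsf{getL}(x.t))\to\mathsf{getL}(x.\mathsf{putR}(v,t))$, $\ \mathsf{getR}(x.\mathsf{putL}(v,t))\to\mathsf{putL}(v,\mathsf{getR}(x.t))$ if $x$ does not occur in $v$, $\ \mathsf{getR}(x.\mathsf{getL}(y.t))\to\mathsf{getL}(y.\mathsf{getR}(x.t))$. Let $\stackrel{*}{\leftrightarrow}$ be the equivalence relation generated by $\to$. **Interpretation.** Identify $A\in\mathcal{M}_0$ with the one-element list $(A)$. Each term $\Gamma\Vdash t:(U,B,W)$ has an interpretation $[\![t]\!]:(U;\Gamma;B;W)$ in $\ulcorner F(\mathcal{M})\lrcorner$, given by $$[\![[v]]\!]=\ulcorner(v)\lrcorner,\qquad [\![\mathsf{let}\ \bar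 x\downarrow(t_1\mid\cdots\mid t_n)\ \mathsf{in}\ t]\!]=([\![t_1]\!]\mid\cdots\mid[\![t_n]\!])\cdot[\![t]\!],$$ $$[\![\mathsf{putL}(v,t)]\!]=((\ulcorner(v)\lrcorner\cdot A\lrcorner)\mid1_\Delta)\cdot[\![t]\!],\qquad [\![\mathsf{putR}(v,t)]\!]=(1_\Delta\mid(\ulcorner(v)\lrcorner\cdot A\llcorner))\cdot[\![t]\!],$$ $$[\![\mathsf{getL}(x.t)]\!]=(A\urcorner\mid1_\Gamma)\cdot[\![t]\!],\qquad [\![\mathsf{getR}(x.t)]\!]=(1_\Gamma\mid A\ulcorner)\cdot[\![t]\!].$$ **Virtual double categories.** Let $[\mathcal{M}]$ have one object, horizontal edges $\mathcal{M}_0$, vertical edge monoid $\mathcal{M}_0^{\circ\bullet}$, and as cells with left boundary $U$, top boundary $\Gamma$, bottom boundary $B$ and right boundary $W$ the $\stackrel{*}{\leftrightarrow}$-classes of terms $\Gamma\Vdash t:(U,B,W)$. Its identities are $1_A=(x{:}A\Vdash[x]:(\lambda,A,\lambda))$, and its composition is $f\circ(g_1,\dots,g_n)=\mathsf{let}\ \bar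 x\downarrow(g_1\mid\cdots\mid g_n)\ \mathsf{in}\ f$ for $n\ge1$ and $f\circ(\,)_U=id_U(f)$ for the empty path at $U$, where $id_\lambda(f)=f$, $id_{A^\circ U}(f)=\mathsf{getL}(x.\mathsf{putR}(x,id_U(f)))$ and $id_{A^\bullet U}(f)=\mathsf{getR}(x.\mathsf{putL}(x,id_U(f)))$. For a single-object double category $\mathbb{X}$, let $U(\mathbb{X})$ have the same edges, cells $(U;A_1,\dots,A_n;B;W)$ the cells $(U;A_1\otimes\cdots\otimes A_n;B;W)$ of $\mathbb{X}$, composition $f\circ(g_1,\dots,g_n)=(g_1\mid\cdots\mid g_n)\cdot f$ (with $f\circ(\,)_U=id_U\cdot f$), and the vertical identities as identities. **Theorem.** $[\mathcal{M}]$ and $U(\ulcorner F(\mathcal{M})\lrcorner)$ are single-object virtual double categories (composition is associative and unital). If $t\stackrel{*}{\leftrightarrow}t'$, then $[\![t]\!]=[\![t']\!]$. The resulting map $t\mapsto[\![t]\!]$ on cells, together with $A\mapsto(A)$ on horizontal edges and the induced monoid homomorphism on vertical edges, is a functor of virtual double categories $$[\![-]\!]:[\mathcal{M}]\to U(\ulcorner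 F(\mathcal{M})\lrcorner).$$ -/

import Mathlib

/-!
Throughout, an operation whose result is typed by a product of boundaries (or by a concatenation of
contexts) takes proofs that the boundary of the result equals that product, such as
`hU : U * U' = U''`, so that the result is available at every boundary that equals the product.
This is the usual operation, and the laws become plain equations, without transports.
-/

universe u v w u₁ u₂ v₁ v₂

namespace ProcessCalculus

open CategoryTheory

set_option linter.checkUnivs false

/-! ### Multicategories -/

/-- Sequences `(f₁, …, fₙ)` with `fᵢ : Γᵢ ⟶ Aᵢ`, with domain `Γ₁, …, Γₙ` and codomain
`A₁, …, Aₙ`. -/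
inductive HomSeq {Ob : Type u} (Hom : List Ob → Ob → Type v) :
    List Ob → List Ob → Type (max u v)
  | nil : HomSeq Hom [] []
  | cons {Γ Δ Θ : List Ob} {A : Ob} {As : List Ob} (h : Γ ++ Δ = Θ)
      (f : Hom Γ A) (fs : HomSeq Hom Δ As) : HomSeq Hom Θ (A :: As)

namespace HomSeq

variable {Ob : Type u} {Hom : List Ob → Ob → Type v}

/-- The sequence with one entry. -/
def single {Γ : List Ob} {A : Ob} (f : Hom Γ A) : HomSeq Hom Γ [A] :=
  .cons (List.append_nil Γ) f .nil

/-- The sequence of identities, for a given family of identity morphisms. -/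
def ids (one : (A : Ob) → Hom [A] A) : (As : List Ob) → HomSeq Hom As As
  | [] => .nil
  | A :: As => .cons (Γ := [A]) rfl (one A) (ids one As)

/-- Concatenation of sequences. -/
def append {Γ Δ As Bs : List Ob} : HomSeq Hom Γ As → HomSeq Hom Δ Bs →
    HomSeq Hom (Γ ++ Δ) (As ++ Bs)
  | .nil, q => q
  | .cons h f fs, q => .cons (by rw [← h, List.append_assoc]) f (append fs q)

/-- The (unique) way to cut a sequence with codomain `As ++ Bs` into two. -/
structure Split (Hom : List Ob → Ob → Type v) (Θ As Bs : List Ob) where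
  {Γ : List Ob}
  {Δ : List Ob}
  h : Γ ++ Δ = Θ
  fst : HomSeq Hom Γ As
  snd : HomSeq Hom Δ Bs

/-- Cut a sequence with codomain `As ++ Bs` into two. -/
def split : (As : List Ob) → {Bs Θ : List Ob} → HomSeq Hom Θ (As ++ Bs) → Split Hom Θ As Bs
  | [], _, _, p => ⟨List.nil_append _, .nil, p⟩
  | _ :: As, _, _, .cons h f fs =>
    ⟨by rw [List.append_assoc, (split As fs).h, h], .cons rfl f (split As fs).fst,
      (split As fs).snd⟩

/-- Composition of sequences, for a given composition operation of single morphisms. -/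
def comp (c : {Γ As : List Ob} → {B : Ob} → HomSeq Hom Γ As → Hom As B → Hom Γ B) :
    {Γ Δ As : List Ob} → HomSeq Hom Γ Δ → HomSeq Hom Δ As → HomSeq Hom Γ As
  | _, _, _, p, .nil => p
  | _, _, _, p, .cons (Γ := Δ₁) h f fs =>
    let s := split Δ₁ (h ▸ p)
    .cons s.h (c s.fst f) (comp c s.snd fs)

end HomSeq

/-- (Planar, i.e. non-symmetric) multicategories. `comp gs f` is `f ∘ (g₁, …, gₙ)`. -/
structure Multicategory where
  Ob : Type u
  Hom : List Ob → Ob → Type v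
  one : (A : Ob) → Hom [A] A
  comp : {Γ As : List Ob} → {B : Ob} → HomSeq Hom Γ As → Hom As B → Hom Γ B
  one_comp : ∀ {As : List Ob} {B : Ob} (f : Hom As B), comp (HomSeq.ids one As) f = f
  comp_one : ∀ {Γ : List Ob} {B : Ob} (f : Hom Γ B), comp (HomSeq.single f) (one B) = f
  assoc : ∀ {Γ Δ As : List Ob} {B : Ob} (hs : HomSeq Hom Γ Δ) (gs : HomSeq Hom Δ As)
    (f : Hom As B), comp hs (comp gs f) = comp (HomSeq.comp comp hs gs) f

/-! ### Strict monoidal categories, and the free one on a multicategory -/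

/-- Strict monoidal categories. -/
structure StrictMonCat where
  Ob : Type u
  [monoid : Monoid Ob]
  [category : Category.{v} Ob]
  tensor : {X Y X' Y' P Q : Ob} → X * X' = P → Y * Y' = Q → (X ⟶ Y) → (X' ⟶ Y') → (P ⟶ Q)
  tensor_id : ∀ (X Y : Ob), tensor rfl rfl (𝟙 X) (𝟙 Y) = 𝟙 (X * Y)
  tensor_comp : ∀ {X Y Z X' Y' Z' : Ob} (f : X ⟶ Y) (g : Y ⟶ Z) (f' : X' ⟶ Y') (g' : Y' ⟶ Z'),
    tensor rfl rfl (f ≫ g) (f' ≫ g') = tensor rfl rfl f f' ≫ tensor rfl rfl g g'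
  unit_tensor : ∀ {X Y : Ob} (f : X ⟶ Y), tensor (one_mul X) (one_mul Y) (𝟙 1) f = f
  tensor_unit : ∀ {X Y : Ob} (f : X ⟶ Y), tensor (mul_one X) (mul_one Y) f (𝟙 1) = f
  tensor_assoc : ∀ {X Y X' Y' X'' Y'' : Ob} (f : X ⟶ Y) (g : X' ⟶ Y') (h : X'' ⟶ Y''),
    tensor rfl rfl (tensor rfl rfl f g) h =
      tensor (mul_assoc X X' X'').symm (mul_assoc Y Y' Y'').symm f (tensor rfl rfl g h)

attribute [instance] StrictMonCat.monoid StrictMonCat.category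

namespace HomSeq

variable {Ob : Type u} {Hom : List Ob → Ob → Type v}

/-- Transport along equalities of the domain and of the codomain. -/
def cast {Γ Γ' As As' : List Ob} (hΓ : Γ = Γ') (hA : As = As') (p : HomSeq Hom Γ As) :
    HomSeq Hom Γ' As' := hΓ ▸ hA ▸ p

theorem cons_cast {Γ D D' E E' T T' : List Ob} {A : Ob} (hD : D = D') (hE : E = E') (hT : T = T')
    (h : Γ ++ D = T) (h' : Γ ++ D' = T') (f : Hom Γ A) (p : HomSeq Hom D E) :
    cons h' f (cast hD hE p) = cast hT (congrArg (A :: ·) hE) (cons h f p) := by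
  subst hD hE hT; rfl

theorem append_assoc {Γ As Δ Bs Θ Cs : List Ob} (p : HomSeq Hom Γ As) (q : HomSeq Hom Δ Bs)
    (r : HomSeq Hom Θ Cs) :
    append (append p q) r =
      cast (List.append_assoc _ _ _).symm (List.append_assoc _ _ _).symm
        (append p (append q r)) := by
  induction p with
  | nil => rfl
  | cons h f fs ih =>
    subst h
    simp only [append, ih]
    exact cons_cast _ _ _ _ _ _ _

theorem append_nil {Γ As : List Ob} (p : HomSeq Hom Γ As) :
    cast (List.append_nil _) (List.append_nil _) (append p .nil) = p := by
  induction p with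
  | nil => rfl
  | cons h f fs ih =>
    subst h
    conv_rhs => rw [← ih]
    exact (cons_cast _ _ _ _ _ _ _).symm

theorem ids_append (one : (A : Ob) → Hom [A] A) (As Bs : List Ob) :
    ids one (As ++ Bs) = append (ids one As) (ids one Bs) := by
  induction As with
  | nil => rfl
  | cons A As ih => simp [ids, append, ih]

theorem exists_append {Θ Cs : List Ob} (p : HomSeq Hom Θ Cs) (As : List Ob) {Bs : List Ob}
    (h : As ++ Bs = Cs) : ∃ (Γ Δ : List Ob) (hD : Γ ++ Δ = Θ) (p₁ : HomSeq Hom Γ As)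
      (p₂ : HomSeq Hom Δ Bs), p = cast hD h (append p₁ p₂) := by
  subst h
  induction As generalizing Θ with
  | nil => exact ⟨[], Θ, rfl, .nil, p, rfl⟩
  | cons A As ih =>
    cases p with
    | cons h f fs =>
      obtain ⟨Γ, Δ, hD, p₁, p₂, rfl⟩ := ih fs
      subst hD h
      exact ⟨_, Δ, List.append_assoc _ _ _, .cons rfl f p₁, p₂, cons_cast _ _ _ _ _ _ _⟩

theorem split_append {Γ Δ As Bs : List Ob} (p : HomSeq Hom Γ As) (q : HomSeq Hom Δ Bs) :
    split As (append p q) = ⟨rfl, p, q⟩ := by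
  induction p with
  | nil => rfl
  | cons h f fs ih =>
    subst h
    exact congrArg (fun s : Split Hom _ _ _ =>
      (⟨by rw [List.append_assoc, s.h, List.append_assoc], .cons rfl f s.fst, s.snd⟩ : Split Hom _ _ _)) ih

theorem comp_cons (c : {Γ As : List Ob} → {B : Ob} → HomSeq Hom Γ As → Hom As B → Hom Γ B)
    {Γ Δ Θ Γ₁ Δ₁ Θ₁ As : List Ob} {A : Ob} (hD : Γ ++ Δ = Θ) (h : Γ₁ ++ Δ₁ = Θ₁)
    (p₁ : HomSeq Hom Γ Γ₁) (p₂ : HomSeq Hom Δ Δ₁) (f : Hom Γ₁ A) (fs : HomSeq Hom Δ₁ As) :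
    comp c (cast hD h (append p₁ p₂)) (.cons h f fs) = .cons hD (c p₁ f) (comp c p₂ fs) := by
  subst hD h
  exact congrArg (fun s : Split Hom _ _ _ => cons s.h (c s.fst f) (comp c s.snd fs))
    (split_append p₁ p₂)

theorem comp_append (c : {Γ As : List Ob} → {B : Ob} → HomSeq Hom Γ As → Hom As B → Hom Γ B)
    {Γ Δ As Γ' Δ' As' : List Ob} (p : HomSeq Hom Γ Δ) (r : HomSeq Hom Δ As)
    (q : HomSeq Hom Γ' Δ') (s : HomSeq Hom Δ' As') :
    comp c (append p q) (append r s) = append (comp c p r) (comp c q s) := by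
  induction r generalizing Γ with
  | nil => cases p; rfl
  | @cons Γ₁ Δ₁ Θ₁ A As h f fs ih =>
    obtain ⟨G, D, hD, p₁, p₂, rfl⟩ := exists_append p Γ₁ h
    subst hD h
    rw [comp_cons]
    simp only [append, ← ih]
    rw [← comp_cons c]
    · congr 1
      exact append_assoc p₁ p₂ q

end HomSeq

/-- The free strict monoidal category on a multicategory: objects are lists of objects, morphisms
are sequences of morphisms, and the tensor product is concatenation. -/
def freeMonoidal (M : Multicategory.{u, v}) : StrictMonCat.{u, max u v} where
  Ob := List M.Ob
  monoid := inferInstanceAs (Monoid (FreeMonoid M.Ob))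
  category :=
    { Hom := HomSeq M.Hom
      id := HomSeq.ids M.one
      comp := HomSeq.comp M.comp
      id_comp := by
        intro X Y f
        induction f with
        | nil => rfl
        | cons h f fs ih =>
          subst h
          rw [HomSeq.ids_append]
          refine (HomSeq.comp_cons M.comp rfl rfl _ _ f fs).trans ?_
          rw [ih, M.one_comp]
      comp_id := by
        intro X Y f
        induction f with
        | nil => rfl
        | @cons Γ Δ Θ A As h f fs ih =>
          subst h
          have := HomSeq.comp_cons M.comp (Γ₁ := [A]) rfl rfl (HomSeq.single f) fs (M.one A)
            (HomSeq.ids M.one As)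
          rw [ih, M.comp_one] at this
          refine Eq.trans ?_ this
          rfl
      assoc := by
        intro X Y Z W p q r
        induction r generalizing X Y with
        | nil => rfl
        | cons h f fs ih =>
          obtain ⟨G, D, hD, q₁, q₂, rfl⟩ := HomSeq.exists_append q _ h
          obtain ⟨G', D', hD', p₁, p₂, rfl⟩ := HomSeq.exists_append p _ hD
          subst hD' hD h
          rw [HomSeq.comp_cons, HomSeq.comp_cons]
          have := HomSeq.comp_append M.comp p₁ q₁ p₂ q₂
          refine (congrArg (fun x => HomSeq.comp M.comp x _) this).trans ?_
          refine (HomSeq.comp_cons M.comp rfl rfl _ _ f fs).trans ?_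
          rw [ih, M.assoc] }
  tensor hP hQ f g := HomSeq.cast hP hQ (HomSeq.append f g)
  tensor_id X Y := (HomSeq.ids_append M.one X Y).symm
  tensor_comp f g f' g' := (HomSeq.comp_append M.comp f g f' g').symm
  unit_tensor f := rfl
  tensor_unit f := HomSeq.append_nil f
  tensor_assoc f g h := HomSeq.append_assoc f g h

/-! ### Single-object strict double categories -/

/-- Single-object strict double categories. `Cell U A B W` is the set of cells with left boundary
`U`, top boundary `A`, bottom boundary `B` and right boundary `W`. -/
structure DoubleCat where
  Hor : Type u₁
  Vert : Type u₂
  [horMonoid : Monoid Hor]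
  [vertMonoid : Monoid Vert]
  Cell : Vert → Hor → Hor → Vert → Type w
  vid : (A : Hor) → Cell 1 A A 1
  hid : (U : Vert) → Cell U 1 1 U
  vcomp : {U U' U'' W W' W'' : Vert} → {A B C : Hor} → U * U' = U'' → W * W' = W'' →
    Cell U A B W → Cell U' B C W' → Cell U'' A C W''
  hcomp : {U W V : Vert} → {A A' A'' B B' B'' : Hor} → A * A' = A'' → B * B' = B'' →
    Cell U A B W → Cell W A' B' V → Cell U A'' B'' V
  vid_vcomp : ∀ {U W : Vert} {A B : Hor} (a : Cell U A B W),
    vcomp (one_mul U) (one_mul W) (vid A) a = a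
  vcomp_vid : ∀ {U W : Vert} {A B : Hor} (a : Cell U A B W),
    vcomp (mul_one U) (mul_one W) a (vid B) = a
  hid_hcomp : ∀ {U W : Vert} {A B : Hor} (a : Cell U A B W),
    hcomp (one_mul A) (one_mul B) (hid U) a = a
  hcomp_hid : ∀ {U W : Vert} {A B : Hor} (a : Cell U A B W),
    hcomp (mul_one A) (mul_one B) a (hid W) = a
  vcomp_assoc : ∀ {U U' U'' W W' W'' : Vert} {A B C D : Hor} (a : Cell U A B W)
    (b : Cell U' B C W') (c : Cell U'' C D W''),
    vcomp rfl rfl (vcomp rfl rfl a b) c =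
      vcomp (mul_assoc U U' U'').symm (mul_assoc W W' W'').symm a (vcomp rfl rfl b c)
  hcomp_assoc : ∀ {U V W X : Vert} {A A' A'' B B' B'' : Hor} (a : Cell U A B V)
    (b : Cell V A' B' W) (c : Cell W A'' B'' X),
    hcomp rfl rfl (hcomp rfl rfl a b) c =
      hcomp (mul_assoc A A' A'').symm (mul_assoc B B' B'').symm a (hcomp rfl rfl b c)
  interchange : ∀ {U V W U' V' W' : Vert} {A B C A' B' C' : Hor} (a : Cell U A B V)
    (b : Cell V A' B' W) (c : Cell U' B C V') (d : Cell V' B' C' W'),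
    vcomp rfl rfl (hcomp rfl rfl a b) (hcomp rfl rfl c d) =
      hcomp rfl rfl (vcomp rfl rfl a c) (vcomp rfl rfl b d)
  hid_one : hid 1 = vid 1
  hid_mul : ∀ U W : Vert, vcomp rfl rfl (hid U) (hid W) = hid (U * W)
  vid_mul : ∀ A B : Hor, hcomp rfl rfl (vid A) (vid B) = vid (A * B)

attribute [instance] DoubleCat.horMonoid DoubleCat.vertMonoid

/-- Transport of a cell along an equality of top boundaries. -/
def DoubleCat.castTop (X : DoubleCat.{w, u₁, u₂}) {U W : X.Vert} {A A' B : X.Hor} (h : A = A')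
    (a : X.Cell U A B W) : X.Cell U A' B W := h ▸ a

/-! ### The free cornering -/

/-- `circ` is the polarity `∘`, and `bullet` is the polarity `•`. -/
inductive Polarity
  | circ
  | bullet

/-- The `X`-valued exchanges: the free monoid on `X × {∘, •}`, as lists. -/
abbrev Exch (X : Type u) : Type u := List (X × Polarity)

/-- The exchange `A^∘`. -/
abbrev Exch.circ {X : Type u} (A : X) : Exch X := [(A, .circ)]

/-- The exchange `A^•`. -/
abbrev Exch.bullet {X : Type u} (A : X) : Exch X := [(A, .bullet)]

/-- Formal expressions for the cells of the free cornering: `CellExpr 𝔸 U A B W` has left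
boundary `U`, top boundary `A`, bottom boundary `B` and right boundary `W`. -/
inductive CellExpr (𝔸 : StrictMonCat.{u, v}) :
    Exch 𝔸.Ob → 𝔸.Ob → 𝔸.Ob → Exch 𝔸.Ob → Type (max u v)
  /-- the cell given by a morphism -/
  | corner {A B : 𝔸.Ob} (f : A ⟶ B) : CellExpr 𝔸 [] A B []
  /-- `A⌝`: receive `A` along the left boundary -/
  | receiveL (A : 𝔸.Ob) : CellExpr 𝔸 (Exch.circ A) 1 A []
  /-- `A⌞`: send `A` along the right boundary -/
  | sendR (A : 𝔸.Ob) : CellExpr 𝔸 [] A 1 (Exch.circ A)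
  /-- `A⌜`: receive `A` along the right boundary -/
  | receiveR (A : 𝔸.Ob) : CellExpr 𝔸 [] 1 A (Exch.bullet A)
  /-- `A⌟`: send `A` along the left boundary -/
  | sendL (A : 𝔸.Ob) : CellExpr 𝔸 (Exch.bullet A) A 1 []
  | vid (A : 𝔸.Ob) : CellExpr 𝔸 [] A A []
  | hid (U : Exch 𝔸.Ob) : CellExpr 𝔸 U 1 1 U
  | vcomp {U U' U'' W W' W'' : Exch 𝔸.Ob} {A B C : 𝔸.Ob} (hU : U ++ U' = U'')
      (hW : W ++ W' = W'') (a : CellExpr 𝔸 U A B W) (b : CellExpr 𝔸 U' B C W') :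
      CellExpr 𝔸 U'' A C W''
  | hcomp {U W V : Exch 𝔸.Ob} {A A' A'' B B' B'' : 𝔸.Ob} (hA : A * A' = A'')
      (hB : B * B' = B'') (a : CellExpr 𝔸 U A B W) (b : CellExpr 𝔸 W A' B' V) :
      CellExpr 𝔸 U A'' B'' V

open CellExpr in
/-- The congruence on formal expressions generated by the equations of the free cornering. -/
inductive CellRel (𝔸 : StrictMonCat.{u, v}) : {U W : Exch 𝔸.Ob} → {A B : 𝔸.Ob} →
    CellExpr 𝔸 U A B W → CellExpr 𝔸 U A B W → Prop
  -- equivalence and congruence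
  | refl {U W : Exch 𝔸.Ob} {A B : 𝔸.Ob} (a : CellExpr 𝔸 U A B W) : CellRel 𝔸 a a
  | symm {U W : Exch 𝔸.Ob} {A B : 𝔸.Ob} {a b : CellExpr 𝔸 U A B W} :
      CellRel 𝔸 a b → CellRel 𝔸 b a
  | trans {U W : Exch 𝔸.Ob} {A B : 𝔸.Ob} {a b c : CellExpr 𝔸 U A B W} :
      CellRel 𝔸 a b → CellRel 𝔸 b c → CellRel 𝔸 a c
  | vcomp_congr {U U' U'' W W' W'' : Exch 𝔸.Ob} {A B C : 𝔸.Ob} (hU : U ++ U' = U'')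
      (hW : W ++ W' = W'') {a a' : CellExpr 𝔸 U A B W} {b b' : CellExpr 𝔸 U' B C W'} :
      CellRel 𝔸 a a' → CellRel 𝔸 b b' → CellRel 𝔸 (vcomp hU hW a b) (vcomp hU hW a' b')
  | hcomp_congr {U W V : Exch 𝔸.Ob} {A A' A'' B B' B'' : 𝔸.Ob} (hA : A * A' = A'')
      (hB : B * B' = B'') {a a' : CellExpr 𝔸 U A B W} {b b' : CellExpr 𝔸 W A' B' V} :
      CellRel 𝔸 a a' → CellRel 𝔸 b b' → CellRel 𝔸 (hcomp hA hB a b) (hcomp hA hB a' b')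
  -- equations for the cells given by morphisms
  | corner_comp {A B C : 𝔸.Ob} (f : A ⟶ B) (g : B ⟶ C) :
      CellRel 𝔸 (vcomp rfl rfl (corner f) (corner g)) (corner (f ≫ g))
  | corner_tensor {A B A' B' : 𝔸.Ob} (f : A ⟶ B) (g : A' ⟶ B') :
      CellRel 𝔸 (hcomp rfl rfl (corner f) (corner g)) (corner (𝔸.tensor rfl rfl f g))
  | vid_eq (A : 𝔸.Ob) : CellRel 𝔸 (vid A) (corner (𝟙 A))
  -- yanking equations
  | yank_circ_hor (A : 𝔸.Ob) :
      CellRel 𝔸 (hcomp (mul_one A) (one_mul A) (sendR A) (receiveL A)) (vid A)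
  | yank_bullet_hor (A : 𝔸.Ob) :
      CellRel 𝔸 (hcomp (one_mul A) (mul_one A) (receiveR A) (sendL A)) (vid A)
  | yank_circ_vert (A : 𝔸.Ob) :
      CellRel 𝔸 (vcomp rfl rfl (receiveL A) (sendR A)) (hid (Exch.circ A))
  | yank_bullet_vert (A : 𝔸.Ob) :
      CellRel 𝔸 (vcomp rfl rfl (receiveR A) (sendL A)) (hid (Exch.bullet A))
  -- axioms of a double category
  | vid_vcomp {U W : Exch 𝔸.Ob} {A B : 𝔸.Ob} (a : CellExpr 𝔸 U A B W) :
      CellRel 𝔸 (vcomp (List.nil_append U) (List.nil_append W) (vid A) a) a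
  | vcomp_vid {U W : Exch 𝔸.Ob} {A B : 𝔸.Ob} (a : CellExpr 𝔸 U A B W) :
      CellRel 𝔸 (vcomp (List.append_nil U) (List.append_nil W) a (vid B)) a
  | vcomp_assoc {U U' U'' W W' W'' : Exch 𝔸.Ob} {A B C D : 𝔸.Ob} (a : CellExpr 𝔸 U A B W)
      (b : CellExpr 𝔸 U' B C W') (c : CellExpr 𝔸 U'' C D W'') :
      CellRel 𝔸 (vcomp rfl rfl (vcomp rfl rfl a b) c)
        (vcomp (List.append_assoc U U' U'').symm (List.append_assoc W W' W'').symm a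
          (vcomp rfl rfl b c))
  | hid_hcomp {U W : Exch 𝔸.Ob} {A B : 𝔸.Ob} (a : CellExpr 𝔸 U A B W) :
      CellRel 𝔸 (hcomp (one_mul A) (one_mul B) (hid U) a) a
  | hcomp_hid {U W : Exch 𝔸.Ob} {A B : 𝔸.Ob} (a : CellExpr 𝔸 U A B W) :
      CellRel 𝔸 (hcomp (mul_one A) (mul_one B) a (hid W)) a
  | hcomp_assoc {U V W X : Exch 𝔸.Ob} {A A' A'' B B' B'' : 𝔸.Ob} (a : CellExpr 𝔸 U A B V)
      (b : CellExpr 𝔸 V A' B' W) (c : CellExpr 𝔸 W A'' B'' X) :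
      CellRel 𝔸 (hcomp rfl rfl (hcomp rfl rfl a b) c)
        (hcomp (mul_assoc A A' A'').symm (mul_assoc B B' B'').symm a (hcomp rfl rfl b c))
  | interchange {U V W U' V' W' : Exch 𝔸.Ob} {A B C A' B' C' : 𝔸.Ob} (a : CellExpr 𝔸 U A B V)
      (b : CellExpr 𝔸 V A' B' W) (c : CellExpr 𝔸 U' B C V') (d : CellExpr 𝔸 V' B' C' W') :
      CellRel 𝔸 (vcomp rfl rfl (hcomp rfl rfl a b) (hcomp rfl rfl c d))
        (hcomp rfl rfl (vcomp rfl rfl a c) (vcomp rfl rfl b d))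
  | hid_nil : CellRel 𝔸 (hid []) (vid 1)
  | hid_append (U W : Exch 𝔸.Ob) :
      CellRel 𝔸 (vcomp rfl rfl (hid U) (hid W)) (hid (U ++ W))

/-- The setoid of formal expressions modulo the equations. -/
def cellSetoid (𝔸 : StrictMonCat.{u, v}) (U : Exch 𝔸.Ob) (A B : 𝔸.Ob) (W : Exch 𝔸.Ob) :
    Setoid (CellExpr 𝔸 U A B W) where
  r := CellRel 𝔸
  iseqv := ⟨.refl, .symm, .trans⟩

/-- The free cornering of a strict monoidal category. -/
def freeCornering (𝔸 : StrictMonCat.{u, v}) : DoubleCat.{max u v, u, u} where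
  Hor := 𝔸.Ob
  Vert := Exch 𝔸.Ob
  vertMonoid := inferInstanceAs (Monoid (FreeMonoid (𝔸.Ob × Polarity)))
  Cell U A B W := Quotient (cellSetoid 𝔸 U A B W)
  vid A := ⟦.vid A⟧
  hid U := ⟦.hid U⟧
  vcomp hU hW := Quotient.map₂ (.vcomp hU hW) fun _ _ h _ _ h' => .vcomp_congr hU hW h h'
  hcomp hA hB := Quotient.map₂ (.hcomp hA hB) fun _ _ h _ _ h' => .hcomp_congr hA hB h h'
  vid_vcomp := by rintro _ _ _ _ ⟨a⟩; exact Quotient.sound (.vid_vcomp a)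
  vcomp_vid := by rintro _ _ _ _ ⟨a⟩; exact Quotient.sound (.vcomp_vid a)
  hid_hcomp := by rintro _ _ _ _ ⟨a⟩; exact Quotient.sound (.hid_hcomp a)
  hcomp_hid := by rintro _ _ _ _ ⟨a⟩; exact Quotient.sound (.hcomp_hid a)
  vcomp_assoc := by
    rintro _ _ _ _ _ _ _ _ _ _ ⟨a⟩ ⟨b⟩ ⟨c⟩; exact Quotient.sound (.vcomp_assoc a b c)
  hcomp_assoc := by
    rintro _ _ _ _ _ _ _ _ _ _ ⟨a⟩ ⟨b⟩ ⟨c⟩; exact Quotient.sound (.hcomp_assoc a b c)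
  interchange := by
    rintro _ _ _ _ _ _ _ _ _ _ _ _ ⟨a⟩ ⟨b⟩ ⟨c⟩ ⟨d⟩
    exact Quotient.sound (.interchange a b c d)
  hid_one := Quotient.sound .hid_nil
  hid_mul U W := Quotient.sound (.hid_append U W)
  vid_mul A B := Quotient.sound <|
    (CellRel.hcomp_congr rfl rfl (.vid_eq A) (.vid_eq B)).trans <|
      (CellRel.corner_tensor _ _).trans <| by rw [𝔸.tensor_id]; exact .symm (.vid_eq _)

/-! ### Single-object virtual double categories -/

/-- Cell paths: `CellPath Cell U Γ As W` is the set of sequences `(a₁, …, aₙ)` of cells `aᵢ` with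
left boundary `Uᵢ₋₁`, top boundary `Γᵢ`, bottom boundary `Aᵢ` and right boundary `Uᵢ`, where
`U₀ = U`, `Uₙ = W`, `Γ = Γ₁, …, Γₙ` and `As = A₁, …, Aₙ`. -/
inductive CellPath {E : Type u₁} {H : Type u₂} (Cell : E → List H → H → E → Type w) :
    E → List H → List H → E → Type (max u₁ u₂ w)
  | nil (U : E) : CellPath Cell U [] [] U
  | cons {U V W : E} {Γ Δ Θ : List H} {A : H} {As : List H} (h : Γ ++ Δ = Θ)
      (a : Cell U Γ A V) (p : CellPath Cell V Δ As W) : CellPath Cell U Θ (A :: As) W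

namespace CellPath

variable {E : Type u₁} {H : Type u₂} {Cell : E → List H → H → E → Type w}

/-- The path with one entry. -/
def single {U W : E} {Γ : List H} {A : H} (a : Cell U Γ A W) : CellPath Cell U Γ [A] W :=
  .cons (List.append_nil Γ) a (.nil W)

/-- Concatenation of paths. -/
def append {U V W : E} {Γ Δ Θ As Bs : List H} (h : Γ ++ Δ = Θ) :
    CellPath Cell U Γ As V → CellPath Cell V Δ Bs W → CellPath Cell U Θ (As ++ Bs) W
  | .nil _, q => h ▸ q
  | .cons (Γ := Γ₁) h' a p, q =>
    .cons (by rw [← h, ← h', List.append_assoc]) a (append rfl p q)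

/-- The path of identities, for a given family of identity cells. -/
def ids {e : E} (one : (A : H) → Cell e [A] A e) : (As : List H) → CellPath Cell e As As e
  | [] => .nil e
  | A :: As => .cons (Γ := [A]) rfl (one A) (ids one As)

/-- The (unique) way to cut a path with bottom boundary `As ++ Bs` into two. -/
structure Split (Cell : E → List H → H → E → Type w) (U : E) (Θ As Bs : List H) (W : E) where
  {Γ : List H}
  {Δ : List H}
  {mid : E}
  h : Γ ++ Δ = Θ
  fst : CellPath Cell U Γ As mid
  snd : CellPath Cell mid Δ Bs W

/-- Cut a path with bottom boundary `As ++ Bs` into two. -/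
def split : (As : List H) → {Bs Θ : List H} → {U W : E} → CellPath Cell U Θ (As ++ Bs) W →
    Split Cell U Θ As Bs W
  | [], _, _, U, _, p => ⟨List.nil_append _, .nil U, p⟩
  | _ :: As, _, _, _, _, .cons h a p =>
    ⟨by rw [List.append_assoc, (split As p).h, h], .cons rfl a (split As p).fst,
      (split As p).snd⟩

/-- Composition of paths, for a given composition operation `c gs f = f ∘ (g₁, …, gₙ)`: the path
`comp c hs (g₁, …, gₙ)` is `(g₁ ∘ (h₁¹, …, h₁ᵏ), …, gₙ ∘ (hₙ¹, …, hₙˡ))`. -/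
def comp [Monoid E] (c : {U W P Q : E} → {Γ As : List H} → {B : H} → CellPath Cell U Γ As W →
      Cell P As B Q → Cell (U * P) Γ B (W * Q)) :
    {U W P Q : E} → {Γ Δ As : List H} → CellPath Cell U Γ Δ W → CellPath Cell P Δ As Q →
      CellPath Cell (U * P) Γ As (W * Q)
  | _, _, _, _, _, _, _, hs, .nil P => match hs with
    | .nil U => .nil (U * P)
  | _, _, _, _, _, _, _, hs, .cons (Γ := Δ₁) h g gs =>
    let s := split Δ₁ (h ▸ hs)
    .cons s.h (c s.fst g) (comp c s.snd gs)

/-- Apply a map of cells to every entry of a path. -/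
def map {E' : Type v₁} {H' : Type v₂} {Cell' : E' → List H' → H' → E' → Type v}
    (ver : E → E') (hor : H → H') (F : {U W : E} → {Γ : List H} → {A : H} → Cell U Γ A W →
      Cell' (ver U) (Γ.map hor) (hor A) (ver W)) :
    {U W : E} → {Γ As : List H} → CellPath Cell U Γ As W →
      CellPath Cell' (ver U) (Γ.map hor) (As.map hor) (ver W)
  | _, _, _, _, .nil U => .nil (ver U)
  | _, _, _, _, .cons h a p => .cons (by rw [← h, List.map_append]) (F a) (map ver hor F p)

end CellPath

/-- The data of a single-object virtual double category; the laws are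
`IsVirtualDoubleCategory`. `comp gs f` is `f ∘ (g₁, …, gₙ)`. -/
structure VirtualDoubleData where
  Hor : Type u₁
  Vert : Type u₂
  [vertMonoid : Monoid Vert]
  Cell : Vert → List Hor → Hor → Vert → Type w
  one : (A : Hor) → Cell 1 [A] A 1
  comp : {U P U' W Q W' : Vert} → {Γ As : List Hor} → {B : Hor} → U * P = U' → W * Q = W' →
    CellPath Cell U Γ As W → Cell P As B Q → Cell U' Γ B W'

attribute [instance] VirtualDoubleData.vertMonoid

/-- The axioms of a single-object virtual double category. -/
structure IsVirtualDoubleCategory (X : VirtualDoubleData.{w, u₁, u₂}) : Prop where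
  assoc : ∀ {U W V V' P Q : X.Vert} {Γ Δ As : List X.Hor} {B : X.Hor}
    (hs : CellPath X.Cell U Γ Δ W) (gs : CellPath X.Cell V Δ As V') (f : X.Cell P As B Q),
    X.comp (mul_assoc U V P) (mul_assoc W V' Q) (CellPath.comp (X.comp rfl rfl) hs gs) f =
      X.comp rfl rfl hs (X.comp rfl rfl gs f)
  ones_comp : ∀ {U W : X.Vert} {As : List X.Hor} {B : X.Hor} (f : X.Cell U As B W),
    X.comp (one_mul U) (one_mul W) (CellPath.ids X.one As) f = f
  comp_one : ∀ {U W : X.Vert} {As : List X.Hor} {B : X.Hor} (f : X.Cell U As B W),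
    X.comp (mul_one U) (mul_one W) (CellPath.single f) (X.one B) = f

/-- A map of horizontal edges, a map of vertical edges and a map of cells form a functor of
single-object virtual double categories. -/
structure IsVirtualDoubleFunctor (X : VirtualDoubleData.{w, u₁, u₂})
    (Y : VirtualDoubleData.{v, v₁, v₂}) (hor : X.Hor → Y.Hor) (ver : X.Vert → Y.Vert)
    (F : {U W : X.Vert} → {Γ : List X.Hor} → {B : X.Hor} → X.Cell U Γ B W →
      Y.Cell (ver U) (Γ.map hor) (hor B) (ver W)) : Prop where
  ver_one : ver 1 = 1
  ver_mul : ∀ U W : X.Vert, ver (U * W) = ver U * ver W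
  map_one : ∀ A : X.Hor, HEq (F (X.one A)) (Y.one (hor A))
  map_comp : ∀ {U P U' W Q W' : X.Vert} {Γ As : List X.Hor} {B : X.Hor} (hU : U * P = U')
    (hW : W * Q = W') (gs : CellPath X.Cell U Γ As W) (f : X.Cell P As B Q),
    F (X.comp hU hW gs f) =
      Y.comp (by rw [← ver_mul, hU]) (by rw [← ver_mul, hW]) (gs.map ver hor F) (F f)

/-- The cells of the underlying virtual double category of a double category. -/
abbrev DoubleCat.VirtualCell (X : DoubleCat.{w, u₁, u₂}) (U : X.Vert) (Γ : List X.Hor)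
    (B : X.Hor) (W : X.Vert) : Type w := X.Cell U Γ.prod B W

/-- The horizontal composite `a₁ | ⋯ | aₙ` of a path, which is `id_U` for the empty path at `U`. -/
def DoubleCat.hcompPath (X : DoubleCat.{w, u₁, u₂}) : {U W : X.Vert} → {Γ As : List X.Hor} →
    CellPath X.VirtualCell U Γ As W → X.Cell U Γ.prod As.prod W
  | _, _, _, _, .nil U => X.hid U
  | _, _, _, _, .cons h a p =>
    X.hcomp (by rw [← h, List.prod_append]) List.prod_cons.symm a (X.hcompPath p)

/-- The underlying virtual double category of a double category. -/
abbrev DoubleCat.toVirtual (X : DoubleCat.{w, u₁, u₂}) : VirtualDoubleData.{w, u₁, u₂} where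
  Hor := X.Hor
  Vert := X.Vert
  Cell := X.VirtualCell
  one A := X.castTop List.prod_singleton.symm (X.vid A)
  comp hU hW gs f := X.vcomp hU hW (X.hcompPath gs) f

/-! ### The term calculus -/

/-- Terms of the calculus, as derivations: `Term M U Γ B W` is the set of derivations of
`Γ ⊩ t : (U, B, W)`. Variables are not named: the variables of a context are told apart by their
position, and binding removes the first or the last position.

In `letIn` the sequence of bound terms is nonempty; an empty one is admitted only between empty
boundaries, where the rule for neutral sequences removes it. -/
inductive Term (M : Multicategory.{u, v}) :
    Exch M.Ob → List M.Ob → M.Ob → Exch M.Ob → Type (max u v)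
  | neutral {Γ : List M.Ob} {A : M.Ob} (v : M.Hom Γ A) : Term M [] Γ A []
  | letIn {U P U' W Q W' : Exch M.Ob} {Γ As : List M.Ob} {B : M.Ob} (hU : U ++ P = U')
      (hW : W ++ Q = W') (hn : As = [] → U = []) (ts : CellPath (Term M) U Γ As W)
      (t : Term M P As B Q) : Term M U' Γ B W'
  | putR {U W : Exch M.Ob} {Δ Γ Θ : List M.Ob} {A B : M.Ob} (h : Δ ++ Γ = Θ)
      (v : M.Hom Γ A) (t : Term M U Δ B W) : Term M U Θ B ((A, .circ) :: W)
  | getL {U W : Exch M.Ob} {Γ : List M.Ob} {A B : M.Ob} (t : Term M U (A :: Γ) B W) :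
      Term M ((A, .circ) :: U) Γ B W
  | getR {U W : Exch M.Ob} {Γ : List M.Ob} {A B : M.Ob} (t : Term M U (Γ ++ [A]) B W) :
      Term M U Γ B ((A, .bullet) :: W)
  | putL {U W : Exch M.Ob} {Γ Δ Θ : List M.Ob} {A B : M.Ob} (h : Γ ++ Δ = Θ)
      (v : M.Hom Γ A) (t : Term M U Δ B W) : Term M ((A, .bullet) :: U) Θ B W

namespace Term

variable {M : Multicategory.{u, v}}

mutual

/-- Value substitution `t[v₁, …, vₙ / x₁, …, xₙ]`. -/
def subst : {U W : Exch M.Ob} → {Γ Δ : List M.Ob} → {B : M.Ob} →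
    HomSeq M.Hom Γ Δ → Term M U Δ B W → Term M U Γ B W
  | _, _, _, _, _, vs, .neutral u => .neutral (M.comp vs u)
  | _, _, _, _, _, vs, .letIn hU hW hn ts t => .letIn hU hW hn (substPath vs ts) t
  | _, _, _, _, _, vs, .putR (Δ := Δ₁) h u t =>
    let s := HomSeq.split Δ₁ (h ▸ vs)
    .putR s.h (M.comp s.snd u) (subst s.fst t)
  | _, _, _, _, _, vs, .getL (A := A) t => .getL (subst (.cons (Γ := [A]) rfl (M.one A) vs) t)
  | _, _, _, _, _, vs, .getR (A := A) t => .getR (subst (vs.append (.single (M.one A))) t)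
  | _, _, _, _, _, vs, .putL (Γ := Γ₁) h u t =>
    let s := HomSeq.split Γ₁ (h ▸ vs)
    .putL s.h (M.comp s.fst u) (subst s.snd t)

/-- Value substitution in a sequence of terms. -/
def substPath : {U W : Exch M.Ob} → {Γ Δ As : List M.Ob} →
    HomSeq M.Hom Γ Δ → CellPath (Term M) U Δ As W → CellPath (Term M) U Γ As W
  | _, _, _, _, _, vs, .nil U => match vs with
    | .nil => .nil U
  | _, _, _, _, _, vs, .cons (Γ := Γ₁) h t ts =>
    let s := HomSeq.split Γ₁ (h ▸ vs)
    .cons s.h (subst s.fst t) (substPath s.snd ts)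

end

/-- `t[v / x]`, where `x` is the first variable of the context of `t`. -/
def substFirst {U W : Exch M.Ob} {Γ Δ : List M.Ob} {A B : M.Ob} (v : M.Hom Γ A)
    (t : Term M U (A :: Δ) B W) : Term M U (Γ ++ Δ) B W :=
  subst (.cons rfl v (HomSeq.ids M.one Δ)) t

/-- `t[v / x]`, where `x` is the last variable of the context of `t`. -/
def substLast {U W : Exch M.Ob} {Γ Δ : List M.Ob} {A B : M.Ob} (v : M.Hom Γ A)
    (t : Term M U (Δ ++ [A]) B W) : Term M U (Δ ++ Γ) B W :=
  subst ((HomSeq.ids M.one Δ).append (.single v)) t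

/-- The sequence of neutral terms `[v₁] | ⋯ | [vₙ]`. -/
def neutrals : {Γ As : List M.Ob} → HomSeq M.Hom Γ As → CellPath (Term M) [] Γ As []
  | _, _, .nil => .nil []
  | _, _, .cons h v vs => .cons h (.neutral v) (neutrals vs)

mutual

/-- The rewrite relation on terms: the generating rewrites `r0`, …, `r10`, closed under the term
constructors. -/
inductive Step : {U W : Exch M.Ob} → {Γ : List M.Ob} → {B : M.Ob} →
    Term M U Γ B W → Term M U Γ B W → Prop
  -- `let x₁, …, xₙ ↓ ([v₁] | ⋯ | [vₙ]) in t  →  t[v₁, …, vₙ / x₁, …, xₙ]`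
  | r0 {U W : Exch M.Ob} {Γ As : List M.Ob} {B : M.Ob} (vs : HomSeq M.Hom Γ As)
      (t : Term M U As B W) : Step (.letIn rfl rfl (fun _ => rfl) (neutrals vs) t) (subst vs t)
  -- `let x̄ ↓ (putL(v,t) | ā) in r  →  putL(v, let x̄ ↓ (t | ā) in r)`
  | r3 {U V W P Q U' W' : Exch M.Ob} {Φ Δ Γ Ξ Θ Ψ As : List M.Ob} {A B C : M.Ob}
      (hU : U ++ P = U') (hW : W ++ Q = W')
      (h₁ : Φ ++ Δ = Γ) (h₂ : Γ ++ Ξ = Θ) (h₃ : Δ ++ Ξ = Ψ) (h₄ : Φ ++ Ψ = Θ)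
      (v : M.Hom Φ A) (t : Term M U Δ B V) (ts : CellPath (Term M) V Ξ As W)
      (r : Term M P (B :: As) C Q) :
      Step (.letIn (congrArg ((A, .bullet) :: ·) hU) hW (by simp)
          (.cons h₂ (.putL h₁ v t) ts) r)
        (.putL h₄ v (.letIn hU hW (by simp) (.cons h₃ t ts) r))
  -- `let x̄ ↓ (getL(y.t) | ā) in r  →  getL(y. let x̄ ↓ (t | ā) in r)`
  | r4 {U V W P Q U' W' : Exch M.Ob} {Γ Ξ Θ As : List M.Ob} {A B C : M.Ob}
      (hU : U ++ P = U') (hW : W ++ Q = W') (h : Γ ++ Ξ = Θ)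
      (t : Term M U (A :: Γ) B V) (ts : CellPath (Term M) V Ξ As W)
      (r : Term M P (B :: As) C Q) :
      Step (.letIn (congrArg ((A, .circ) :: ·) hU) hW (by simp)
          (.cons h (.getL t) ts) r)
        (.getL (.letIn hU hW (by simp) (.cons (congrArg (A :: ·) h) t ts) r))
  -- `let x̄ ↓ (ā | putR(v,t)) in r  →  putR(v, let x̄ ↓ (ā | t) in r)`
  | r5 {U V W P Q U' W' : Exch M.Ob} {Φ Δ Γ Ξ Θ Ψ As : List M.Ob} {A B C : M.Ob}
      (hU : U ++ P = U') (hW : W ++ Q = W')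
      (h₁ : Δ ++ Φ = Γ) (h₂ : Ξ ++ Γ = Θ) (h₃ : Ξ ++ Δ = Ψ) (h₄ : Ψ ++ Φ = Θ)
      (ts : CellPath (Term M) U Ξ As V) (v : M.Hom Φ A) (t : Term M V Δ B W)
      (r : Term M P (As ++ [B]) C Q) :
      Step (.letIn hU (congrArg ((A, .circ) :: ·) hW) (by simp)
          (ts.append h₂ (.single (.putR h₁ v t))) r)
        (.putR h₄ v (.letIn hU hW (by simp) (ts.append h₃ (.single t)) r))
  -- `let x̄ ↓ (ā | getR(y.t)) in r  →  getR(y. let x̄ ↓ (ā | t) in r)`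
  | r6 {U V W P Q U' W' : Exch M.Ob} {Γ Ξ Θ As : List M.Ob} {A B C : M.Ob}
      (hU : U ++ P = U') (hW : W ++ Q = W') (h₁ : Ξ ++ Γ = Θ) (h₂ : Ξ ++ (Γ ++ [A]) = Θ ++ [A])
      (ts : CellPath (Term M) U Ξ As V) (t : Term M V (Γ ++ [A]) B W)
      (r : Term M P (As ++ [B]) C Q) :
      Step (.letIn hU (congrArg ((A, .bullet) :: ·) hW) (by simp)
          (ts.append h₁ (.single (.getR t))) r)
        (.getR (.letIn hU hW (by simp) (ts.append h₂ (.single t)) r))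
  -- `putR(v, putL(w,t))  →  putL(w, putR(v,t))`
  | r7 {U W : Exch M.Ob} {Γ Δ Φ Δ' Ψ Θ : List M.Ob} {A A' B : M.Ob}
      (h₁ : Φ ++ Δ = Δ') (h₂ : Δ' ++ Γ = Θ) (h₃ : Δ ++ Γ = Ψ) (h₄ : Φ ++ Ψ = Θ)
      (v : M.Hom Γ A) (w : M.Hom Φ A') (t : Term M U Δ B W) :
      Step (.putR h₂ v (.putL h₁ w t)) (.putL h₄ w (.putR h₃ v t))
  -- `putR(v, getL(x.t))  →  getL(x. putR(v,t))`
  | r8 {U W : Exch M.Ob} {Γ Δ Θ : List M.Ob} {A A' B : M.Ob} (h : Δ ++ Γ = Θ)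
      (v : M.Hom Γ A) (t : Term M U (A' :: Δ) B W) :
      Step (.putR h v (.getL t)) (.getL (.putR (congrArg (A' :: ·) h) v t))
  -- `getR(x. putL(v,t))  →  putL(v, getR(x.t))`, where `x` occurs in `t` and not in `v`
  | r9 {U W : Exch M.Ob} {Γ Δ Θ : List M.Ob} {A A' B : M.Ob}
      (h₁ : Γ ++ (Δ ++ [A']) = Θ ++ [A']) (h₂ : Γ ++ Δ = Θ)
      (v : M.Hom Γ A) (t : Term M U (Δ ++ [A']) B W) :
      Step (.getR (.putL h₁ v t)) (.putL h₂ v (.getR t))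
  -- `getR(x. getL(y.t))  →  getL(y. getR(x.t))`
  | r10 {U W : Exch M.Ob} {Γ : List M.Ob} {A A' B : M.Ob}
      (t : Term M U (A' :: (Γ ++ [A])) B W) :
      Step (.getR (.getL t)) (.getL (.getR (Γ := A' :: Γ) t))
  -- closure under the term constructors
  | letIn_args {U P U' W Q W' : Exch M.Ob} {Γ As : List M.Ob} {B : M.Ob} (hU : U ++ P = U')
      (hW : W ++ Q = W') (hn : As = [] → U = []) {ts ts' : CellPath (Term M) U Γ As W}
      (t : Term M P As B Q) :
      StepPath ts ts' → Step (.letIn hU hW hn ts t) (.letIn hU hW hn ts' t)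
  | letIn_body {U P U' W Q W' : Exch M.Ob} {Γ As : List M.Ob} {B : M.Ob} (hU : U ++ P = U')
      (hW : W ++ Q = W') (hn : As = [] → U = []) (ts : CellPath (Term M) U Γ As W)
      {t t' : Term M P As B Q} :
      Step t t' → Step (.letIn hU hW hn ts t) (.letIn hU hW hn ts t')
  | putR {U W : Exch M.Ob} {Δ Γ Θ : List M.Ob} {A B : M.Ob} (h : Δ ++ Γ = Θ)
      (v : M.Hom Γ A) {t t' : Term M U Δ B W} : Step t t' → Step (.putR h v t) (.putR h v t')
  | getL {U W : Exch M.Ob} {Γ : List M.Ob} {A B : M.Ob} {t t' : Term M U (A :: Γ) B W} :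
      Step t t' → Step (.getL t) (.getL t')
  | getR {U W : Exch M.Ob} {Γ : List M.Ob} {A B : M.Ob} {t t' : Term M U (Γ ++ [A]) B W} :
      Step t t' → Step (.getR t) (.getR t')
  | putL {U W : Exch M.Ob} {Γ Δ Θ : List M.Ob} {A B : M.Ob} (h : Γ ++ Δ = Θ)
      (v : M.Hom Γ A) {t t' : Term M U Δ B W} : Step t t' → Step (.putL h v t) (.putL h v t')

/-- Rewrites inside the sequence `t₁ | ⋯ | tₙ` of terms bound by a let: the interactions `r1` and
`r2` of two neighbours, and rewrites of one entry, both at any position. -/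
inductive StepPath : {U W : Exch M.Ob} → {Γ As : List M.Ob} →
    CellPath (Term M) U Γ As W → CellPath (Term M) U Γ As W → Prop
  -- `(putR(v,t) | getL(y.s) | b̄)  →  (t | s[v/y] | b̄)`
  | r1 {U V V' W : Exch M.Ob} {Δ Γ Ψ Ξ Φ Θ Θ₁ Θ₂ As : List M.Ob} {A B C : M.Ob}
      (h₁ : Δ ++ Γ = Ψ) (h₂ : Φ ++ Ξ = Θ₁) (h₃ : Ψ ++ Θ₁ = Θ) (h₄ : Γ ++ Φ ++ Ξ = Θ₂)
      (h₅ : Δ ++ Θ₂ = Θ) (v : M.Hom Γ A) (t : Term M U Δ B V) (s : Term M V (A :: Φ) C V')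
      (b : CellPath (Term M) V' Ξ As W) :
      StepPath (.cons h₃ (.putR h₁ v t) (.cons h₂ (.getL s) b))
        (.cons h₅ t (.cons h₄ (substFirst v s) b))
  -- `(getR(y.t) | putL(v,s) | b̄)  →  (t[v/y] | s | b̄)`
  | r2 {U V V' W : Exch M.Ob} {Δ Γ Ψ Ξ Φ Θ Θ₁ Θ₂ As : List M.Ob} {A B C : M.Ob}
      (h₁ : Γ ++ Φ = Ψ) (h₂ : Ψ ++ Ξ = Θ₁) (h₃ : Δ ++ Θ₁ = Θ) (h₄ : Φ ++ Ξ = Θ₂)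
      (h₅ : Δ ++ Γ ++ Θ₂ = Θ) (v : M.Hom Γ A) (t : Term M U (Δ ++ [A]) B V)
      (s : Term M V Φ C V') (b : CellPath (Term M) V' Ξ As W) :
      StepPath (.cons h₃ (.getR t) (.cons h₂ (.putL h₁ v s) b))
        (.cons h₅ (substLast v t) (.cons h₄ s b))
  | head {U V W : Exch M.Ob} {Γ Δ Θ As : List M.Ob} {A : M.Ob} (h : Γ ++ Δ = Θ)
      {t t' : Term M U Γ A V} (ts : CellPath (Term M) V Δ As W) :
      Step t t' → StepPath (.cons h t ts) (.cons h t' ts)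
  | tail {U V W : Exch M.Ob} {Γ Δ Θ As : List M.Ob} {A : M.Ob} (h : Γ ++ Δ = Θ)
      (t : Term M U Γ A V) {ts ts' : CellPath (Term M) V Δ As W} :
      StepPath ts ts' → StepPath (.cons h t ts) (.cons h t ts')

end

/-- Convertibility: the equivalence relation generated by the rewrite relation. -/
def Conv {U W : Exch M.Ob} {Γ : List M.Ob} {B : M.Ob} : Term M U Γ B W → Term M U Γ B W → Prop :=
  Relation.EqvGen Step

/-- Convertibility of sequences of terms. -/
def ConvPath {U W : Exch M.Ob} {Γ As : List M.Ob} :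
    CellPath (Term M) U Γ As W → CellPath (Term M) U Γ As W → Prop :=
  Relation.EqvGen StepPath

/-- Transport of a term along equalities of the left and of the right boundary. -/
def cast {U U' W W' : Exch M.Ob} {Γ : List M.Ob} {B : M.Ob} (hU : U = U') (hW : W = W')
    (t : Term M U Γ B W) : Term M U' Γ B W' := hU ▸ hW ▸ t

/-- The term `id_U(f)`. -/
def idHor {P Q : Exch M.Ob} {B : M.Ob} (f : Term M P [] B Q) :
    (U : Exch M.Ob) → Term M (U ++ P) [] B (U ++ Q)
  | [] => f
  | (A, .circ) :: U => .getL (.putR (Δ := []) rfl (M.one A) (idHor f U))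
  | (A, .bullet) :: U => .getR (Γ := []) (.putL (Γ := [A]) rfl (M.one A) (idHor f U))

/-- Composition of terms: `compose (g₁, …, gₙ) f` is `let x₁, …, xₙ ↓ (g₁ | ⋯ | gₙ) in f` when
`n > 0`, and `id_U(f)` for the empty path at `U`. -/
def compose {U P U' W Q W' : Exch M.Ob} {Γ As : List M.Ob} {B : M.Ob} (hU : U ++ P = U')
    (hW : W ++ Q = W') : CellPath (Term M) U Γ As W → Term M P As B Q → Term M U' Γ B W'
  | .nil U, f => (idHor f U).cast hU hW
  | .cons h g gs, f => .letIn hU hW (by simp) (.cons h g gs) f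

theorem convPath_cons_head {U V W : Exch M.Ob} {Γ Δ Θ As : List M.Ob} {A : M.Ob}
    (h : Γ ++ Δ = Θ) {t t' : Term M U Γ A V} (ts : CellPath (Term M) V Δ As W) (ht : Conv t t') :
    ConvPath (.cons h t ts) (.cons h t' ts) := by
  induction ht with
  | rel _ _ h' => exact .rel _ _ (.head h ts h')
  | refl _ => exact .refl _
  | symm _ _ _ ih => exact .symm _ _ ih
  | trans _ _ _ _ _ ih ih' => exact .trans _ _ _ ih ih'

theorem convPath_cons_tail {U V W : Exch M.Ob} {Γ Δ Θ As : List M.Ob} {A : M.Ob}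
    (h : Γ ++ Δ = Θ) (t : Term M U Γ A V) {ts ts' : CellPath (Term M) V Δ As W}
    (hts : ConvPath ts ts') : ConvPath (.cons h t ts) (.cons h t ts') := by
  induction hts with
  | rel _ _ h' => exact .rel _ _ (.tail h t h')
  | refl _ => exact .refl _
  | symm _ _ _ ih => exact .symm _ _ ih
  | trans _ _ _ _ _ ih ih' => exact .trans _ _ _ ih ih'

theorem conv_cast {U U' W W' : Exch M.Ob} {Γ : List M.Ob} {B : M.Ob} (hU : U = U') (hW : W = W')
    {t t' : Term M U Γ B W} (h : Conv t t') : Conv (t.cast hU hW) (t'.cast hU hW) := by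
  subst hU hW; exact h

theorem step_idHor {P Q : Exch M.Ob} {B : M.Ob} {f f' : Term M P [] B Q} (h : Step f f') :
    (U : Exch M.Ob) → Step (idHor f U) (idHor f' U)
  | [] => h
  | (_, .circ) :: U => .getL (.putR _ _ (step_idHor h U))
  | (_, .bullet) :: U => .getR (.putL _ _ (step_idHor h U))

theorem conv_compose_body {U P U' W Q W' : Exch M.Ob} {Γ As : List M.Ob} {B : M.Ob}
    (hU : U ++ P = U') (hW : W ++ Q = W') (ts : CellPath (Term M) U Γ As W)
    {f f' : Term M P As B Q} (h : Conv f f') :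
    Conv (compose hU hW ts f) (compose hU hW ts f') := by
  induction h with
  | rel _ _ h' =>
    cases ts with
    | nil => exact conv_cast hU hW (.rel _ _ (step_idHor h' _))
    | cons h g gs => exact .rel _ _ (.letIn_body _ _ _ _ h')
  | refl _ => exact .refl _
  | symm _ _ _ ih => exact .symm _ _ ih
  | trans _ _ _ _ _ ih ih' => exact .trans _ _ _ ih ih'

theorem conv_compose_args {U P U' W Q W' : Exch M.Ob} {Γ As : List M.Ob} {B : M.Ob}
    (hU : U ++ P = U') (hW : W ++ Q = W') {ts ts' : CellPath (Term M) U Γ As W}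
    (f : Term M P As B Q) (h : ConvPath ts ts') :
    Conv (compose hU hW ts f) (compose hU hW ts' f) := by
  induction h with
  | rel ts ts' h' =>
    cases ts with
    | nil => cases h'
    | cons h g gs =>
      cases ts' with
      | cons h g' gs' => exact .rel _ _ (.letIn_args _ _ _ _ h')
  | refl _ => exact .refl _
  | symm _ _ _ ih => exact .symm _ _ ih
  | trans _ _ _ _ _ ih ih' => exact .trans _ _ _ ih ih'

/-- Terms modulo convertibility. -/
def Class (M : Multicategory.{u, v}) (U : Exch M.Ob) (Γ : List M.Ob) (B : M.Ob) (W : Exch M.Ob) :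
    Type (max u v) :=
  Quotient (Relation.EqvGen.setoid (Step (M := M) (U := U) (Γ := Γ) (B := B) (W := W)))

/-- The class of a term. -/
def mk {U W : Exch M.Ob} {Γ : List M.Ob} {B : M.Ob} (t : Term M U Γ B W) : Class M U Γ B W :=
  Quotient.mk _ t

/-- Sequences of terms modulo convertibility. -/
def PathClass (M : Multicategory.{u, v}) (U : Exch M.Ob) (Γ As : List M.Ob) (W : Exch M.Ob) :
    Type (max u v) :=
  Quotient (Relation.EqvGen.setoid (StepPath (M := M) (U := U) (Γ := Γ) (As := As) (W := W)))

/-- The class of the sequence of terms given by a sequence of classes of terms. -/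
def pathClass : {U W : Exch M.Ob} → {Γ As : List M.Ob} → CellPath (Class M) U Γ As W →
    PathClass M U Γ As W
  | _, _, _, _, .nil U => Quotient.mk _ (.nil U)
  | _, _, _, _, .cons h t ts =>
    Quotient.map₂ (CellPath.cons h)
      (fun _ _ ht _ _ hts => .trans _ _ _ (convPath_cons_head h _ ht) (convPath_cons_tail h _ hts))
      t (pathClass ts)

end Term

/-- The virtual double category `[M]` of terms modulo convertibility. -/
def termVirtual (M : Multicategory.{u, v}) : VirtualDoubleData.{max u v, u, u} where
  Hor := M.Ob
  Vert := Exch M.Ob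
  vertMonoid := inferInstanceAs (Monoid (FreeMonoid (M.Ob × Polarity)))
  Cell := Term.Class M
  one A := Term.mk (.neutral (M.one A))
  comp hU hW gs f :=
    Quotient.map₂ (Term.compose hU hW)
      (fun _ _ hg _ _ hf =>
        .trans _ _ _ (Term.conv_compose_args hU hW _ hg) (Term.conv_compose_body hU hW _ hf))
      (Term.pathClass gs) f

/-! ### The interpretation -/

/-- The map on exchanges induced by the inclusion `A ↦ [A]` of the objects of `M` into those of the
free strict monoidal category on `M`. -/
def Exch.single {X : Type u} (U : Exch X) : Exch (List X) := U.map fun a => ([a.1], a.2)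

namespace Term

variable {M : Multicategory.{u, v}}

/-- The free cornering of the free strict monoidal category on `M`. -/
abbrev Cornering (M : Multicategory.{u, v}) : DoubleCat.{max u v, u, u} :=
  freeCornering (freeMonoidal M)

/-- The cell of the free cornering given by the sequence `(v)`. -/
def cornerCell {Γ : List M.Ob} {A : M.Ob} (v : M.Hom Γ A) : (Cornering M).Cell [] Γ [A] [] :=
  Quotient.mk _ (.corner (𝔸 := freeMonoidal M) (A := Γ) (B := [A]) (HomSeq.single v))

/-- The cell `A⌝` of the free cornering. -/
def receiveLCell (A : M.Ob) : (Cornering M).Cell (Exch.circ [A]) [] [A] [] :=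
  Quotient.mk _ (.receiveL (𝔸 := freeMonoidal M) [A])

/-- The cell `A⌞` of the free cornering. -/
def sendRCell (A : M.Ob) : (Cornering M).Cell [] [A] [] (Exch.circ [A]) :=
  Quotient.mk _ (.sendR (𝔸 := freeMonoidal M) [A])

/-- The cell `A⌜` of the free cornering. -/
def receiveRCell (A : M.Ob) : (Cornering M).Cell [] [] [A] (Exch.bullet [A]) :=
  Quotient.mk _ (.receiveR (𝔸 := freeMonoidal M) [A])

/-- The cell `A⌟` of the free cornering. -/
def sendLCell (A : M.Ob) : (Cornering M).Cell (Exch.bullet [A]) [A] [] [] :=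
  Quotient.mk _ (.sendL (𝔸 := freeMonoidal M) [A])

mutual

/-- The interpretation `⟦t⟧` of a term as a cell of the free cornering. -/
def interp : {U W : Exch M.Ob} → {Γ : List M.Ob} → {B : M.Ob} → Term M U Γ B W →
    (Cornering M).Cell U.single Γ [B] W.single
  | _, _, _, _, .neutral v => cornerCell v
  | _, _, _, _, .letIn hU hW _ ts t =>
    (Cornering M).vcomp (hU ▸ List.map_append.symm) (hW ▸ List.map_append.symm)
      (interpPath ts) (interp t)
  | _, _, _, _, .putR (Δ := Δ) h v t =>
    (Cornering M).vcomp rfl rfl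
      ((Cornering M).hcomp h (List.append_nil Δ) ((Cornering M).vid Δ)
        ((Cornering M).vcomp rfl rfl (cornerCell v) (sendRCell _)))
      (interp t)
  | _, _, Γ, _, .getL t =>
    (Cornering M).vcomp rfl rfl
      ((Cornering M).hcomp rfl rfl (receiveLCell _) ((Cornering M).vid Γ))
      (interp t)
  | _, _, Γ, _, .getR t =>
    (Cornering M).vcomp rfl rfl
      ((Cornering M).hcomp (List.append_nil Γ) rfl ((Cornering M).vid Γ) (receiveRCell _))
      (interp t)
  | _, _, _, _, .putL (Δ := Δ) h v t =>
    (Cornering M).vcomp rfl rfl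
      ((Cornering M).hcomp h rfl
        ((Cornering M).vcomp rfl rfl (cornerCell v) (sendLCell _)) ((Cornering M).vid Δ))
      (interp t)

/-- The horizontal composite `⟦t₁⟧ | ⋯ | ⟦tₙ⟧`, which is `id_U` for the empty path at `U`. -/
def interpPath : {U W : Exch M.Ob} → {Γ As : List M.Ob} → CellPath (Term M) U Γ As W →
    (Cornering M).Cell U.single Γ As W.single
  | _, _, _, _, .nil U => (Cornering M).hid U.single
  | _, _, _, _, .cons h t ts => (Cornering M).hcomp h rfl (interp t) (interpPath ts)

end

theorem prod_map_single (Γ : List M.Ob) :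
    (List.map (β := (Cornering M).Hor) (fun A => [A]) Γ).prod = Γ := by
  induction Γ with
  | nil => rfl
  | cons A Γ ih => exact List.prod_cons.trans (congrArg (fun Δ => A :: Δ) ih)

/-- The interpretation of classes of terms, given that it is invariant under convertibility, as
cells of the underlying virtual double category of the free cornering. The top boundary
`A₁, …, Aₙ` is the tensor product of the one-element lists `[A₁], …, [Aₙ]`. -/
def interpClass
    (h : ∀ {U W : Exch M.Ob} {Γ : List M.Ob} {B : M.Ob} (t t' : Term M U Γ B W),
      Conv t t' → interp t = interp t')
    {U W : Exch M.Ob} {Γ : List M.Ob} {B : M.Ob} (c : (termVirtual M).Cell U Γ B W) :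
    (Cornering M).toVirtual.Cell U.single (Γ.map fun A => [A]) [B] W.single :=
  (Cornering M).castTop (prod_map_single Γ).symm (Quotient.lift interp h c)

end Term

end ProcessCalculus

/-!
Every double category is a virtual one: a path of cells has a horizontal composite, and composites
of paths compose vertically by interchange (`DoubleCat.isVirtualDoubleCategory`).

The interpretation of terms turns substitution into vertical composition (`interp_subst`). Given
this, each rewrite is an equation of cells in the free cornering: those that pull an action out of a
let, or that exchange actions on the two boundaries, hold by sliding cells past each other, and
those that let two neighbours communicate hold by the equations `A⌞ | A⌝ = 1` and `A⌜ | A⌟ = 1`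
(`interp_eq_of_step`).

Composition of terms is associative only up to convertibility, and this is the main point. Let `hs`,
`gs` be composable paths and `f` a term below them. Every term is convertible to one without lets
(`exists_letFree_conv`), so the entries of `hs` can be taken to be sequences of communications that
end in a value. If `hs` is not empty, then it is a path of values, or else a communication is
available: its first entry communicates with the left boundary, or its last one with the right
boundary, or two neighbours with each other (`LetFreePath.redex`). This gives an induction on `hs`
(`LetFreePath.induction`) in which it remains to see that `let (gs ∘ hs) in f` reduces in the same
way as `let hs in (let gs in f)`. Now a communication of `hs` is also one of the composite `gs ∘ hs`
(`compPath hs gs`). If one entry of `gs` binds all the terms of `hs` that take part, then it is a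
communication inside the let made from this entry. Otherwise a message has to cross the places where
entries of `gs` bind the empty path at some `U`. There the composite has entries `id_U(g)`, which
forward messages from one side to the other, so that the message arrives after a chain of
communications (`exists_compPath_putL`, `exists_compPath_putR`, `convPath_putR_compPath_getL`,
`convPath_compPath_getR_putL`). For a path of values, both sides are substitutions
(`convPath_compPath_neutrals`), and if `hs` is the empty path at `U`, then associativity follows by
induction on `U`, again by forwarding (`conv_letIn_compPath_nil`).

Finally the interpretation respects composition by definition, except for the empty path at `U`,
where `id_U(f)` has to be interpreted by a composite with the horizontal identity of `U`. This
follows from the equations `A⌝ · A⌞ = id` and `A⌜ · A⌟ = id` (`interp_idHor`). -/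

namespace ProcessCalculus

/-! ### Splitting and concatenating sequences and paths -/

namespace HomSeq

variable {Ob : Type u} {Hom : List Ob → Ob → Type v}

/-- Concatenation with result at any domain and codomain equal to the concatenations. -/
def app {Γ Δ Θ As Bs Cs : List Ob} (hΓ : Γ ++ Δ = Θ) (hA : As ++ Bs = Cs)
    (p : HomSeq Hom Γ As) (q : HomSeq Hom Δ Bs) : HomSeq Hom Θ Cs :=
  cast hΓ hA (append p q)

theorem exists_app {Θ Cs : List Ob} (p : HomSeq Hom Θ Cs) (As : List Ob) {Bs : List Ob}
    (h : As ++ Bs = Cs) : ∃ (Γ Δ : List Ob) (hD : Γ ++ Δ = Θ) (p₁ : HomSeq Hom Γ As)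
      (p₂ : HomSeq Hom Δ Bs), p = app hD h p₁ p₂ :=
  exists_append p As h

theorem split_app {Γ Δ Θ As Bs : List Ob} (h : Γ ++ Δ = Θ) (p : HomSeq Hom Γ As)
    (q : HomSeq Hom Δ Bs) : split As (app h rfl p q) = ⟨h, p, q⟩ := by
  subst h; exact split_append p q

theorem app_cons {Γ Δ Θ Γ₁ Γ₂ As Bs Cs : List Ob} {A : Ob} (h : Γ ++ Δ = Θ) (hA : As ++ Bs = Cs)
    (h' : Γ₁ ++ Γ₂ = Γ) (f : Hom Γ₁ A) (p : HomSeq Hom Γ₂ As) (q : HomSeq Hom Δ Bs) :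
    app h (congrArg (A :: ·) hA) (.cons h' f p) q =
      .cons (by rw [← h, ← h', List.append_assoc]) f (app rfl hA p q) := by
  subst h h' hA; rfl

theorem app_nil {Γ As : List Ob} (p : HomSeq Hom Γ As) :
    app (List.append_nil Γ) (List.append_nil As) p .nil = p := append_nil p

theorem cons_eq_app {Γ Δ Θ As : List Ob} {A : Ob} (h : Γ ++ Δ = Θ) (f : Hom Γ A)
    (p : HomSeq Hom Δ As) : cons h f p = app h rfl (single f) p := by
  subst h
  exact cons_cast rfl rfl (by simp) _ _ f p

theorem cons_eq_app_nil {Γ Θ : List Ob} {A : Ob} (h : Γ ++ [] = Θ) (f : Hom Γ A) :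
    cons h f .nil = app (Γ := []) (As := []) (by rw [← h]; simp) rfl .nil (single f) := by
  obtain rfl := (List.append_nil Γ).symm.trans h
  rfl

theorem app_assoc {Γ₁ Γ₂ Γ₃ Γ Δ Θ As₁ As₂ As₃ As Bs Cs : List Ob} (h : Γ ++ Γ₃ = Θ)
    (hA : As ++ As₃ = Cs) (h₁ : Γ₁ ++ Γ₂ = Γ) (hA₁ : As₁ ++ As₂ = As) (h₂ : Γ₂ ++ Γ₃ = Δ)
    (hA₂ : As₂ ++ As₃ = Bs) (h₃ : Γ₁ ++ Δ = Θ) (hA₃ : As₁ ++ Bs = Cs) (p : HomSeq Hom Γ₁ As₁)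
    (q : HomSeq Hom Γ₂ As₂) (r : HomSeq Hom Γ₃ As₃) :
    app h hA (app h₁ hA₁ p q) r = app h₃ hA₃ p (app h₂ hA₂ q r) := by
  subst h hA h₁ hA₁ h₂ hA₂
  exact append_assoc p q r

theorem ids_app (one : (A : Ob) → Hom [A] A) {As Bs Cs : List Ob} (h : As ++ Bs = Cs) :
    ids one Cs = app h h (ids one As) (ids one Bs) := by
  subst h; exact ids_append one As Bs

end HomSeq

namespace CellPath

variable {E : Type u₁} {H : Type u₂} {Cell : E → List H → H → E → Type w}

/-- Concatenation with result at any top and bottom boundary equal to the concatenations. -/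
def app {U V W : E} {Γ Δ Θ As Bs Cs : List H} (h : Γ ++ Δ = Θ) (hA : As ++ Bs = Cs)
    (p : CellPath Cell U Γ As V) (q : CellPath Cell V Δ Bs W) : CellPath Cell U Θ Cs W :=
  hA ▸ append h p q

/-- The intermediate top boundary `Ξ` and all the proofs are free, for rewriting. -/
theorem app_cons {U V V' W : E} {Γ Δ Θ Γ₁ Γ₂ Ξ As Bs Cs : List H} {A : H} (h : Γ ++ Δ = Θ)
    (hA : A :: As ++ Bs = A :: Cs) (h' : Γ₁ ++ Γ₂ = Γ) (h₁ : Γ₂ ++ Δ = Ξ) (h₂ : Γ₁ ++ Ξ = Θ)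
    (hA' : As ++ Bs = Cs) (f : Cell U Γ₁ A V')
    (p : CellPath Cell V' Γ₂ As V) (q : CellPath Cell V Δ Bs W) :
    app h hA (.cons h' f p) q = .cons h₂ f (app h₁ hA' p q) := by
  subst h h' h₁ hA'; rfl

theorem cons_app {U V V' W : E} {Γ₁ Γ₂ Γ Δ Ξ Θ As Bs Cs : List H} {A : H} (h₁ : Γ₂ ++ Δ = Ξ)
    (h₂ : Γ₁ ++ Ξ = Θ) (hA : As ++ Bs = Cs) (h₃ : Γ₁ ++ Γ₂ = Γ) (f : Cell U Γ₁ A V')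
    (p : CellPath Cell V' Γ₂ As V) (q : CellPath Cell V Δ Bs W) :
    .cons h₂ f (app h₁ hA p q) =
      app (by rw [← h₂, ← h₁, ← h₃, List.append_assoc]) (congrArg (A :: ·) hA) (.cons h₃ f p) q :=
  (app_cons _ _ _ _ _ _ _ _ _).symm

theorem single_app {U V W : E} {Γ Δ Θ As : List H} {A : H} (h : Γ ++ Δ = Θ)
    (hA : [A] ++ As = A :: As) (f : Cell U Γ A V) (p : CellPath Cell V Δ As W) :
    app h hA (single f) p = .cons h f p := by
  subst h; rfl

theorem cons_cons_eq_app {U V V' W : E} {Γ Δ Ξ Θ Θ₁ Θ' As : List H} {A B : H} (h : Γ ++ Θ₁ = Θ)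
    (h' : Δ ++ Ξ = Θ₁) (h₁ : Γ ++ Δ = Θ') (h₂ : Θ' ++ Ξ = Θ) (x : Cell U Γ A V) (y : Cell V Δ B V')
    (p : CellPath Cell V' Ξ As W) :
    cons h x (cons h' y p) = app h₂ rfl (cons h₁ x (single y)) p := by
  rw [app_cons (h₁ := h') (h₂ := h) (hA' := rfl), single_app]

theorem app_nil {U W : E} {Γ As : List H} (p : CellPath Cell U Γ As W) :
    app (List.append_nil Γ) (List.append_nil As) p (.nil W) = p := by
  induction p with
  | nil => rfl
  | cons h' a p ih =>
    rw [app_cons _ _ h' (List.append_nil _) h' (List.append_nil _), ih]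

theorem app_assoc {U V V' W : E} {Γ Δ Θ Γ₁ Γ₂ Γ₃ As Bs Cs As₁ As₂ As₃ : List H}
    (h : Γ ++ Δ = Θ) (hA : As ++ Bs = Cs) (h₁ : Γ₁ ++ Γ₂ = Γ) (hA₁ : As₁ ++ As₂ = As)
    (h₂ : Γ₂ ++ Δ = Γ₃) (hA₂ : As₂ ++ Bs = As₃) (h₃ : Γ₁ ++ Γ₃ = Θ) (hA₃ : As₁ ++ As₃ = Cs)
    (p : CellPath Cell U Γ₁ As₁ V) (q : CellPath Cell V Γ₂ As₂ V')
    (r : CellPath Cell V' Δ Bs W) :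
    app h hA (app h₁ hA₁ p q) r = app h₃ hA₃ p (app h₂ hA₂ q r) := by
  subst h hA h₁ hA₁ h₂ hA₂
  induction p with
  | nil => rfl
  | cons h' a p ih =>
    subst h'
    rw [app_cons (h₁ := rfl) (h₂ := (List.append_assoc _ _ _).symm) (hA' := rfl) (Cs := _ ++ _),
      app_cons (h₁ := rfl) (h₂ := by simp) (hA' := rfl) (Cs := _ ++ _),
      app_cons (h₁ := (List.append_assoc _ _ _).symm) (h₂ := by simp)
        (hA' := (List.append_assoc _ _ _).symm) (Cs := _ ++ _), ih]

theorem exists_app {U W : E} {Θ Cs : List H} (p : CellPath Cell U Θ Cs W) (As : List H)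
    {Bs : List H} (h : As ++ Bs = Cs) : ∃ (Γ Δ : List H) (V : E) (hD : Γ ++ Δ = Θ)
      (p₁ : CellPath Cell U Γ As V) (p₂ : CellPath Cell V Δ Bs W), p = app hD h p₁ p₂ := by
  subst h
  induction As generalizing Θ U with
  | nil => exact ⟨[], Θ, U, rfl, .nil U, p, rfl⟩
  | cons A As ih =>
    cases p with
    | cons h f fs =>
      obtain ⟨Γ, Δ, V, hD, p₁, p₂, rfl⟩ := ih fs
      subst hD h
      exact ⟨_, Δ, V, List.append_assoc _ _ _, .cons rfl f p₁, p₂,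
        (app_cons _ rfl _ rfl _ rfl _ _ _).symm⟩

/-- A path with one entry is given by a cell. -/
theorem exists_single {U W : E} {Γ : List H} {A : H} (p : CellPath Cell U Γ [A] W) :
    ∃ a : Cell U Γ A W, p = single a := by
  cases p with
  | cons h a q =>
    cases q
    obtain rfl := (List.append_nil _).symm.trans h
    exact ⟨a, rfl⟩

/-- Induction on paths from the right. -/
theorem snocInduction {motive : ∀ {U W : E} {Γ As : List H}, CellPath Cell U Γ As W → Prop}
    (nil : ∀ U, motive (.nil U : CellPath Cell U [] [] U))
    (snoc : ∀ {U V W : E} {Γ Δ Θ As Bs : List H} {B : H} (h : Γ ++ Δ = Θ) (hA : As ++ [B] = Bs)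
      (p : CellPath Cell U Γ As V) (b : Cell V Δ B W), motive p →
      motive (app h hA p (single b)))
    {U W : E} {Γ As : List H} (p : CellPath Cell U Γ As W) : motive p := by
  induction As using List.reverseRecOn generalizing U W Γ with
  | nil => cases p; exact nil _
  | append_singleton As B ih =>
    obtain ⟨Γ, Δ, V, hD, p₁, p₂, rfl⟩ := exists_app p As rfl
    obtain ⟨b, rfl⟩ := exists_single p₂
    exact snoc _ _ _ _ (ih _)

/-- A nonempty path has a last entry. -/
theorem exists_snoc {U W : E} {Θ As : List H} (hAs : As ≠ []) (p : CellPath Cell U Θ As W) :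
    ∃ (Γ Δ As' : List H) (B : H) (V : E) (hD : Γ ++ Δ = Θ) (hA : As' ++ [B] = As)
      (q : CellPath Cell U Γ As' V) (b : Cell V Δ B W), p = app hD hA q (single b) := by
  revert hAs
  induction p using snocInduction with
  | nil => exact fun h => absurd rfl h
  | snoc h hA p b _ => exact fun _ => ⟨_, _, _, _, _, h, hA, p, b, rfl⟩

theorem split_app {U V W : E} {Γ Δ Θ As Bs : List H} (h : Γ ++ Δ = Θ)
    (p : CellPath Cell U Γ As V) (q : CellPath Cell V Δ Bs W) :
    split As (app h rfl p q) = ⟨h, p, q⟩ := by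
  subst h
  induction p with
  | nil => rfl
  | cons h f fs ih =>
    subst h
    exact congrArg (fun s : Split Cell _ _ _ _ _ =>
      (⟨by rw [List.append_assoc, s.h, List.append_assoc], .cons rfl f s.fst, s.snd⟩ :
        Split Cell _ _ _ _ _)) (ih q)

section comp

variable [Monoid E] (c : {U W P Q : E} → {Γ As : List H} → {B : H} → CellPath Cell U Γ As W →
  Cell P As B Q → Cell (U * P) Γ B (W * Q))

theorem comp_cons {U V W P P' Q : E} {Γ Δ Θ Γ₁ Δ₁ Θ₁ As : List H} {A : H} (hD : Γ ++ Δ = Θ)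
    (h : Γ₁ ++ Δ₁ = Θ₁) (p₁ : CellPath Cell U Γ Γ₁ V) (p₂ : CellPath Cell V Δ Δ₁ W)
    (f : Cell P Γ₁ A P') (fs : CellPath Cell P' Δ₁ As Q) :
    comp c (app hD h p₁ p₂) (.cons h f fs) = .cons hD (c p₁ f) (comp c p₂ fs) := by
  subst hD h
  exact congrArg (fun s : Split Cell _ _ _ _ _ => cons s.h (c s.fst f) (comp c s.snd fs))
    (split_app rfl p₁ p₂)

theorem comp_app {U V W P P' Q : E} {Γ Δ Θ Γ₁ Δ₁ Θ₁ As Bs Cs : List H} (hD : Γ ++ Δ = Θ)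
    (h : Γ₁ ++ Δ₁ = Θ₁) (hA : As ++ Bs = Cs) (p₁ : CellPath Cell U Γ Γ₁ V)
    (p₂ : CellPath Cell V Δ Δ₁ W) (q₁ : CellPath Cell P Γ₁ As P') (q₂ : CellPath Cell P' Δ₁ Bs Q) :
    comp c (app hD h p₁ p₂) (app h hA q₁ q₂) = app hD hA (comp c p₁ q₁) (comp c p₂ q₂) := by
  subst hA
  induction q₁ generalizing U Γ Θ Θ₁ with
  | nil => cases p₁; subst hD h; rfl
  | cons h' f fs ih =>
    obtain ⟨Γ', Δ', V', h₁, p, p', rfl⟩ := exists_app p₁ _ h'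
    subst h' h h₁ hD
    rw [comp_cons, app_cons (h₁ := rfl) (h₂ := (List.append_assoc _ _ _).symm) (hA' := rfl)
        (Cs := _ ++ _), app_cons (h₁ := rfl) (h₂ := (List.append_assoc _ _ _).symm) (hA' := rfl)
        (Cs := _ ++ _), ← ih rfl rfl _ _, ← comp_cons c _ (List.append_assoc _ _ _).symm]
    congr 1
    exact app_assoc _ _ _ _ _ _ _ _ _ _ _

end comp

/-- Cutting the top boundary of a path in two either cuts the path in two, or goes through one of
its entries. -/
theorem exists_cut {U W : E} {Δ₁ Δ₂ Δ As : List H} (p : CellPath Cell U Δ As W)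
    (h : Δ₁ ++ Δ₂ = Δ) :
    (∃ (As₁ As₂ : List H) (V : E) (hA : As₁ ++ As₂ = As) (p₁ : CellPath Cell U Δ₁ As₁ V)
        (p₂ : CellPath Cell V Δ₂ As₂ W), p = app h hA p₁ p₂) ∨
      ∃ (Ξ X Y Φ Ψ Ψ' As₁ As₂ : List H) (A : H) (V V' : E) (_ : Ξ ++ X = Δ₁) (_ : Y ++ Φ = Δ₂)
        (h₁ : Ψ ++ Φ = Ψ') (h₂ : Ξ ++ Ψ' = Δ) (_ : X ++ Y = Ψ) (hA : As₁ ++ A :: As₂ = As)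
        (p₁ : CellPath Cell U Ξ As₁ V) (a : Cell V Ψ A V') (p₂ : CellPath Cell V' Φ As₂ W),
        X ≠ [] ∧ Y ≠ [] ∧ p = app h₂ hA p₁ (.cons h₁ a p₂) := by
  induction p generalizing Δ₁ with
  | nil =>
    obtain ⟨rfl, rfl⟩ := List.append_eq_nil_iff.1 h
    exact .inl ⟨[], [], _, rfl, .nil _, .nil _, rfl⟩
  | @cons U V W Γ Δ' Θ A As h' a p ih =>
    rcases List.append_eq_append_iff.1 (h'.trans h.symm) with ⟨X, rfl, rfl⟩ | ⟨Y, rfl, rfl⟩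
    · subst h
      rcases ih rfl with ⟨As₁, As₂, V, hA, p₁, p₂, rfl⟩ |
        ⟨Ξ, X', Y, Φ, Ψ, Ψ', As₁, As₂, B, V, V', hX, hY, h₁, h₂, hΨ, hA, p₁, b, p₂, hX', hY', rfl⟩
      · exact .inl ⟨A :: As₁, As₂, V, congrArg (A :: ·) hA, .cons rfl a p₁, p₂,
          (app_cons _ _ _ _ _ _ _ _ _).symm⟩
      · subst hX
        exact .inr ⟨Γ ++ Ξ, X', Y, Φ, Ψ, Ψ', A :: As₁, As₂, B, V, V', List.append_assoc _ _ _, hY,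
          h₁, by rw [List.append_assoc, h₂, h'], hΨ, congrArg (A :: ·) hA, .cons rfl a p₁, b, p₂,
          hX', hY', (app_cons _ _ _ _ _ _ _ _ _).symm⟩
    · by_cases hX : Δ₁ = []
      · subst hX h
        exact .inl ⟨[], A :: As, U, rfl, .nil U, .cons h' a p, rfl⟩
      · by_cases hY : Y = []
        · subst hY
          exact .inl ⟨[A], As, V, rfl, .cons (by simp) a (.nil _), p,
            (app_cons h rfl _ rfl h' rfl a (.nil _) p).symm⟩
        · exact .inr ⟨[], Δ₁, Y, Δ', _, Θ, [], As, A, U, V, rfl, rfl, h', rfl, rfl, rfl, .nil U,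
            a, p, hX, hY, rfl⟩

end CellPath

/-! ### Double categories as virtual double categories -/

namespace DoubleCat

variable {X : DoubleCat.{w, u₁, u₂}}

theorem vcomp_assoc' {U₁ U₂ U₃ U₁₂ U₂₃ U W₁ W₂ W₃ W₁₂ W₂₃ W : X.Vert} {A B C D : X.Hor}
    (h₁ : U₁ * U₂ = U₁₂) (h₁' : W₁ * W₂ = W₁₂) (h₂ : U₁₂ * U₃ = U) (h₂' : W₁₂ * W₃ = W)
    (h₃ : U₂ * U₃ = U₂₃) (h₃' : W₂ * W₃ = W₂₃) (h₄ : U₁ * U₂₃ = U) (h₄' : W₁ * W₂₃ = W)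
    (a : X.Cell U₁ A B W₁) (b : X.Cell U₂ B C W₂) (c : X.Cell U₃ C D W₃) :
    X.vcomp h₂ h₂' (X.vcomp h₁ h₁' a b) c = X.vcomp h₄ h₄' a (X.vcomp h₃ h₃' b c) := by
  subst h₁ h₁' h₂ h₂' h₃ h₃'
  exact X.vcomp_assoc a b c

theorem hcomp_assoc' {U V W Z : X.Vert} {A₁ A₂ A₃ A₁₂ A₂₃ A B₁ B₂ B₃ B₁₂ B₂₃ B : X.Hor}
    (h₁ : A₁ * A₂ = A₁₂) (h₁' : B₁ * B₂ = B₁₂) (h₂ : A₁₂ * A₃ = A) (h₂' : B₁₂ * B₃ = B)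
    (h₃ : A₂ * A₃ = A₂₃) (h₃' : B₂ * B₃ = B₂₃) (h₄ : A₁ * A₂₃ = A) (h₄' : B₁ * B₂₃ = B)
    (a : X.Cell U A₁ B₁ V) (b : X.Cell V A₂ B₂ W) (c : X.Cell W A₃ B₃ Z) :
    X.hcomp h₂ h₂' (X.hcomp h₁ h₁' a b) c = X.hcomp h₄ h₄' a (X.hcomp h₃ h₃' b c) := by
  subst h₁ h₁' h₂ h₂' h₃ h₃'
  exact X.hcomp_assoc a b c

theorem interchange' {U V W U' V' W' U'' V'' W'' : X.Vert} {A B C A' B' C' A'' B'' C'' : X.Hor}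
    (hU : U * U' = U'') (hV : V * V' = V'') (hW : W * W' = W'') (hA : A * A' = A'')
    (hB : B * B' = B'') (hC : C * C' = C'') (a : X.Cell U A B V) (b : X.Cell V A' B' W)
    (c : X.Cell U' B C V') (d : X.Cell V' B' C' W') :
    X.vcomp hU hW (X.hcomp hA hB a b) (X.hcomp hB hC c d) =
      X.hcomp hA hC (X.vcomp hU hV a c) (X.vcomp hV hW b d) := by
  subst hU hV hW hA hB hC
  exact X.interchange a b c d

theorem hcompPath_append {U V W : X.Vert} {Γ Δ Θ As Bs : List X.Hor} (h : Γ ++ Δ = Θ)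
    (p : CellPath X.VirtualCell U Γ As V) (q : CellPath X.VirtualCell V Δ Bs W) :
    X.hcompPath (p.append h q) =
      X.hcomp (by rw [← h, List.prod_append]) (List.prod_append).symm
        (X.hcompPath p) (X.hcompPath q) := by
  induction p generalizing Θ with
  | nil =>
    subst h
    exact (X.hid_hcomp (X.hcompPath q)).symm
  | cons h' a p ih =>
    subst h h'
    simp only [CellPath.append, hcompPath]
    rw [ih, hcomp_assoc' (h₃ := List.prod_append.symm) (h₃' := List.prod_append.symm)]

theorem hcompPath_comp {U W P Q : X.Vert} {Γ Δ As : List X.Hor}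
    (hs : CellPath X.VirtualCell U Γ Δ W) (gs : CellPath X.VirtualCell P Δ As Q) :
    X.hcompPath (CellPath.comp (X.toVirtual.comp rfl rfl) hs gs) =
      X.vcomp rfl rfl (X.hcompPath hs) (X.hcompPath gs) := by
  induction gs generalizing U Γ with
  | nil P =>
    cases hs
    exact (X.hid_mul _ _).symm
  | cons h g gs ih =>
    obtain ⟨Γ, Δ, V, hD, p, q, rfl⟩ := CellPath.exists_app hs _ h
    subst h hD
    rw [CellPath.comp_cons]
    simp only [hcompPath]
    rw [ih]
    have := hcompPath_append rfl p q
    refine Eq.trans ?_ (congrArg (fun x => X.vcomp rfl rfl x _) this.symm)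
    exact (interchange' _ _ _ _ _ _ _ _ _ _).symm

theorem hcompPath_ids (As : List X.Hor) :
    X.hcompPath (CellPath.ids X.toVirtual.one As) = X.vid As.prod := by
  induction As with
  | nil => exact X.hid_one
  | cons A As ih =>
    simp only [CellPath.ids, hcompPath]
    have key : ∀ {B B' P : X.Hor} (h : A = B) (h' : B * P = B') (h'' : A * P = B'),
        X.hcomp h' h'' (X.castTop h (X.vid A)) (X.vid P) = X.vid B' := by
      rintro B B' P rfl rfl h''
      exact X.vid_mul _ _
    rw [ih]
    exact key _ _ _

/-- Horizontal composites of virtual paths compose vertically by interchange, and this makes the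
composition of the underlying virtual double category associative. -/
theorem isVirtualDoubleCategory (X : DoubleCat.{w, u₁, u₂}) :
    IsVirtualDoubleCategory X.toVirtual where
  assoc hs gs f := by
    refine (congrArg (fun x => X.vcomp _ _ x f) (hcompPath_comp hs gs)).trans ?_
    exact vcomp_assoc' _ _ _ _ _ _ _ _ _ _ _
  ones_comp f := by
    refine (congrArg (fun x => X.vcomp _ _ x f) (hcompPath_ids _)).trans ?_
    exact X.vid_vcomp f
  comp_one {U W As B} f := by
    have key : ∀ {C A' : X.Hor} (h : B = C) (h₁ : As.prod * 1 = A') (h₂ : B * 1 = C)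
        (a : X.Cell U A' B W), (∀ h₃ : As.prod = A', a = X.castTop h₃ f) →
        X.vcomp (mul_one U) (mul_one W) (X.hcomp h₁ h₂ f (X.hid W)) (X.castTop h (X.vid B)) =
          a := by
      rintro C A' rfl h₁ h₂ a ha
      obtain rfl : As.prod = A' := (mul_one _).symm.trans h₁
      rw [ha rfl]
      exact (X.vcomp_vid _).trans (X.hcomp_hid f)
    exact key _ _ _ f fun _ => rfl

/-! ### Sliding cells past each other in a double category -/

/-- A cell with bottom boundary `1` on the right slides up past a cell on its left. -/
theorem slideR {U P : X.Vert} {A B G Θ : X.Hor} (h : A * G = Θ) (a : X.Cell U A B 1)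
    (y : X.Cell 1 G 1 P) :
    X.vcomp (one_mul U) (mul_one P) (X.hcomp h (mul_one A) (X.vid A) y) a =
      X.hcomp h (mul_one B) a y := by
  conv_lhs => rw [← X.hcomp_hid a]
  rw [interchange' (hV := one_mul 1), X.vid_vcomp, X.hid_one, X.vcomp_vid]

theorem slideL {W P : X.Vert} {A B G Θ : X.Hor} (h : G * A = Θ) (a : X.Cell 1 A B W)
    (y : X.Cell P G 1 1) :
    X.vcomp (mul_one P) (one_mul W) (X.hcomp h (one_mul A) y (X.vid A)) a =
      X.hcomp h (one_mul B) y a := by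
  conv_lhs => rw [← X.hid_hcomp a]
  rw [interchange' (hV := one_mul 1), X.vid_vcomp, X.hid_one, X.vcomp_vid]

/-- A cell with top boundary `1` on the right slides down past a cell on its left. -/
theorem slideR' {U P : X.Vert} {A B G Θ : X.Hor} (h : B * G = Θ) (a : X.Cell U A B 1)
    (y : X.Cell 1 1 G P) :
    X.vcomp (mul_one U) (one_mul P) a (X.hcomp (mul_one B) h (X.vid B) y) =
      X.hcomp (mul_one A) h a y := by
  conv_lhs => rw [← X.hcomp_hid a]
  rw [interchange' (hV := one_mul 1), X.vcomp_vid, X.hid_one, X.vid_vcomp]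

theorem slideL' {W P : X.Vert} {A B G Θ : X.Hor} (h : G * B = Θ) (a : X.Cell 1 A B W)
    (y : X.Cell P 1 G 1) :
    X.vcomp (one_mul P) (mul_one W) a (X.hcomp (one_mul B) h y (X.vid B)) =
      X.hcomp (one_mul A) h y a := by
  conv_lhs => rw [← X.hid_hcomp a]
  rw [interchange' (hV := one_mul 1), X.vcomp_vid, X.hid_one, X.vid_vcomp]

theorem vid_mul' {A B C : X.Hor} (h : A * B = C) :
    X.hcomp h h (X.vid A) (X.vid B) = X.vid C := by
  subst h; exact X.vid_mul A B

/-- An action on the left boundary of the left one of two neighbours is one of their composite. -/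
theorem vcomp_whiskerL_hcomp {P U U' V W : X.Vert} {G G' D D' Ξ A B C T S S' : X.Hor}
    (hU : P * U = U') (h₁ : G * D = A) (h₂ : G' * D = D') (h₃ : A * Ξ = T) (h₄ : D' * Ξ = S)
    (h₅ : D * Ξ = S') (h₆ : G * S' = T) (h₇ : G' * S' = S) (hB : B * C = A')
    (y : X.Cell P G G' 1) (t : X.Cell U D' B V) (s : X.Cell V Ξ C W) :
    X.hcomp h₃ hB (X.vcomp hU (one_mul V) (X.hcomp h₁ h₂ y (X.vid D)) t) s =
      X.vcomp hU (one_mul W) (X.hcomp h₆ h₇ y (X.vid S')) (X.hcomp h₄ hB t s) := by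
  rw [← vid_mul' h₅, ← hcomp_assoc' h₁ h₂ h₃ h₄, interchange' (hV := one_mul V), X.vid_vcomp]

theorem vcomp_whiskerR_hcomp {P U V W W' : X.Vert} {G G' D D' Ξ A B C A' T S S' : X.Hor}
    (hW : P * W = W') (h₁ : D * G = A) (h₂ : D * G' = D') (h₃ : Ξ * A = T) (h₄ : Ξ * D' = S)
    (h₅ : Ξ * D = S') (h₆ : S' * G = T) (h₇ : S' * G' = S) (hB : C * B = A')
    (y : X.Cell 1 G G' P) (t : X.Cell V D' B W) (s : X.Cell U Ξ C V) :
    X.hcomp h₃ hB s (X.vcomp (one_mul V) hW (X.hcomp h₁ h₂ (X.vid D) y) t) =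
      X.vcomp (one_mul U) hW (X.hcomp h₆ h₇ (X.vid S') y) (X.hcomp h₄ hB s t) := by
  rw [← vid_mul' h₅, hcomp_assoc' h₅ h₅ h₆ h₇ h₁ h₂ h₃ h₄, interchange' (hV := one_mul V),
    X.vid_vcomp]

/-- Actions on the left and on the right boundary commute. -/
theorem whiskerR_whiskerL_comm {P Q U U' W W' : X.Vert}
    {F F' G G' D D₁ D₂ D₃ D₄ T E E' S B : X.Hor} (hU : Q * U = U') (hW : P * W = W')
    (k₁ : F * D = D₁) (k₂ : D * G' = D₂) (k₃ : D * G = D₃) (k₄ : F' * D = D₄)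
    (a₁ : D₁ * G = T) (a₂ : D₁ * G' = E) (a₃ : F * D₂ = E) (a₄ : F' * D₂ = S)
    (b₁ : F * D₃ = T) (b₂ : F' * D₃ = E') (b₃ : D₄ * G = E') (b₄ : D₄ * G' = S)
    (y : X.Cell 1 G G' P) (z : X.Cell Q F F' 1) (t : X.Cell U S B W) :
    X.vcomp (one_mul U') hW (X.hcomp a₁ a₂ (X.vid D₁) y)
        (X.vcomp hU (one_mul W) (X.hcomp a₃ a₄ z (X.vid D₂)) t) =
      X.vcomp hU (one_mul W') (X.hcomp b₁ b₂ z (X.vid D₃))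
        (X.vcomp (one_mul U) hW (X.hcomp b₃ b₄ (X.vid D₄) y) t) := by
  rw [← vcomp_assoc' (one_mul Q) (mul_one P) hU hW,
    ← vcomp_assoc' (mul_one Q) (one_mul P) hU hW]
  congr 1
  rw [← vid_mul' k₁, ← vid_mul' k₂, ← vid_mul' k₃, ← vid_mul' k₄,
    hcomp_assoc' k₁ k₁ a₁ a₂ k₃ k₂ b₁ a₃, interchange' (hV := one_mul 1),
    hcomp_assoc' k₄ k₄ b₃ b₄ k₃ k₂ b₂ a₄, interchange' (hV := one_mul 1),
    X.vid_vcomp, X.vcomp_vid, interchange' (hV := one_mul 1), interchange' (hV := one_mul 1),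
    X.vid_vcomp, X.vcomp_vid, X.vid_vcomp, X.vcomp_vid]

/-- Communication of a sender with a receiver on its right, for a sending cell `s` and a receiving
cell `r` that satisfy the yanking equation. -/
theorem hcomp_send_receive {P U V V' W : X.Vert} {A B C C' D D₁ F G K S T : X.Hor}
    {s : X.Cell 1 A 1 P} {r : X.Cell P 1 A 1}
    (yank : X.hcomp (mul_one A) (one_mul A) s r = X.vid A) (hV : P * V = V')
    (h₁ : D * G = D₁) (h₂ : D₁ * F = T) (h₃ : A * F = S) (h₄ : G * F = K) (h₅ : D * K = T)
    (hB : B * C = C') (v : X.Cell 1 G A 1) (t : X.Cell U D B V) (t' : X.Cell V S C W) :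
    X.hcomp h₂ hB
        (X.vcomp (one_mul U) hV
          (X.hcomp h₁ (mul_one D) (X.vid D) (X.vcomp (one_mul 1) (one_mul P) v s)) t)
        (X.vcomp hV (one_mul W) (X.hcomp (one_mul F) h₃ r (X.vid F)) t') =
      X.hcomp h₅ hB t (X.vcomp (one_mul V) (one_mul W) (X.hcomp h₄ h₃ v (X.vid F)) t') := by
  have hv : X.hcomp (mul_one G) (one_mul A) (X.vcomp (one_mul 1) (one_mul P) v s) r = v := by
    conv_lhs => rw [← X.vid_vcomp r]
    rw [← interchange' (hU := one_mul 1) (hW := one_mul 1) (hA := mul_one G) (hB := mul_one A),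
      yank, X.vcomp_vid, ← X.hid_one, X.hcomp_hid]
  conv_rhs => rw [← X.vid_vcomp t]
  rw [← interchange' (hB := rfl) (hU := one_mul U) (hW := one_mul W),
    ← interchange' (hB := rfl) (hU := one_mul U) (hW := one_mul W),
    hcomp_assoc' h₁ (mul_one D) h₂ rfl h₄ (one_mul S) h₅ rfl,
    ← hcomp_assoc' (mul_one G) (one_mul A) h₄ h₃ (one_mul F) h₃, hv]

/-- Communication of a sender with a receiver on its left, for a receiving cell `r` and a sending
cell `s` that compose horizontally to an identity. -/
theorem hcomp_receive_send {P U V V' W : X.Vert} {A B C C' D D₁ F G K S T : X.Hor}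
    {r : X.Cell 1 1 A P} {s : X.Cell P A 1 1}
    (yank : X.hcomp (one_mul A) (mul_one A) r s = X.vid A) (hV : P * V = V')
    (h₁ : G * F = K) (h₂ : D * K = T) (h₃ : D * A = S) (h₄ : D * G = D₁) (h₅ : D₁ * F = T)
    (hB : B * C = C') (v : X.Cell 1 G A 1) (t : X.Cell U S B V) (t' : X.Cell V F C W) :
    X.hcomp h₂ hB
        (X.vcomp (one_mul U) hV (X.hcomp (mul_one D) h₃ (X.vid D) r) t)
        (X.vcomp hV (one_mul W)
          (X.hcomp h₁ (one_mul F) (X.vcomp (one_mul P) (one_mul 1) v s) (X.vid F)) t') =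
      X.hcomp h₅ hB (X.vcomp (one_mul U) (one_mul V) (X.hcomp h₄ h₃ (X.vid D) v) t) t' := by
  have hv : X.hcomp (one_mul G) (mul_one A) r (X.vcomp (one_mul P) (one_mul 1) v s) = v := by
    conv_lhs => rw [← X.vid_vcomp r]
    rw [← interchange' (hU := one_mul 1) (hW := one_mul 1) (hA := one_mul G) (hB := one_mul A),
      yank, X.vcomp_vid, ← X.hid_one, X.hid_hcomp]
  conv_rhs => rw [← X.vid_vcomp t']
  rw [← interchange' (hB := rfl) (hU := one_mul U) (hW := one_mul W),
    ← interchange' (hB := rfl) (hU := one_mul U) (hW := one_mul W),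
    hcomp_assoc' (mul_one D) h₃ h₂ rfl ((one_mul K)) rfl h₂ ((mul_assoc D A F).symm.trans
      (congrArg (· * F) h₃)),
    ← hcomp_assoc' (one_mul G) (mul_one A) h₁ rfl h₁ (one_mul F) (one_mul K) rfl, hv,
    ← hcomp_assoc' h₄ h₃ h₅ rfl h₁ rfl h₂ ((mul_assoc D A F).symm.trans (congrArg (· * F) h₃))]

/-- Sending commutes with substitution. -/
theorem vcomp_sendR {P U W W' : X.Vert} {A B D E G Γ Δ Θ : X.Hor} (hW : P * W = W')
    (h₁ : Γ * Δ = Θ) (h₂ : D * G = E) {a : X.Cell 1 Γ D 1} {b : X.Cell 1 Δ G 1}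
    {ab : X.Cell 1 Θ E 1} (hab : X.hcomp h₁ h₂ a b = ab) {v : X.Cell 1 G A 1}
    {bv : X.Cell 1 Δ A 1} (hbv : X.vcomp (one_mul 1) (one_mul 1) b v = bv) (s : X.Cell 1 A 1 P)
    {t : X.Cell U D B W} {t' : X.Cell U Γ B W}
    (ht : t' = X.vcomp (one_mul U) (one_mul W) a t) :
    X.vcomp (one_mul U) hW
        (X.hcomp h₁ (mul_one Γ) (X.vid Γ) (X.vcomp (one_mul 1) (one_mul P) bv s)) t' =
      X.vcomp (one_mul U) (one_mul W') ab
        (X.vcomp (one_mul U) hW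
          (X.hcomp h₂ (mul_one D) (X.vid D) (X.vcomp (one_mul 1) (one_mul P) v s)) t) := by
  subst hab hbv ht
  rw [← vcomp_assoc' (one_mul 1) (one_mul P) (one_mul U) hW,
    ← vcomp_assoc' (one_mul 1) (mul_one P) (one_mul U) hW, slideR,
    interchange' (hV := one_mul 1), X.vcomp_vid,
    ← vcomp_assoc' (one_mul 1) (one_mul 1) (one_mul 1) (one_mul P)]

theorem vcomp_sendL {P U U' W : X.Vert} {A B D E G Γ Δ Θ : X.Hor} (hU : P * U = U')
    (h₁ : Δ * Γ = Θ) (h₂ : G * D = E) {a : X.Cell 1 Γ D 1} {b : X.Cell 1 Δ G 1}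
    {ba : X.Cell 1 Θ E 1} (hba : X.hcomp h₁ h₂ b a = ba) {v : X.Cell 1 G A 1}
    {bv : X.Cell 1 Δ A 1} (hbv : X.vcomp (one_mul 1) (one_mul 1) b v = bv) (s : X.Cell P A 1 1)
    {t : X.Cell U D B W} {t' : X.Cell U Γ B W}
    (ht : t' = X.vcomp (one_mul U) (one_mul W) a t) :
    X.vcomp hU (one_mul W)
        (X.hcomp h₁ (one_mul Γ) (X.vcomp (one_mul P) (one_mul 1) bv s) (X.vid Γ)) t' =
      X.vcomp (one_mul U') (one_mul W) ba
        (X.vcomp hU (one_mul W)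
          (X.hcomp h₂ (one_mul D) (X.vcomp (one_mul P) (one_mul 1) v s) (X.vid D)) t) := by
  subst hba hbv ht
  rw [← vcomp_assoc' (one_mul P) (one_mul 1) hU (one_mul W),
    ← vcomp_assoc' (mul_one P) (one_mul 1) hU (one_mul W), slideL,
    interchange' (hV := one_mul 1), X.vcomp_vid,
    ← vcomp_assoc' (one_mul 1) (one_mul 1) (one_mul P) (one_mul 1)]

/-- Receiving commutes with substitution. -/
theorem vcomp_receiveR {P U W W' : X.Vert} {A B D E Γ Θ : X.Hor} (hW : P * W = W')
    (h₁ : Γ * A = Θ) (h₂ : D * A = E) {a : X.Cell 1 Γ D 1} {a' : X.Cell 1 Θ E 1}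
    (ha : X.hcomp h₁ h₂ a (X.vid A) = a') (r : X.Cell 1 1 A P)
    {t : X.Cell U E B W} {t' : X.Cell U Θ B W}
    (ht : t' = X.vcomp (one_mul U) (one_mul W) a' t) :
    X.vcomp (one_mul U) hW (X.hcomp (mul_one Γ) h₁ (X.vid Γ) r) t' =
      X.vcomp (one_mul U) (one_mul W') a
        (X.vcomp (one_mul U) hW (X.hcomp (mul_one D) h₂ (X.vid D) r) t) := by
  subst ha ht
  rw [← vcomp_assoc' (one_mul 1) (one_mul P) (one_mul U) hW,
    ← vcomp_assoc' (one_mul 1) (mul_one P) (one_mul U) hW, slideR',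
    interchange' (hV := one_mul 1), X.vcomp_vid, X.vid_vcomp]

theorem vcomp_receiveL {P U U' W : X.Vert} {A B D E Γ Θ : X.Hor} (hU : P * U = U')
    (h₁ : A * Γ = Θ) (h₂ : A * D = E) {a : X.Cell 1 Γ D 1} {a' : X.Cell 1 Θ E 1}
    (ha : X.hcomp h₁ h₂ (X.vid A) a = a') (r : X.Cell P 1 A 1)
    {t : X.Cell U E B W} {t' : X.Cell U Θ B W}
    (ht : t' = X.vcomp (one_mul U) (one_mul W) a' t) :
    X.vcomp hU (one_mul W) (X.hcomp (one_mul Γ) h₁ r (X.vid Γ)) t' =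
      X.vcomp (one_mul U') (one_mul W) a
        (X.vcomp hU (one_mul W) (X.hcomp (one_mul D) h₂ r (X.vid D)) t) := by
  subst ha ht
  rw [← vcomp_assoc' (one_mul P) (one_mul 1) hU (one_mul W),
    ← vcomp_assoc' (mul_one P) (one_mul 1) hU (one_mul W), slideL',
    interchange' (hV := one_mul 1), X.vcomp_vid, X.vid_vcomp]

end DoubleCat

/-! ### Invariance of the interpretation under convertibility -/

namespace HomSeq

variable {M : Multicategory.{u, v}}

theorem comp_single {Γ As : List M.Ob} {B : M.Ob} (p : HomSeq M.Hom Γ As) (f : M.Hom As B) :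
    HomSeq.comp M.comp p (single f) = single (M.comp p f) := by
  have := comp_cons M.comp (List.append_nil Γ) (List.append_nil As) p .nil f .nil
  rw [append_nil p] at this
  exact this

end HomSeq

namespace Term

variable {M : Multicategory.{u, v}}

/-- The cell of the free cornering given by a sequence of morphisms. -/
def seqCell {Γ As : List M.Ob} (p : HomSeq M.Hom Γ As) : (Cornering M).Cell [] Γ As [] :=
  Quotient.mk _ (.corner (𝔸 := freeMonoidal M) (A := Γ) (B := As) p)

theorem seqCell_ids (As : List M.Ob) : seqCell (HomSeq.ids M.one As) = (Cornering M).vid As :=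
  Quotient.sound (CellRel.symm (.vid_eq (𝔸 := freeMonoidal M) As))

theorem seqCell_app {Γ Δ Θ As Bs Cs : List M.Ob} (hΓ : Γ ++ Δ = Θ) (hA : As ++ Bs = Cs)
    (p : HomSeq M.Hom Γ As) (q : HomSeq M.Hom Δ Bs) :
    (Cornering M).hcomp hΓ hA (seqCell p) (seqCell q) = seqCell (HomSeq.app hΓ hA p q) := by
  subst hΓ hA
  exact Quotient.sound (.corner_tensor (𝔸 := freeMonoidal M) p q)

theorem vcomp_cornerCell {Γ As : List M.Ob} {B : M.Ob} (p : HomSeq M.Hom Γ As) (f : M.Hom As B) :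
    (Cornering M).vcomp (one_mul _) (one_mul _) (seqCell p) (cornerCell f) =
      cornerCell (M.comp p f) := by
  refine Eq.trans (Quotient.sound (.corner_comp (𝔸 := freeMonoidal M) p (HomSeq.single f))) ?_
  exact congrArg seqCell (HomSeq.comp_single p f)

theorem send_receive_circ (A : M.Ob) :
    (Cornering M).hcomp (mul_one _) (one_mul _) (sendRCell A) (receiveLCell A) =
      (Cornering M).vid [A] :=
  Quotient.sound (.yank_circ_hor (𝔸 := freeMonoidal M) [A])

theorem receive_send_bullet (A : M.Ob) :
    (Cornering M).hcomp (one_mul _) (mul_one _) (receiveRCell A) (sendLCell A) =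
      (Cornering M).vid [A] :=
  Quotient.sound (.yank_bullet_hor (𝔸 := freeMonoidal M) [A])

theorem subst_putR {U W : Exch M.Ob} {Δ Γ Θ Δ' Γ' Θ' : List M.Ob} {A B : M.Ob} (h : Δ ++ Γ = Θ)
    (h' : Δ' ++ Γ' = Θ') (p : HomSeq M.Hom Δ' Δ) (q : HomSeq M.Hom Γ' Γ) (v : M.Hom Γ A)
    (t : Term M U Δ B W) :
    subst (HomSeq.app h' h p q) (.putR h v t) = .putR h' (M.comp q v) (subst p t) := by
  subst h
  exact congrArg (fun s : HomSeq.Split _ _ _ _ =>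
    Term.putR s.h (M.comp s.snd v) (subst s.fst t)) (HomSeq.split_app h' p q)

theorem subst_putL {U W : Exch M.Ob} {Δ Γ Θ Δ' Γ' Θ' : List M.Ob} {A B : M.Ob} (h : Γ ++ Δ = Θ)
    (h' : Γ' ++ Δ' = Θ') (p : HomSeq M.Hom Γ' Γ) (q : HomSeq M.Hom Δ' Δ) (v : M.Hom Γ A)
    (t : Term M U Δ B W) :
    subst (HomSeq.app h' h p q) (.putL h v t) = .putL h' (M.comp p v) (subst q t) := by
  subst h
  exact congrArg (fun s : HomSeq.Split _ _ _ _ =>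
    Term.putL s.h (M.comp s.fst v) (subst s.snd t)) (HomSeq.split_app h' p q)

theorem substPath_cons {U V W : Exch M.Ob} {Δ Γ Θ Δ' Γ' Θ' As : List M.Ob} {A : M.Ob}
    (h : Γ ++ Δ = Θ) (h' : Γ' ++ Δ' = Θ') (p : HomSeq M.Hom Γ' Γ) (q : HomSeq M.Hom Δ' Δ)
    (t : Term M U Γ A V) (ts : CellPath (Term M) V Δ As W) :
    substPath (HomSeq.app h' h p q) (.cons h t ts) = .cons h' (subst p t) (substPath q ts) := by
  subst h
  exact congrArg (fun s : HomSeq.Split _ _ _ _ =>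
    CellPath.cons s.h (subst s.fst t) (substPath s.snd ts)) (HomSeq.split_app h' p q)

mutual

/-- Substitution is interpreted by vertical composition. -/
theorem interp_subst {U W : Exch M.Ob} {Γ Δ : List M.Ob} {B : M.Ob} (p : HomSeq M.Hom Γ Δ) :
    (t : Term M U Δ B W) → interp (subst p t) =
      (Cornering M).vcomp (List.nil_append U.single) (List.nil_append W.single)
        (seqCell p) (interp t)
  | .neutral v => (vcomp_cornerCell p v).symm
  | .letIn hU hW hn ts t => by
    simp only [subst, interp, interpPath_subst p ts]
    exact DoubleCat.vcomp_assoc' _ _ _ _ _ _ _ _ _ _ _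
  | .putR h v t => by
    obtain ⟨Γ, Δ, h', p, q, rfl⟩ := HomSeq.exists_app p _ h
    rw [subst_putR]
    exact DoubleCat.vcomp_sendR (X := Cornering M) rfl h' h (seqCell_app h' h p q)
      (vcomp_cornerCell q v) (sendRCell _) (interp_subst p t)
  | .getL (A := A) t => by
    have := (congrArg (fun x => (Cornering M).hcomp rfl rfl x (seqCell p))
      (seqCell_ids [A])).symm.trans
      (seqCell_app rfl rfl (HomSeq.ids M.one [A]) p)
    exact DoubleCat.vcomp_receiveL (X := Cornering M) rfl rfl rfl this (receiveLCell A)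
      (interp_subst _ t)
  | .getR (A := A) t => by
    have := (congrArg ((Cornering M).hcomp rfl rfl (seqCell p)) (seqCell_ids [A])).symm.trans
      (seqCell_app rfl rfl p (HomSeq.ids M.one [A]))
    exact DoubleCat.vcomp_receiveR (X := Cornering M) rfl rfl rfl this (receiveRCell A)
      (interp_subst _ t)
  | .putL h v t => by
    obtain ⟨Γ, Δ, h', p, q, rfl⟩ := HomSeq.exists_app p _ h
    rw [subst_putL]
    exact DoubleCat.vcomp_sendL (X := Cornering M) rfl h' h (seqCell_app h' h p q)
      (vcomp_cornerCell p v) (sendLCell _) (interp_subst q t)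

theorem interpPath_subst : {U W : Exch M.Ob} → {Γ Δ As : List M.Ob} → (p : HomSeq M.Hom Γ Δ) →
    (ts : CellPath (Term M) U Δ As W) → interpPath (substPath p ts) =
      (Cornering M).vcomp (List.nil_append U.single) (List.nil_append W.single)
        (seqCell p) (interpPath ts)
  | _, _, _, _, _, p, .nil U => by
    cases p
    exact ((congrArg (fun x => DoubleCat.vcomp (Cornering M) _ _ x ((Cornering M).hid U.single))
      (seqCell_ids [])).trans ((Cornering M).vid_vcomp _)).symm
  | _, _, _, _, _, p, .cons h t ts => by
    obtain ⟨Γ, Δ, h', p, q, rfl⟩ := HomSeq.exists_app p _ h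
    rw [substPath_cons]
    simp only [interpPath]
    rw [interp_subst p t, interpPath_subst q ts, ← seqCell_app h' h]
    exact (DoubleCat.interchange' (X := Cornering M) _ _ _ _ _ _ _ _ _ _).symm

end

theorem interpPath_neutrals {Γ As : List M.Ob} (vs : HomSeq M.Hom Γ As) :
    interpPath (neutrals vs) = seqCell vs := by
  induction vs with
  | nil => exact (Cornering M).hid_one.trans (seqCell_ids []).symm
  | cons h f fs ih =>
    simp only [neutrals, interpPath, interp, ih]
    exact (seqCell_app h rfl (HomSeq.single f) fs).trans
      (congrArg seqCell (HomSeq.cons_eq_app h f fs).symm)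

theorem interpPath_append {U V W : Exch M.Ob} {Γ Δ Θ As Bs : List M.Ob} (h : Γ ++ Δ = Θ)
    (p : CellPath (Term M) U Γ As V) (q : CellPath (Term M) V Δ Bs W) :
    interpPath (p.append h q) = (Cornering M).hcomp h rfl (interpPath p) (interpPath q) := by
  induction p generalizing Θ with
  | nil => subst h; exact ((Cornering M).hid_hcomp (interpPath q)).symm
  | cons h' a p ih =>
    subst h h'
    simp only [CellPath.append, interpPath]
    rw [ih]
    exact (DoubleCat.hcomp_assoc' (X := Cornering M) _ _ _ _ _ _ _ _ _ _ _).symm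

theorem interp_substFirst {U W : Exch M.Ob} {Γ Δ : List M.Ob} {A B : M.Ob} (v : M.Hom Γ A)
    (t : Term M U (A :: Δ) B W) :
    interp (substFirst v t) = (Cornering M).vcomp (List.nil_append U.single)
      (List.nil_append W.single)
      ((Cornering M).hcomp rfl rfl (cornerCell v) ((Cornering M).vid Δ)) (interp t) := by
  refine (interp_subst _ t).trans
    (congrArg (fun x => DoubleCat.vcomp (Cornering M) _ _ x (interp t)) ?_)
  refine (congrArg seqCell (HomSeq.cons_eq_app rfl v _)).trans ((seqCell_app _ _ _ _).symm.trans ?_)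
  exact congrArg (DoubleCat.hcomp _ _ _ _) (seqCell_ids Δ)

theorem interp_substLast {U W : Exch M.Ob} {Γ Δ : List M.Ob} {A B : M.Ob} (v : M.Hom Γ A)
    (t : Term M U (Δ ++ [A]) B W) :
    interp (substLast v t) = (Cornering M).vcomp (List.nil_append U.single)
      (List.nil_append W.single)
      ((Cornering M).hcomp rfl rfl ((Cornering M).vid Δ) (cornerCell v)) (interp t) := by
  refine (interp_subst _ t).trans
    (congrArg (fun x => DoubleCat.vcomp (Cornering M) _ _ x (interp t)) ?_)
  refine (seqCell_app rfl rfl _ _).symm.trans ?_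
  exact congrArg (fun x => DoubleCat.hcomp _ _ _ x (cornerCell v)) (seqCell_ids Δ)

theorem interpPath_append_single {U V W : Exch M.Ob} {Γ Δ Θ As : List M.Ob} {B : M.Ob}
    (h : Γ ++ Δ = Θ) (p : CellPath (Term M) U Γ As V) (t : Term M V Δ B W) :
    interpPath (p.append h (.single t)) = (Cornering M).hcomp h rfl (interpPath p) (interp t) := by
  refine (interpPath_append h p _).trans (congrArg (DoubleCat.hcomp _ _ _ _) ?_)
  exact (Cornering M).hcomp_hid (interp t)

mutual

/-- Every rewrite preserves the interpretation. -/
theorem interp_eq_of_step : {U W : Exch M.Ob} → {Γ : List M.Ob} → {B : M.Ob} →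
    {t t' : Term M U Γ B W} → Step t t' → interp t = interp t'
  | _, _, _, _, _, _, .r0 vs t =>
    (congrArg (fun x => DoubleCat.vcomp (Cornering M) _ _ x (interp t))
      (interpPath_neutrals vs)).trans (interp_subst vs t).symm
  | _, _, _, _, _, _, .r3 hU hW h₁ h₂ h₃ h₄ v t ts r => by
    have key := DoubleCat.vcomp_whiskerL_hcomp (X := Cornering M) rfl h₁ rfl h₂ h₃ h₃ h₄ rfl rfl
      ((Cornering M).vcomp rfl rfl (cornerCell v) (sendLCell _)) (interp t) (interpPath ts)
    refine (congrArg (fun x => DoubleCat.vcomp (Cornering M) _ _ x (interp r)) key).trans ?_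
    exact DoubleCat.vcomp_assoc' (X := Cornering M) _ _ _ _ _ _ _ _ _ _ _
  | _, _, _, _, _, _, .r4 (A := A) hU hW h t ts r => by
    have key := DoubleCat.vcomp_whiskerL_hcomp (X := Cornering M) rfl rfl rfl h
      (congrArg (A :: ·) h) h rfl rfl rfl (receiveLCell A) (interp t) (interpPath ts)
    refine (congrArg (fun x => DoubleCat.vcomp (Cornering M) _ _ x (interp r)) key).trans ?_
    exact DoubleCat.vcomp_assoc' (X := Cornering M) _ _ _ _ _ _ _ _ _ _ _
  | _, _, _, _, _, _, .r5 hU hW h₁ h₂ h₃ h₄ ts v t r => by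
    have key := (interpPath_append_single h₂ ts (.putR h₁ v t)).trans
      (DoubleCat.vcomp_whiskerR_hcomp (X := Cornering M) rfl h₁ (List.append_nil _) h₂ h₃ h₃ h₄
        (List.append_nil _) rfl ((Cornering M).vcomp rfl rfl (cornerCell v) (sendRCell _))
        (interp t) (interpPath ts))
    refine (congrArg (fun x => DoubleCat.vcomp (Cornering M) _ _ x (interp r))
      (key.trans (congrArg (DoubleCat.vcomp (Cornering M) _ _ _)
        (interpPath_append_single h₃ ts t).symm))).trans ?_
    exact DoubleCat.vcomp_assoc' (X := Cornering M) _ _ _ _ _ _ _ _ _ _ _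
  | _, _, _, _, _, _, .r6 (A := A) hU hW h₁ h₂ ts t r => by
    have key := (interpPath_append_single h₁ ts (.getR t)).trans
      (DoubleCat.vcomp_whiskerR_hcomp (X := Cornering M) rfl (List.append_nil _) rfl h₁ h₂ h₁
        (List.append_nil _) rfl rfl (receiveRCell A) (interp t) (interpPath ts))
    refine (congrArg (fun x => DoubleCat.vcomp (Cornering M) _ _ x (interp r))
      (key.trans (congrArg (DoubleCat.vcomp (Cornering M) _ _ _)
        (interpPath_append_single h₂ ts t).symm))).trans ?_
    exact DoubleCat.vcomp_assoc' (X := Cornering M) _ _ _ _ _ _ _ _ _ _ _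
  | _, _, _, _, _, _, .r7 (Γ := Γ) (Δ := Δ) (Φ := Φ) h₁ h₂ h₃ h₄ v w t =>
    DoubleCat.whiskerR_whiskerL_comm (X := Cornering M) (F := Φ) (F' := ([] : List M.Ob)) (G := Γ)
      (G' := ([] : List M.Ob)) (D := Δ) rfl rfl h₁ (List.append_nil _) h₃ rfl h₂
      (List.append_nil _) h₁ rfl h₄ rfl h₃ (List.append_nil _) _ _ (interp t)
  | _, _, _, _, _, _, .r8 (Γ := Γ) (Δ := Δ) (A' := A') h v t =>
    DoubleCat.whiskerR_whiskerL_comm (X := Cornering M) (F := ([] : List M.Ob)) (F' := [A'])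
      (G := Γ) (G' := ([] : List M.Ob)) (D := Δ) rfl rfl rfl (List.append_nil _) h rfl h
      (List.append_nil _) rfl rfl rfl rfl (congrArg (_ :: ·) h) (List.append_nil _) _ _ (interp t)
  | _, _, _, _, _, _, .r9 (Γ := Γ) (Δ := Δ) (A' := A') h₁ h₂ v t =>
    DoubleCat.whiskerR_whiskerL_comm (X := Cornering M) (F := Γ) (F' := ([] : List M.Ob))
      (G := ([] : List M.Ob)) (G' := [A']) (D := Δ) rfl rfl h₂ rfl (List.append_nil _) rfl
      (List.append_nil _) rfl h₁ rfl h₂ rfl (List.append_nil _) rfl _ _ (interp t)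
  | _, _, _, _, _, _, .r10 (Γ := Γ) (A := A) (A' := A') t =>
    DoubleCat.whiskerR_whiskerL_comm (X := Cornering M) (F := ([] : List M.Ob)) (F' := [A'])
      (G := ([] : List M.Ob)) (G' := [A]) (D := Γ) rfl rfl rfl rfl (List.append_nil _) rfl
      (List.append_nil _) rfl rfl rfl rfl rfl (List.append_nil (_ :: Γ)) rfl _ _ (interp t)
  | _, _, _, _, _, _, .letIn_args hU hW hn t h =>
    congrArg (fun x => DoubleCat.vcomp (Cornering M) _ _ x (interp t)) (interpPath_eq_of_step h)
  | _, _, _, _, _, _, .letIn_body hU hW hn ts h =>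
    congrArg (DoubleCat.vcomp (Cornering M) _ _ (interpPath ts)) (interp_eq_of_step h)
  | _, _, _, _, _, _, .putR h v h' =>
    congrArg (DoubleCat.vcomp (Cornering M) _ _ _) (interp_eq_of_step h')
  | _, _, _, _, _, _, .getL h' =>
    congrArg (DoubleCat.vcomp (Cornering M) _ _ _) (interp_eq_of_step h')
  | _, _, _, _, _, _, .getR h' =>
    congrArg (DoubleCat.vcomp (Cornering M) _ _ _) (interp_eq_of_step h')
  | _, _, _, _, _, _, .putL h v h' =>
    congrArg (DoubleCat.vcomp (Cornering M) _ _ _) (interp_eq_of_step h')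

theorem interpPath_eq_of_step : {U W : Exch M.Ob} → {Γ As : List M.Ob} →
    {p p' : CellPath (Term M) U Γ As W} → StepPath p p' → interpPath p = interpPath p'
  | _, _, _, _, _, _, .r1 (Γ := Γ) (Φ := Φ) (A := A) h₁ h₂ h₃ h₄ h₅ v t s b => by
    have key := DoubleCat.hcomp_send_receive (X := Cornering M) (F := Φ) (K := Γ ++ Φ)
      (send_receive_circ A) rfl h₁ rfl rfl rfl ((List.append_assoc _ _ _).symm.trans
        (congrArg (· ++ Φ) h₁)) rfl (cornerCell v) (interp t) (interp s)
    refine (DoubleCat.hcomp_assoc' (X := Cornering M) rfl rfl ((List.append_assoc _ _ _).trans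
      ((congrArg _ h₂).trans h₃)) rfl h₂ rfl h₃ rfl _ _ (interpPath b)).symm.trans ?_
    refine (congrArg (fun x => DoubleCat.hcomp (Cornering M) _ _ x (interpPath b)) key).trans ?_
    refine (DoubleCat.hcomp_assoc' (X := Cornering M) _ rfl _ rfl h₄ rfl h₅ rfl _ _ _).trans ?_
    exact congrArg (fun x => DoubleCat.hcomp (Cornering M) _ _ (interp t)
      (DoubleCat.hcomp (Cornering M) _ _ x (interpPath b))) (interp_substFirst v s).symm
  | _, _, _, _, _, _, .r2 (Δ := Δ) (Γ := Γ) (Φ := Φ) (A := A) h₁ h₂ h₃ h₄ h₅ v t s b => by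
    have key := DoubleCat.hcomp_receive_send (X := Cornering M) (F := Φ) (D₁ := Δ ++ Γ)
      (receive_send_bullet A) rfl h₁ rfl rfl rfl ((List.append_assoc _ _ _).trans
        (congrArg (Δ ++ ·) h₁)) rfl (cornerCell v) (interp t) (interp s)
    refine (DoubleCat.hcomp_assoc' (X := Cornering M) rfl rfl ((List.append_assoc _ _ _).trans
      ((congrArg _ h₂).trans h₃)) rfl h₂ rfl h₃ rfl _ _ (interpPath b)).symm.trans ?_
    refine (congrArg (fun x => DoubleCat.hcomp (Cornering M) _ _ x (interpPath b)) key).trans ?_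
    refine (DoubleCat.hcomp_assoc' (X := Cornering M) _ rfl _ rfl h₄ rfl h₅ rfl _ _ _).trans ?_
    exact congrArg (fun x => DoubleCat.hcomp (Cornering M) _ _ x
      (DoubleCat.hcomp (Cornering M) _ _ (interp s) (interpPath b))) (interp_substLast v t).symm
  | _, _, _, _, _, _, .head h ts h' =>
    congrArg (fun x => DoubleCat.hcomp (Cornering M) _ _ x (interpPath ts)) (interp_eq_of_step h')
  | _, _, _, _, _, _, .tail h t h' =>
    congrArg (DoubleCat.hcomp (Cornering M) _ _ (interp t)) (interpPath_eq_of_step h')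

end

/-- Convertible terms have the same interpretation. -/
theorem interp_eq_of_conv {U W : Exch M.Ob} {Γ : List M.Ob} {B : M.Ob} {t t' : Term M U Γ B W}
    (h : Conv t t') : interp t = interp t' := by
  induction h with
  | rel _ _ h => exact interp_eq_of_step h
  | refl _ => rfl
  | symm _ _ _ ih => exact ih.symm
  | trans _ _ _ _ _ ih ih' => exact ih.trans ih'

/-! ### Substitution of identities -/

mutual

theorem subst_ids : {U W : Exch M.Ob} → {Γ : List M.Ob} → {B : M.Ob} → (t : Term M U Γ B W) →
    subst (HomSeq.ids M.one Γ) t = t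
  | _, _, _, _, .neutral v => congrArg Term.neutral (M.one_comp v)
  | _, _, _, _, .letIn hU hW hn ts t =>
    congrArg (fun x => Term.letIn hU hW hn x t) (substPath_ids ts)
  | _, _, _, _, .putR h v t => by
    rw [HomSeq.ids_app M.one h, subst_putR, M.one_comp, subst_ids t]
  | _, _, _, _, .getL t => congrArg Term.getL (subst_ids t)
  | _, _, _, _, .getR t =>
    congrArg Term.getR ((congrArg (fun x => subst x t) (HomSeq.ids_append M.one _ _).symm).trans
      (subst_ids t))
  | _, _, _, _, .putL h v t => by
    rw [HomSeq.ids_app M.one h, subst_putL, M.one_comp, subst_ids t]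

theorem substPath_ids : {U W : Exch M.Ob} → {Γ As : List M.Ob} → (p : CellPath (Term M) U Γ As W) →
    substPath (HomSeq.ids M.one Γ) p = p
  | _, _, _, _, .nil U => rfl
  | _, _, _, _, .cons h t ts => by
    rw [HomSeq.ids_app M.one h, substPath_cons, subst_ids t, substPath_ids ts]

end

theorem substFirst_one {U W : Exch M.Ob} {Γ : List M.Ob} {A B : M.Ob} (t : Term M U (A :: Γ) B W) :
    substFirst (M.one A) t = t := subst_ids t

theorem substLast_one {U W : Exch M.Ob} {Γ : List M.Ob} {A B : M.Ob} (t : Term M U (Γ ++ [A]) B W) :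
    substLast (M.one A) t = t :=
  (congrArg (fun x => subst x t) (HomSeq.ids_append M.one Γ [A]).symm).trans (subst_ids t)

/-! ### Convertibility is a congruence -/

theorem Conv.lift {U W U' W' : Exch M.Ob} {Γ Γ' : List M.Ob} {B B' : M.Ob}
    (F : Term M U Γ B W → Term M U' Γ' B' W') (hF : ∀ t t', Step t t' → Step (F t) (F t'))
    {t t' : Term M U Γ B W} (h : Conv t t') : Conv (F t) (F t') := by
  induction h with
  | rel _ _ h' => exact .rel _ _ (hF _ _ h')
  | refl _ => exact .refl _
  | symm _ _ _ ih => exact .symm _ _ ih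
  | trans _ _ _ _ _ ih ih' => exact .trans _ _ _ ih ih'

theorem ConvPath.lift {U W U' W' : Exch M.Ob} {Γ Γ' As As' : List M.Ob}
    (F : CellPath (Term M) U Γ As W → CellPath (Term M) U' Γ' As' W')
    (hF : ∀ t t', StepPath t t' → StepPath (F t) (F t'))
    {t t' : CellPath (Term M) U Γ As W} (h : ConvPath t t') : ConvPath (F t) (F t') := by
  induction h with
  | rel _ _ h' => exact .rel _ _ (hF _ _ h')
  | refl _ => exact .refl _
  | symm _ _ _ ih => exact .symm _ _ ih
  | trans _ _ _ _ _ ih ih' => exact .trans _ _ _ ih ih'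

theorem Conv.of_eq {U W : Exch M.Ob} {Γ : List M.Ob} {B : M.Ob} {t t' : Term M U Γ B W}
    (h : t = t') : Conv t t' := h ▸ .refl _

theorem ConvPath.of_eq {U W : Exch M.Ob} {Γ As : List M.Ob} {t t' : CellPath (Term M) U Γ As W}
    (h : t = t') : ConvPath t t' := h ▸ .refl _

theorem Conv.putR {U W : Exch M.Ob} {Δ Γ Θ : List M.Ob} {A B : M.Ob} (h : Δ ++ Γ = Θ)
    (v : M.Hom Γ A) {t t' : Term M U Δ B W} (ht : Conv t t') :
    Conv (.putR h v t) (.putR h v t') := ht.lift _ fun _ _ => .putR h v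

theorem Conv.putL {U W : Exch M.Ob} {Γ Δ Θ : List M.Ob} {A B : M.Ob} (h : Γ ++ Δ = Θ)
    (v : M.Hom Γ A) {t t' : Term M U Δ B W} (ht : Conv t t') :
    Conv (.putL h v t) (.putL h v t') := ht.lift _ fun _ _ => .putL h v

theorem Conv.getL {U W : Exch M.Ob} {Γ : List M.Ob} {A B : M.Ob} {t t' : Term M U (A :: Γ) B W}
    (ht : Conv t t') : Conv (.getL t) (.getL t') := ht.lift _ fun _ _ => .getL

theorem Conv.getR {U W : Exch M.Ob} {Γ : List M.Ob} {A B : M.Ob} {t t' : Term M U (Γ ++ [A]) B W}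
    (ht : Conv t t') : Conv (.getR t) (.getR t') := ht.lift _ fun _ _ => .getR

theorem Conv.letIn_body {U P U' W Q W' : Exch M.Ob} {Γ As : List M.Ob} {B : M.Ob} (hU : U ++ P = U')
    (hW : W ++ Q = W') (hn : As = [] → U = []) (ts : CellPath (Term M) U Γ As W)
    {t t' : Term M P As B Q} (ht : Conv t t') :
    Conv (.letIn hU hW hn ts t) (.letIn hU hW hn ts t') := ht.lift _ fun _ _ => .letIn_body _ _ _ _

theorem Conv.letIn_args {U P U' W Q W' : Exch M.Ob} {Γ As : List M.Ob} {B : M.Ob} (hU : U ++ P = U')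
    (hW : W ++ Q = W') (hn : As = [] → U = []) {ts ts' : CellPath (Term M) U Γ As W}
    (t : Term M P As B Q) (h : ConvPath ts ts') :
    Conv (.letIn hU hW hn ts t) (.letIn hU hW hn ts' t) := by
  induction h with
  | rel _ _ h' => exact .rel _ _ (.letIn_args _ _ _ _ h')
  | refl _ => exact .refl _
  | symm _ _ _ ih => exact .symm _ _ ih
  | trans _ _ _ _ _ ih ih' => exact .trans _ _ _ ih ih'

theorem StepPath.app_left {U V W : Exch M.Ob} {Γ Δ Θ As Bs Cs : List M.Ob} (h : Γ ++ Δ = Θ)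
    (hA : As ++ Bs = Cs) (p : CellPath (Term M) U Γ As V) {q q' : CellPath (Term M) V Δ Bs W}
    (hq : StepPath q q') : StepPath (p.app h hA q) (p.app h hA q') := by
  subst hA
  induction p generalizing Θ with
  | nil => subst h; exact hq
  | cons h' t ts ih => subst h h'; exact .tail _ _ (ih rfl hq)

theorem StepPath.app_right {U V W : Exch M.Ob} {Γ Δ Θ As Bs Cs : List M.Ob} (h : Γ ++ Δ = Θ)
    (hA : As ++ Bs = Cs) {p p' : CellPath (Term M) U Γ As V} (q : CellPath (Term M) V Δ Bs W)
    (hp : StepPath p p') : StepPath (p.app h hA q) (p'.app h hA q) := by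
  subst hA
  induction p generalizing Θ with
  | nil => cases hp
  | cons h' t ts ih =>
    cases hp with
    | r1 h₁ h₂ h₃ h₄ h₅ v t s b => exact .r1 _ _ _ _ _ _ _ _ _
    | r2 h₁ h₂ h₃ h₄ h₅ v t s b => exact .r2 _ _ _ _ _ _ _ _ _
    | head h ts ht => exact .head _ _ ht
    | tail h t hts => exact .tail _ _ (ih _ _ hts)

theorem ConvPath.app {U V W : Exch M.Ob} {Γ Δ Θ As Bs Cs : List M.Ob} (h : Γ ++ Δ = Θ)
    (hA : As ++ Bs = Cs) {p p' : CellPath (Term M) U Γ As V} {q q' : CellPath (Term M) V Δ Bs W}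
    (hp : ConvPath p p') (hq : ConvPath q q') : ConvPath (p.app h hA q) (p'.app h hA q') :=
  .trans _ _ _ (hp.lift (fun p => p.app h hA q) fun _ _ => .app_right h hA q)
    (hq.lift (fun q => p'.app h hA q) fun _ _ => .app_left h hA p')

theorem ConvPath.cons {U V W : Exch M.Ob} {Γ Δ Θ As : List M.Ob} {A : M.Ob}
    (h : Γ ++ Δ = Θ) {t t' : Term M U Γ A V} {ts ts' : CellPath (Term M) V Δ As W}
    (ht : Conv t t') (hts : ConvPath ts ts') : ConvPath (.cons h t ts) (.cons h t' ts') :=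
  .trans _ _ _ (convPath_cons_head h ts ht) (convPath_cons_tail h t' hts)

/-! ### Terms without lets -/

/-- `LetFree n t` states that `t` contains no let and performs `n` communications. -/
inductive LetFree : ℕ → {U W : Exch M.Ob} → {Γ : List M.Ob} → {B : M.Ob} →
    Term M U Γ B W → Prop
  | neutral {Γ : List M.Ob} {A : M.Ob} (v : M.Hom Γ A) : LetFree 0 (.neutral v)
  | putR {n : ℕ} {U W : Exch M.Ob} {Δ Γ Θ : List M.Ob} {A B : M.Ob} (h : Δ ++ Γ = Θ)
      (v : M.Hom Γ A) {t : Term M U Δ B W} : LetFree n t → LetFree (n + 1) (.putR h v t)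
  | getL {n : ℕ} {U W : Exch M.Ob} {Γ : List M.Ob} {A B : M.Ob} {t : Term M U (A :: Γ) B W} :
      LetFree n t → LetFree (n + 1) (.getL t)
  | getR {n : ℕ} {U W : Exch M.Ob} {Γ : List M.Ob} {A B : M.Ob} {t : Term M U (Γ ++ [A]) B W} :
      LetFree n t → LetFree (n + 1) (.getR t)
  | putL {n : ℕ} {U W : Exch M.Ob} {Γ Δ Θ : List M.Ob} {A B : M.Ob} (h : Γ ++ Δ = Θ)
      (v : M.Hom Γ A) {t : Term M U Δ B W} : LetFree n t → LetFree (n + 1) (.putL h v t)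

/-- `LetFreePath n p` states that the entries of `p` contain no lets and perform `n` communications
in all. -/
inductive LetFreePath : ℕ → {U W : Exch M.Ob} → {Γ As : List M.Ob} →
    CellPath (Term M) U Γ As W → Prop
  | nil (U : Exch M.Ob) : LetFreePath 0 (.nil U)
  | cons {m n k : ℕ} {U V W : Exch M.Ob} {Γ Δ Θ As : List M.Ob} {A : M.Ob} (h : Γ ++ Δ = Θ)
      {t : Term M U Γ A V} {ts : CellPath (Term M) V Δ As W} (hk : m + n = k) :
      LetFree m t → LetFreePath n ts → LetFreePath k (.cons h t ts)

theorem LetFree.subst {n : ℕ} {U W : Exch M.Ob} {Γ : List M.Ob} {B : M.Ob}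
    {t : Term M U Γ B W} (h : LetFree n t) {Δ : List M.Ob} (p : HomSeq M.Hom Δ Γ) :
    LetFree n (subst p t) := by
  induction h generalizing Δ with
  | neutral v => exact .neutral _
  | putR _ _ _ ih => exact .putR _ _ (ih _)
  | getL _ ih => exact .getL (ih _)
  | getR _ ih => exact .getR (ih _)
  | putL _ _ _ ih => exact .putL _ _ (ih _)

/-- The possible shapes of a path of terms without lets: some communication is available, at one
end or between two neighbours, unless all the entries are neutral. Each shape comes with the path
that is left after the communication. -/
inductive Redex : ℕ → {U W : Exch M.Ob} → {Γ As : List M.Ob} → CellPath (Term M) U Γ As W → Prop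
  | neutrals {n : ℕ} {Γ As : List M.Ob} (vs : HomSeq M.Hom Γ As) : Redex n (neutrals vs)
  | putL {m n : ℕ} (hm : m < n) {U V W : Exch M.Ob} {Φ Δ Γ Ξ Θ Ψ As : List M.Ob} {A B : M.Ob}
      (h₁ : Φ ++ Δ = Γ) (h₂ : Γ ++ Ξ = Θ) (h₃ : Δ ++ Ξ = Ψ)
      (v : M.Hom Φ A) (t : Term M U Δ B V) (ts : CellPath (Term M) V Ξ As W) :
      LetFreePath m (.cons h₃ t ts) → Redex n (.cons h₂ (.putL h₁ v t) ts)
  | getL {m n : ℕ} (hm : m < n) {U V W : Exch M.Ob} {Γ Ξ Θ As : List M.Ob} {A B : M.Ob}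
      (h : Γ ++ Ξ = Θ) (t : Term M U (A :: Γ) B V) (ts : CellPath (Term M) V Ξ As W) :
      LetFreePath m (.cons (congrArg (A :: ·) h) t ts) → Redex n (.cons h (.getL t) ts)
  | putR {m n : ℕ} (hm : m < n) {U V W : Exch M.Ob} {Φ Δ Γ Ξ Θ Ψ As Bs : List M.Ob} {A B : M.Ob}
      (h₁ : Δ ++ Φ = Γ) (h₂ : Ξ ++ Γ = Θ) (h₃ : Ξ ++ Δ = Ψ) (hA : As ++ [B] = Bs)
      (ts : CellPath (Term M) U Ξ As V) (v : M.Hom Φ A) (t : Term M V Δ B W) :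
      LetFreePath m (ts.app h₃ hA (.single t)) →
      Redex n (ts.app h₂ hA (.single (.putR h₁ v t)))
  | getR {m n : ℕ} (hm : m < n) {U V W : Exch M.Ob} {Γ Ξ Θ As Bs : List M.Ob} {A B : M.Ob}
      (h₁ : Ξ ++ Γ = Θ) (h₂ : Ξ ++ (Γ ++ [A]) = Θ ++ [A]) (hA : As ++ [B] = Bs)
      (ts : CellPath (Term M) U Ξ As V) (t : Term M V (Γ ++ [A]) B W) :
      LetFreePath m (ts.app h₂ hA (.single t)) →
      Redex n (ts.app h₁ hA (.single (.getR t)))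
  | sendReceive {m n : ℕ} (hm : m < n) {U V V' V'' W : Exch M.Ob}
      {Δ Γ Ψ Ξ Φ Θ Θ₁ Θ₂ Λ Ω As Bs Cs : List M.Ob}
      {A B C : M.Ob} (h₀ : Λ ++ Θ = Ω)
      (h₁ : Δ ++ Γ = Ψ) (h₂ : Φ ++ Ξ = Θ₁) (h₃ : Ψ ++ Θ₁ = Θ) (h₄ : Γ ++ Φ ++ Ξ = Θ₂)
      (h₅ : Δ ++ Θ₂ = Θ) (hA : Bs ++ B :: C :: As = Cs) (a : CellPath (Term M) U Λ Bs V'')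
      (v : M.Hom Γ A) (t : Term M V'' Δ B V) (s : Term M V (A :: Φ) C V')
      (b : CellPath (Term M) V' Ξ As W) :
      LetFreePath m (a.app h₀ hA (.cons h₅ t (.cons h₄ (substFirst v s) b))) →
      Redex n (a.app h₀ hA (.cons h₃ (.putR h₁ v t) (.cons h₂ (.getL s) b)))
  | receiveSend {m n : ℕ} (hm : m < n) {U V V' V'' W : Exch M.Ob}
      {Δ Γ Ψ Ξ Φ Θ Θ₁ Θ₂ Λ Ω As Bs Cs : List M.Ob}
      {A B C : M.Ob} (h₀ : Λ ++ Θ = Ω)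
      (h₁ : Γ ++ Φ = Ψ) (h₂ : Ψ ++ Ξ = Θ₁) (h₃ : Δ ++ Θ₁ = Θ) (h₄ : Φ ++ Ξ = Θ₂)
      (h₅ : Δ ++ Γ ++ Θ₂ = Θ) (hA : Bs ++ B :: C :: As = Cs) (a : CellPath (Term M) U Λ Bs V'')
      (v : M.Hom Γ A) (t : Term M V'' (Δ ++ [A]) B V) (s : Term M V Φ C V')
      (b : CellPath (Term M) V' Ξ As W) :
      LetFreePath m (a.app h₀ hA (.cons h₅ (substLast v t) (.cons h₄ s b))) →
      Redex n (a.app h₀ hA (.cons h₃ (.getR t) (.cons h₂ (.putL h₁ v s) b)))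

/-- If `ts` communicates with its left boundary, then, as the boundaries fit, the new entry `t` is
the other side of that communication, or acts on its own left boundary. Any other communication of
`ts` is one of the whole path. -/
theorem Redex.cons {m n : ℕ} {U V W : Exch M.Ob} {Γ Δ Θ As : List M.Ob} {A : M.Ob}
    (h : Γ ++ Δ = Θ) {t : Term M U Γ A V} {ts : CellPath (Term M) V Δ As W} (ht : LetFree m t)
    (hts : LetFreePath n ts) (hR : Redex n ts) : Redex (m + n) (.cons h t ts) := by
  cases hR with
  | neutrals vs =>
    cases ht with
    | neutral v => exact .neutrals (.cons h v vs)
    | getL ht => exact .getL (by omega) _ _ _ (.cons _ rfl ht hts)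
    | putL h' v ht => exact .putL (by omega) _ _ rfl _ _ _ (.cons _ rfl ht hts)
  | putR hm h₁ h₂ h₃ hA a v s hs =>
    have := LetFreePath.cons (h := rfl) rfl ht hs
    rw [CellPath.cons_app (h₃ := rfl)] at this ⊢
    exact .putR (by omega) _ _ _ _ _ _ _ this
  | getR hm h₁ h₂ hA a s hs =>
    have := LetFreePath.cons (h := (by rw [← List.append_assoc, h])) rfl ht hs
    rw [CellPath.cons_app (h₃ := rfl)] at this ⊢
    exact .getR (by omega) _ _ _ _ _ this
  | sendReceive hm h₀ h₁ h₂ h₃ h₄ h₅ hA a v s s' b hs =>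
    have := LetFreePath.cons (h := h) rfl ht hs
    rw [CellPath.cons_app (h₃ := rfl)] at this ⊢
    exact .sendReceive (by omega) _ _ _ _ _ _ _ _ _ _ _ _ this
  | receiveSend hm h₀ h₁ h₂ h₃ h₄ h₅ hA a v s s' b hs =>
    have := LetFreePath.cons (h := h) rfl ht hs
    rw [CellPath.cons_app (h₃ := rfl)] at this ⊢
    exact .receiveSend (by omega) _ _ _ _ _ _ _ _ _ _ _ _ this
  | putL hm h₁ h₂ h₃ v s ts hs =>
    cases hts with
    | cons _ hk hs hts =>
    cases hs with
    | putL _ _ hs =>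
    cases ht with
    | getL ht => exact .getL (by omega) _ _ _ (.cons _ rfl ht (.cons _ rfl (.putL _ _ hs) hts))
    | putL h' v ht =>
      exact .putL (by omega) _ _ rfl _ _ _ (.cons _ rfl ht (.cons _ rfl (.putL _ _ hs) hts))
    | getR ht =>
      exact .receiveSend (by omega) rfl h₁ h₂ h rfl (by simp [← h, ← h₂, ← h₁]) rfl (.nil _) _ _ _ _
        (.cons _ rfl (ht.subst _) (.cons _ rfl hs hts))
  | getL hm h' s ts hs =>
    cases hts with
    | cons _ hk hs hts =>
    cases hs with
    | getL hs =>
    cases ht with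
    | getL ht => exact .getL (by omega) _ _ _ (.cons _ rfl ht (.cons _ rfl (.getL hs) hts))
    | putL h' v ht =>
      exact .putL (by omega) _ _ rfl _ _ _ (.cons _ rfl ht (.cons _ rfl (.getL hs) hts))
    | putR h₁ v ht =>
      exact .sendReceive (by omega) rfl h₁ h' h rfl (by simp [← h, ← h₁, ← h']) rfl (.nil _) _ _ _ _
        (.cons _ rfl ht (.cons _ rfl (hs.subst _) hts))

/-- A path of terms without lets has one of the shapes of `Redex`. The empty path at `U` does not,
unless `U` is empty. -/
theorem LetFreePath.redex {n : ℕ} {U W : Exch M.Ob} {Γ As : List M.Ob}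
    {p : CellPath (Term M) U Γ As W} (hp : LetFreePath n p) (hn : As = [] → U = []) :
    Redex n p := by
  induction hp with
  | nil U =>
    obtain rfl := hn rfl
    exact .neutrals .nil
  | cons h hk ht hts ih =>
    cases hts with
    | nil =>
      cases ht with
      | neutral v => exact .neutrals (.cons h v .nil)
      | putL h' v ht => exact .putL (by omega) _ _ rfl _ _ _ (.cons _ rfl ht (.nil _))
      | getL ht => exact .getL (by omega) _ _ _ (.cons _ rfl ht (.nil _))
      | putR h' v ht =>
        obtain rfl := (List.append_nil _).symm.trans h
        exact .putR (by omega) h' rfl rfl rfl (.nil _) v _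
          (.cons (List.append_nil _) rfl ht (.nil _))
      | getR ht =>
        obtain rfl := (List.append_nil _).symm.trans h
        exact .getR (by omega) rfl rfl rfl (.nil _) _ (.cons (List.append_nil _) rfl ht (.nil _))
    | cons h' hk' ht' hts' =>
      subst hk
      exact .cons h ht (.cons h' hk' ht' hts') (ih (by simp))

/-- Induction on paths of terms without lets, along communications. -/
theorem LetFreePath.induction
    {motive : ∀ {U W : Exch M.Ob} {Γ As : List M.Ob}, CellPath (Term M) U Γ As W → Prop}
    (neutrals : ∀ {Γ As : List M.Ob} (vs : HomSeq M.Hom Γ As), motive (neutrals vs))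
    (putL : ∀ {U V W : Exch M.Ob} {Φ Δ Γ Ξ Θ Ψ As : List M.Ob} {A B : M.Ob}
      (h₁ : Φ ++ Δ = Γ) (h₂ : Γ ++ Ξ = Θ) (h₃ : Δ ++ Ξ = Ψ)
      (v : M.Hom Φ A) (t : Term M U Δ B V) (ts : CellPath (Term M) V Ξ As W),
      motive (.cons h₃ t ts) → motive (.cons h₂ (.putL h₁ v t) ts))
    (getL : ∀ {U V W : Exch M.Ob} {Γ Ξ Θ As : List M.Ob} {A B : M.Ob} (h : Γ ++ Ξ = Θ)
      (t : Term M U (A :: Γ) B V) (ts : CellPath (Term M) V Ξ As W),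
      motive (.cons (congrArg (A :: ·) h) t ts) → motive (.cons h (.getL t) ts))
    (putR : ∀ {U V W : Exch M.Ob} {Φ Δ Γ Ξ Θ Ψ As Bs : List M.Ob} {A B : M.Ob}
      (h₁ : Δ ++ Φ = Γ) (h₂ : Ξ ++ Γ = Θ) (h₃ : Ξ ++ Δ = Ψ) (hA : As ++ [B] = Bs)
      (ts : CellPath (Term M) U Ξ As V) (v : M.Hom Φ A) (t : Term M V Δ B W),
      motive (ts.app h₃ hA (.single t)) → motive (ts.app h₂ hA (.single (.putR h₁ v t))))
    (getR : ∀ {U V W : Exch M.Ob} {Γ Ξ Θ As Bs : List M.Ob} {A B : M.Ob}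
      (h₁ : Ξ ++ Γ = Θ) (h₂ : Ξ ++ (Γ ++ [A]) = Θ ++ [A]) (hA : As ++ [B] = Bs)
      (ts : CellPath (Term M) U Ξ As V) (t : Term M V (Γ ++ [A]) B W),
      motive (ts.app h₂ hA (.single t)) → motive (ts.app h₁ hA (.single (.getR t))))
    (sendReceive : ∀ {U V V' V'' W : Exch M.Ob} {Δ Γ Ψ Ξ Φ Θ Θ₁ Θ₂ Λ Ω As Bs Cs : List M.Ob}
      {A B C : M.Ob} (h₀ : Λ ++ Θ = Ω)
      (h₁ : Δ ++ Γ = Ψ) (h₂ : Φ ++ Ξ = Θ₁) (h₃ : Ψ ++ Θ₁ = Θ) (h₄ : Γ ++ Φ ++ Ξ = Θ₂)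
      (h₅ : Δ ++ Θ₂ = Θ) (hA : Bs ++ B :: C :: As = Cs) (a : CellPath (Term M) U Λ Bs V'')
      (v : M.Hom Γ A) (t : Term M V'' Δ B V) (s : Term M V (A :: Φ) C V')
      (b : CellPath (Term M) V' Ξ As W),
      motive (a.app h₀ hA (.cons h₅ t (.cons h₄ (substFirst v s) b))) →
      motive (a.app h₀ hA (.cons h₃ (.putR h₁ v t) (.cons h₂ (.getL s) b))))
    (receiveSend : ∀ {U V V' V'' W : Exch M.Ob} {Δ Γ Ψ Ξ Φ Θ Θ₁ Θ₂ Λ Ω As Bs Cs : List M.Ob}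
      {A B C : M.Ob} (h₀ : Λ ++ Θ = Ω)
      (h₁ : Γ ++ Φ = Ψ) (h₂ : Ψ ++ Ξ = Θ₁) (h₃ : Δ ++ Θ₁ = Θ) (h₄ : Φ ++ Ξ = Θ₂)
      (h₅ : Δ ++ Γ ++ Θ₂ = Θ) (hA : Bs ++ B :: C :: As = Cs) (a : CellPath (Term M) U Λ Bs V'')
      (v : M.Hom Γ A) (t : Term M V'' (Δ ++ [A]) B V) (s : Term M V Φ C V')
      (b : CellPath (Term M) V' Ξ As W),
      motive (a.app h₀ hA (.cons h₅ (substLast v t) (.cons h₄ s b))) →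
      motive (a.app h₀ hA (.cons h₃ (.getR t) (.cons h₂ (.putL h₁ v s) b))))
    {n : ℕ} {U W : Exch M.Ob} {Γ As : List M.Ob} {p : CellPath (Term M) U Γ As W}
    (hp : LetFreePath n p) (hn : As = [] → U = []) : motive p := by
  induction n using Nat.strong_induction_on generalizing U W Γ As with
  | _ n ih =>
    cases hp.redex hn with
    | neutrals vs => exact neutrals vs
    | putL hm _ _ _ _ _ _ h => exact putL _ _ _ _ _ _ (ih _ hm h (by simp))
    | getL hm _ _ _ h => exact getL _ _ _ (ih _ hm h (by simp))
    | putR hm _ _ _ hA _ _ _ h => exact putR _ _ _ _ _ _ _ (ih _ hm h (by simp [← hA]))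
    | getR hm _ _ hA _ _ h => exact getR _ _ _ _ _ (ih _ hm h (by simp [← hA]))
    | sendReceive hm _ _ _ _ _ _ hA _ _ _ _ _ h =>
      exact sendReceive _ _ _ _ _ _ _ _ _ _ _ _ (ih _ hm h (by simp [← hA]))
    | receiveSend hm _ _ _ _ _ _ hA _ _ _ _ _ h =>
      exact receiveSend _ _ _ _ _ _ _ _ _ _ _ _ (ih _ hm h (by simp [← hA]))

/-! ### Extraction of communications from lets -/

/-- The rewrite that pulls a `putR` out of a let, with free boundaries. The next three lemmas do the
same for the other actions. -/
theorem conv_letIn_putR {U V W P Q U' W' : Exch M.Ob} {Φ Δ Γ Ξ Θ Ψ As Bs : List M.Ob} {A B C : M.Ob}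
    (hU : U ++ P = U') (hW : W ++ Q = W') (hW' : (A, .circ) :: W ++ Q = (A, .circ) :: W')
    (hn hn') (h₁ : Δ ++ Φ = Γ) (h₂ : Ξ ++ Γ = Θ) (h₃ : Ξ ++ Δ = Ψ) (h₄ : Ψ ++ Φ = Θ)
    (hA : As ++ [B] = Bs)
    (ts : CellPath (Term M) U Ξ As V) (v : M.Hom Φ A) (t : Term M V Δ B W) (r : Term M P Bs C Q) :
    Conv (.letIn hU hW' hn (ts.app h₂ hA (.single (.putR h₁ v t))) r)
      (.putR h₄ v (.letIn hU hW hn' (ts.app h₃ hA (.single t)) r)) := by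
  subst hA
  exact .rel _ _ (.r5 _ _ _ _ _ _ _ _ _ _)

theorem conv_letIn_getR {U V W P Q U' W' : Exch M.Ob} {Γ Ξ Θ As Bs : List M.Ob} {A B C : M.Ob}
    (hU : U ++ P = U') (hW : W ++ Q = W') (hW' : (A, .bullet) :: W ++ Q = (A, .bullet) :: W')
    (hn hn') (h₁ : Ξ ++ Γ = Θ) (h₂ : Ξ ++ (Γ ++ [A]) = Θ ++ [A]) (hA : As ++ [B] = Bs)
    (ts : CellPath (Term M) U Ξ As V) (t : Term M V (Γ ++ [A]) B W) (r : Term M P Bs C Q) :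
    Conv (.letIn hU hW' hn (ts.app h₁ hA (.single (.getR t))) r)
      (.getR (.letIn hU hW hn' (ts.app h₂ hA (.single t)) r)) := by
  subst hA
  exact .rel _ _ (.r6 _ _ _ _ _ _ _)

theorem conv_letIn_putL {U V W P Q U' W' : Exch M.Ob} {Φ Δ Γ Ξ Θ Ψ As : List M.Ob} {A B C : M.Ob}
    (hU : U ++ P = U') (hU' : (A, .bullet) :: U ++ P = (A, .bullet) :: U') (hW : W ++ Q = W')
    (hn hn') (h₁ : Φ ++ Δ = Γ) (h₂ : Γ ++ Ξ = Θ) (h₃ : Δ ++ Ξ = Ψ) (h₄ : Φ ++ Ψ = Θ)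
    (v : M.Hom Φ A) (t : Term M U Δ B V) (ts : CellPath (Term M) V Ξ As W)
    (r : Term M P (B :: As) C Q) :
    Conv (.letIn hU' hW hn (.cons h₂ (.putL h₁ v t) ts) r)
      (.putL h₄ v (.letIn hU hW hn' (.cons h₃ t ts) r)) :=
  .rel _ _ (.r3 _ _ _ _ _ _ _ _ _ _)

theorem conv_letIn_getL {U V W P Q U' W' : Exch M.Ob} {Γ Ξ Θ As : List M.Ob} {A B C : M.Ob}
    (hU : U ++ P = U') (hU' : (A, .circ) :: U ++ P = (A, .circ) :: U') (hW : W ++ Q = W')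
    (hn hn') (h : Γ ++ Ξ = Θ) (h' : A :: Γ ++ Ξ = A :: Θ)
    (t : Term M U (A :: Γ) B V) (ts : CellPath (Term M) V Ξ As W)
    (r : Term M P (B :: As) C Q) :
    Conv (.letIn hU' hW hn (.cons h (.getL t) ts) r)
      (.getL (.letIn hU hW hn' (.cons h' t ts) r)) :=
  .rel _ _ (.r4 _ _ _ _ _ _)

/-- A term sends to its right neighbour, at any position of a path. -/
theorem stepPath_sendReceive {U V V' V'' W : Exch M.Ob}
    {Δ Γ Ψ Ξ Φ Θ Θ₁ Θ₂ Λ Ω As Bs Cs : List M.Ob} {A B C : M.Ob} (h₀ : Λ ++ Θ = Ω)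
    (h₁ : Δ ++ Γ = Ψ) (h₂ : Φ ++ Ξ = Θ₁) (h₃ : Ψ ++ Θ₁ = Θ) (h₄ : Γ ++ Φ ++ Ξ = Θ₂)
    (h₅ : Δ ++ Θ₂ = Θ) (hA : Bs ++ B :: C :: As = Cs) (a : CellPath (Term M) U Λ Bs V'')
    (v : M.Hom Γ A) (t : Term M V'' Δ B V) (s : Term M V (A :: Φ) C V')
    (b : CellPath (Term M) V' Ξ As W) :
    StepPath (a.app h₀ hA (.cons h₃ (.putR h₁ v t) (.cons h₂ (.getL s) b)))
      (a.app h₀ hA (.cons h₅ t (.cons h₄ (substFirst v s) b))) :=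
  .app_left _ _ _ (.r1 _ _ _ _ _ _ _ _ _)

/-- A term sends to its left neighbour, at any position of a path. -/
theorem stepPath_receiveSend {U V V' V'' W : Exch M.Ob}
    {Δ Γ Ψ Ξ Φ Θ Θ₁ Θ₂ Λ Ω As Bs Cs : List M.Ob} {A B C : M.Ob} (h₀ : Λ ++ Θ = Ω)
    (h₁ : Γ ++ Φ = Ψ) (h₂ : Ψ ++ Ξ = Θ₁) (h₃ : Δ ++ Θ₁ = Θ) (h₄ : Φ ++ Ξ = Θ₂)
    (h₅ : Δ ++ Γ ++ Θ₂ = Θ) (hA : Bs ++ B :: C :: As = Cs) (a : CellPath (Term M) U Λ Bs V'')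
    (v : M.Hom Γ A) (t : Term M V'' (Δ ++ [A]) B V) (s : Term M V Φ C V')
    (b : CellPath (Term M) V' Ξ As W) :
    StepPath (a.app h₀ hA (.cons h₃ (.getR t) (.cons h₂ (.putL h₁ v s) b)))
      (a.app h₀ hA (.cons h₅ (substLast v t) (.cons h₄ s b))) :=
  .app_left _ _ _ (.r2 _ _ _ _ _ _ _ _ _)

/-- A let whose bound terms and body contain no lets is convertible to a term without lets. -/
theorem LetFreePath.exists_letIn_conv {n : ℕ} {U W : Exch M.Ob} {Γ As : List M.Ob}
    {p : CellPath (Term M) U Γ As W} (hp : LetFreePath n p) (hn : As = [] → U = [])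
    {P Q U' W' : Exch M.Ob} {B : M.Ob} (hU : U ++ P = U') (hW : W ++ Q = W')
    {m : ℕ} {t : Term M P As B Q} (ht : LetFree m t) :
    ∃ (k : ℕ) (t' : Term M U' Γ B W'), LetFree k t' ∧ Conv (.letIn hU hW hn p t) t' := by
  revert P Q U' W' B m
  refine LetFreePath.induction (motive := fun {U W Γ As} p => ∀ (hn : As = [] → U = [])
    {P Q U' W' : Exch M.Ob} {B : M.Ob} (hU : U ++ P = U') (hW : W ++ Q = W') {m : ℕ}
    {t : Term M P As B Q}, LetFree m t → ∃ (k : ℕ) (t' : Term M U' Γ B W'), LetFree k t' ∧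
      Conv (.letIn hU hW hn p t) t') ?_ ?_ ?_ ?_ ?_ ?_ ?_ hp hn hn
  · intro Γ As vs hn P Q U' W' B hU hW m t ht
    subst hU hW
    exact ⟨m, subst vs t, ht.subst vs, .rel _ _ (.r0 vs t)⟩
  · intro U V W Φ Δ Γ Ξ Θ Ψ As A B h₁ h₂ h₃ v t ts ih hn P Q U' W' C hU hW m r hr
    subst hU
    obtain ⟨k, r', hr', hc⟩ := ih (by simp) rfl hW hr
    exact ⟨k + 1, .putL (by rw [← h₂, ← h₃, ← h₁, List.append_assoc]) v r', .putL _ _ hr',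
      .trans _ _ _ (conv_letIn_putL _ _ _ _ _ _ _ _ _ _ _ _ _) (hc.putL _ _)⟩
  · intro U V W Γ Ξ Θ As A B h t ts ih hn P Q U' W' C hU hW m r hr
    subst hU
    obtain ⟨k, r', hr', hc⟩ := ih (by simp) rfl hW hr
    exact ⟨k + 1, .getL r', .getL hr',
      .trans _ _ _ (conv_letIn_getL _ _ _ _ _ _ _ _ _ _) hc.getL⟩
  · intro U V W Φ Δ Γ Ξ Θ Ψ As Bs A B h₁ h₂ h₃ hA ts v t ih hn P Q U' W' C hU hW m r hr
    subst hW
    obtain ⟨k, r', hr', hc⟩ := ih (by simp [← hA]) hU rfl hr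
    exact ⟨k + 1, .putR (by rw [← h₂, ← h₃, ← h₁, List.append_assoc]) v r', .putR _ _ hr',
      .trans _ _ _ (conv_letIn_putR _ _ _ _ _ _ _ _ _ _ _ _ _ _) (hc.putR _ _)⟩
  · intro U V W Γ Ξ Θ As Bs A B h₁ h₂ hA ts t ih hn P Q U' W' C hU hW m r hr
    subst hW
    obtain ⟨k, r', hr', hc⟩ := ih (by simp [← hA]) hU rfl hr
    exact ⟨k + 1, .getR r', .getR hr',
      .trans _ _ _ (conv_letIn_getR _ _ _ _ _ _ _ _ _ _ _) hc.getR⟩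
  · intro U V V' V'' W Δ Γ Ψ Ξ Φ Θ Θ₁ Θ₂ Λ Ω As Bs Cs A B C h₀ h₁ h₂ h₃ h₄ h₅ hA a v t s b ih hn
      P Q U' W' D hU hW m r hr
    obtain ⟨k, r', hr', hc⟩ := ih hn hU hW hr
    exact ⟨k, r', hr', .trans _ _ _ (Conv.letIn_args _ _ _ _
      (.rel _ _ (stepPath_sendReceive _ _ _ _ _ _ _ _ _ _ _ _))) hc⟩
  · intro U V V' V'' W Δ Γ Ψ Ξ Φ Θ Θ₁ Θ₂ Λ Ω As Bs Cs A B C h₀ h₁ h₂ h₃ h₄ h₅ hA a v t s b ih hn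
      P Q U' W' D hU hW m r hr
    obtain ⟨k, r', hr', hc⟩ := ih hn hU hW hr
    exact ⟨k, r', hr', .trans _ _ _ (Conv.letIn_args _ _ _ _
      (.rel _ _ (stepPath_receiveSend _ _ _ _ _ _ _ _ _ _ _ _))) hc⟩

mutual

/-- Every term is convertible to one without lets. -/
theorem exists_letFree_conv : {U W : Exch M.Ob} → {Γ : List M.Ob} → {B : M.Ob} →
    (t : Term M U Γ B W) → ∃ (n : ℕ) (t' : Term M U Γ B W), LetFree n t' ∧ Conv t t'
  | _, _, _, _, .neutral v => ⟨0, _, .neutral v, .refl _⟩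
  | _, _, _, _, .letIn hU hW hn ts t => by
    obtain ⟨m, ts', hts', hc⟩ := exists_letFreePath_conv ts
    obtain ⟨n, t', ht', hc'⟩ := exists_letFree_conv t
    obtain ⟨k, r, hr, hc''⟩ := hts'.exists_letIn_conv hn hU hW ht'
    exact ⟨k, r, hr, .trans _ _ _ (Conv.letIn_args hU hW hn t hc)
      (.trans _ _ _ (Conv.letIn_body hU hW hn ts' hc') hc'')⟩
  | _, _, _, _, .putR h v t =>
    let ⟨n, _, ht, hc⟩ := exists_letFree_conv t
    ⟨n + 1, _, ht.putR h v, hc.putR h v⟩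
  | _, _, _, _, .getL t =>
    let ⟨n, _, ht, hc⟩ := exists_letFree_conv t
    ⟨n + 1, _, ht.getL, hc.getL⟩
  | _, _, _, _, .getR t =>
    let ⟨n, _, ht, hc⟩ := exists_letFree_conv t
    ⟨n + 1, _, ht.getR, hc.getR⟩
  | _, _, _, _, .putL h v t =>
    let ⟨n, _, ht, hc⟩ := exists_letFree_conv t
    ⟨n + 1, _, ht.putL h v, hc.putL h v⟩

theorem exists_letFreePath_conv : {U W : Exch M.Ob} → {Γ As : List M.Ob} →
    (p : CellPath (Term M) U Γ As W) →
    ∃ (n : ℕ) (p' : CellPath (Term M) U Γ As W), LetFreePath n p' ∧ ConvPath p p'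
  | _, _, _, _, .nil U => ⟨0, _, .nil U, .refl _⟩
  | _, _, _, _, .cons h t ts => by
    obtain ⟨m, t', ht', hc⟩ := exists_letFree_conv t
    obtain ⟨n, ts', hts', hc'⟩ := exists_letFreePath_conv ts
    exact ⟨m + n, _, .cons h rfl ht' hts', .cons h hc hc'⟩

end

/-! ### Composition of paths of terms -/

/-- Composition of paths of terms: each entry of `gs` is composed with the part of `hs` that it
binds. An entry with empty context binds an empty path. -/
def compPath {U W P Q : Exch M.Ob} {Γ Δ As : List M.Ob} (hs : CellPath (Term M) U Γ Δ W)
    (gs : CellPath (Term M) P Δ As Q) : CellPath (Term M) (U ++ P) Γ As (W ++ Q) :=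
  letI : Monoid (Exch M.Ob) := (termVirtual M).vertMonoid
  CellPath.comp (fun hs g => compose rfl rfl hs g) hs gs

theorem compPath_cons {U V W P P' Q : Exch M.Ob} {Γ Δ Θ Γ₁ Δ₁ Θ₁ As : List M.Ob} {A : M.Ob}
    (hD : Γ ++ Δ = Θ) (h : Γ₁ ++ Δ₁ = Θ₁) (p₁ : CellPath (Term M) U Γ Γ₁ V)
    (p₂ : CellPath (Term M) V Δ Δ₁ W) (f : Term M P Γ₁ A P') (fs : CellPath (Term M) P' Δ₁ As Q) :
    compPath (p₁.app hD h p₂) (.cons h f fs) =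
      .cons hD (compose rfl rfl p₁ f) (compPath p₂ fs) :=
  letI : Monoid (Exch M.Ob) := (termVirtual M).vertMonoid
  CellPath.comp_cons _ _ _ _ _ _ _

theorem compPath_app {U V W P P' Q : Exch M.Ob} {Γ Δ Θ Γ₁ Δ₁ Θ₁ As Bs Cs : List M.Ob}
    (hD : Γ ++ Δ = Θ) (h : Γ₁ ++ Δ₁ = Θ₁) (hA : As ++ Bs = Cs) (p₁ : CellPath (Term M) U Γ Γ₁ V)
    (p₂ : CellPath (Term M) V Δ Δ₁ W) (q₁ : CellPath (Term M) P Γ₁ As P')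
    (q₂ : CellPath (Term M) P' Δ₁ Bs Q) :
    compPath (p₁.app hD h p₂) (q₁.app h hA q₂) = (compPath p₁ q₁).app hD hA (compPath p₂ q₂) :=
  letI : Monoid (Exch M.Ob) := (termVirtual M).vertMonoid
  CellPath.comp_app _ _ _ _ _ _ _ _

/-- A term with empty context, composed with the empty path, comes first. -/
theorem compPath_cons_nil {U W P P' Q : Exch M.Ob} {Γ Δ As : List M.Ob} {A : M.Ob}
    (h : [] ++ Δ = Δ) (p : CellPath (Term M) U Γ Δ W) (f : Term M P [] A P')
    (fs : CellPath (Term M) P' Δ As Q) :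
    compPath p (.cons h f fs) = .cons (Γ := []) rfl (idHor f U) (compPath p fs) :=
  compPath_cons rfl h (.nil U) p f fs

/-- A term with empty context, composed with the empty path, comes last. -/
theorem compPath_snoc_nil {U W P P' Q : Exch M.Ob} {Γ Δ As Bs : List M.Ob} {A : M.Ob}
    (h : Δ ++ [] = Δ) (hA : As ++ [A] = Bs) (p : CellPath (Term M) U Γ Δ W) (f : Term M P' [] A Q)
    (fs : CellPath (Term M) P Δ As P') :
    compPath p (fs.app h hA (.single f)) =
      (compPath p fs).app (List.append_nil Γ) hA (.single (idHor f W)) := by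
  have := compPath_app (List.append_nil Γ) h hA p (.nil W) fs (.single f)
  rwa [CellPath.app_nil p] at this

/-- A forwarder to the left that has received `v` sends `v`. -/
theorem substLast_putL_one {U W : Exch M.Ob} {Γ : List M.Ob} {A B : M.Ob} (v : M.Hom Γ A)
    (t : Term M U [] B W) :
    substLast (Δ := []) v (.putL (Γ := [A]) rfl (M.one A) t) = .putL (List.append_nil Γ) v t := by
  have := subst_putL (h := rfl) (List.append_nil Γ) (.single v) .nil (M.one A) t
  rw [M.comp_one, HomSeq.app_nil] at this
  exact this.trans (congrArg (Term.putL _ v) (subst_ids t))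

/-- A forwarder to the right that has received `v` sends `v`. -/
theorem substFirst_putR_one {U W : Exch M.Ob} {Γ : List M.Ob} {A B : M.Ob} (h : [] ++ Γ = Γ ++ [])
    (v : M.Hom Γ A) (t : Term M U [] B W) :
    substFirst (Δ := []) v (.putR (Δ := []) rfl (M.one A) t) = .putR h v t := by
  have := subst_putR (Δ' := []) (h := rfl) h .nil (.single v) (M.one A) t
  rw [M.comp_one] at this
  refine Eq.trans ?_ (this.trans (congrArg (Term.putR _ v) (subst_ids t)))
  exact congrArg (fun x => subst x _) (HomSeq.cons_eq_app_nil rfl v)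

theorem substPath_app {U V W : Exch M.Ob} {Γ Δ Θ Γ' Δ' Θ' As Bs Cs : List M.Ob}
    (h : Γ ++ Δ = Θ) (h' : Γ' ++ Δ' = Θ') (hA : As ++ Bs = Cs) (p : HomSeq M.Hom Γ' Γ)
    (q : HomSeq M.Hom Δ' Δ) (ts : CellPath (Term M) U Γ As V) (us : CellPath (Term M) V Δ Bs W) :
    substPath (HomSeq.app h' h p q) (ts.app h hA us) =
      (substPath p ts).app h' hA (substPath q us) := by
  subst hA
  induction ts generalizing Γ' Θ Θ' with
  | nil => cases p; subst h h'; rfl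
  | cons k t ts ih =>
    obtain ⟨Γ₁, Γ₂, k', p₁, p₂, rfl⟩ := HomSeq.exists_app p _ k
    subst k k' h h'
    rw [CellPath.app_cons (h₁ := rfl) (h₂ := (List.append_assoc _ _ _).symm) (hA' := rfl)
      (Cs := _ ++ _), substPath_cons, HomSeq.app_assoc rfl rfl rfl rfl rfl rfl
      (List.append_assoc _ _ _).symm (List.append_assoc _ _ _).symm, substPath_cons, ih,
      CellPath.app_cons (h₁ := rfl) (h₂ := (List.append_assoc _ _ _).symm) (hA' := rfl)
      (Cs := _ ++ _)]

theorem substFirst_letIn {U V P U' W Q W' : Exch M.Ob} {Φ Γ Ξ Θ As : List M.Ob} {A B C : M.Ob}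
    (hU : U ++ P = U') (hW : W ++ Q = W') (hn : B :: As = [] → U = []) (h : A :: Γ ++ Ξ = A :: Θ)
    (h' : Φ ++ Γ ++ Ξ = Φ ++ Θ) (v : M.Hom Φ A) (t : Term M U (A :: Γ) B V)
    (ts : CellPath (Term M) V Ξ As W) (r : Term M P (B :: As) C Q) :
    substFirst v (.letIn hU hW hn (.cons h t ts) r) =
      .letIn hU hW hn (.cons h' (substFirst v t) ts) r := by
  obtain rfl : Γ ++ Ξ = Θ := List.tail_eq_of_cons_eq h
  refine congrArg (fun x => Term.letIn hU hW hn x r) ?_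
  have hv : (.cons rfl v (HomSeq.ids M.one (Γ ++ Ξ)) : HomSeq M.Hom _ _) =
      HomSeq.app h' h (.cons rfl v (HomSeq.ids M.one Γ)) (HomSeq.ids M.one Ξ) := by
    rw [HomSeq.app_cons (hA := rfl), ← HomSeq.ids_app]
  exact (congrArg (fun x => substPath x _) hv).trans ((substPath_cons _ _ _ _ _ _).trans
    (congrArg (CellPath.cons _ _) (substPath_ids ts)))

theorem substLast_letIn {U V P U' W Q W' : Exch M.Ob} {Φ Γ Ξ Θ As Bs : List M.Ob} {A B C : M.Ob}
    (hU : U ++ P = U') (hW : W ++ Q = W') (hn : Bs = [] → U = [])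
    (h : Ξ ++ (Γ ++ [A]) = Θ ++ [A]) (h' : Ξ ++ (Γ ++ Φ) = Θ ++ Φ) (hA : As ++ [B] = Bs)
    (v : M.Hom Φ A) (t : Term M V (Γ ++ [A]) B W)
    (ts : CellPath (Term M) U Ξ As V) (r : Term M P Bs C Q) :
    substLast v (.letIn hU hW hn (ts.app h hA (.single t)) r) =
      .letIn hU hW hn (ts.app h' hA (.single (substLast v t))) r := by
  obtain rfl : Ξ ++ Γ = Θ := by simpa [← List.append_assoc] using h
  refine congrArg (fun x => Term.letIn hU hW hn x r) ?_
  have hv : (HomSeq.ids M.one (Ξ ++ Γ)).append (.single v) =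
      HomSeq.app h' h (HomSeq.ids M.one Ξ) ((HomSeq.ids M.one Γ).append (.single v)) := by
    rw [HomSeq.ids_append]
    exact HomSeq.append_assoc _ _ _
  refine (congrArg (fun x => substPath x _) hv).trans ((substPath_app _ _ _ _ _ _ _).trans ?_)
  rw [substPath_ids]
  refine congrArg _ ?_
  have := substPath_cons (List.append_nil _) (List.append_nil _)
    ((HomSeq.ids M.one Γ).append (.single v)) .nil t (.nil W)
  rw [HomSeq.app_nil] at this
  exact this

theorem compose_eq_letIn {U P U' W Q W' : Exch M.Ob} {Γ As : List M.Ob} {B : M.Ob}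
    (hU : U ++ P = U') (hW : W ++ Q = W') (hAs : As ≠ []) (hs : CellPath (Term M) U Γ As W)
    (g : Term M P As B Q) :
    compose hU hW hs g = .letIn hU hW (fun h => absurd h hAs) hs g := by
  cases hs with
  | nil => exact absurd rfl hAs
  | cons h t ts => rfl

theorem compPath_single {U W P Q : Exch M.Ob} {Γ Δ : List M.Ob} {A : M.Ob}
    (p : CellPath (Term M) U Γ Δ W) (f : Term M P Δ A Q) :
    compPath p (.single f) = .single (compose rfl rfl p f) := by
  have := compPath_cons (List.append_nil _) (List.append_nil _) p (.nil W) f (.nil Q)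
  rwa [CellPath.app_nil] at this

theorem neutrals_app {Γ Δ Θ As Bs Cs : List M.Ob} (h : Γ ++ Δ = Θ) (hA : As ++ Bs = Cs)
    (p : HomSeq M.Hom Γ As) (q : HomSeq M.Hom Δ Bs) :
    neutrals (HomSeq.app h hA p q) = (neutrals p).app h hA (neutrals q) := by
  subst h hA
  induction p with
  | nil => rfl
  | cons k f p ih =>
    subst k
    rw [HomSeq.app_cons (hA := rfl)]
    simp only [neutrals]
    rw [ih, CellPath.cons_app]

/-- A path of neutral terms composes by substitution. -/
theorem convPath_compPath_neutrals {P Q : Exch M.Ob} {Γ Δ As : List M.Ob} (vs : HomSeq M.Hom Γ Δ)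
    (gs : CellPath (Term M) P Δ As Q) : ConvPath (compPath (neutrals vs) gs) (substPath vs gs) := by
  induction gs generalizing Γ with
  | nil => cases vs; exact .refl _
  | @cons U V W Γ₁ Δ₁ Θ₁ A As h g gs ih =>
    obtain ⟨Γ, Δ, h', p, q, rfl⟩ := HomSeq.exists_app vs _ h
    rw [neutrals_app, compPath_cons, substPath_cons]
    refine ConvPath.cons _ ?_ (ih q)
    cases p with
    | nil => exact Conv.of_eq (subst_ids g).symm
    | cons k f p => exact .rel _ _ (.r0 (.cons k f p) g)

/-! ### Communications of a path and of its composites -/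

/-- The communication `stepPath_sendReceive` with the path split between the two terms that take
part. -/
theorem convPath_sendReceive {U V V' V'' W : Exch M.Ob}
    {Δ Γ Ψ Ξ Φ Θ Θ₁ Θ₂ Λ Λ' Ω As Bs Bs' Cs : List M.Ob} {A B C : M.Ob} (h₀ : Λ ++ Ψ = Θ)
    (h₁ : Δ ++ Γ = Ψ) (h₂ : Φ ++ Ξ = Θ₁) (h₃ : Θ ++ Θ₁ = Ω) (h₄ : Γ ++ Φ ++ Ξ = Θ₂)
    (h₅ : Λ ++ Δ = Λ') (h₆ : Λ' ++ Θ₂ = Ω) (hA : Bs ++ [B] = Bs') (hA' : Bs' ++ C :: As = Cs)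
    (a : CellPath (Term M) U Λ Bs V'')
    (v : M.Hom Γ A) (t : Term M V'' Δ B V) (s : Term M V (A :: Φ) C V')
    (b : CellPath (Term M) V' Ξ As W) :
    ConvPath ((a.app h₀ hA (.single (.putR h₁ v t))).app h₃ hA' (.cons h₂ (.getL s) b))
      ((a.app h₅ hA (.single t)).app h₆ hA' (.cons h₄ (substFirst v s) b)) := by
  subst h₀ h₁ h₂ h₃ h₄ h₅ hA hA'
  rw [CellPath.app_assoc (h₂ := rfl) (hA₂ := rfl) (h₃ := by simp) (hA₃ := by simp),
    CellPath.app_assoc (Γ₃ := Δ ++ Γ ++ (Φ ++ Ξ)) (h₂ := by simp) (hA₂ := rfl) (h₃ := by simp)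
      (hA₃ := by simp),
    CellPath.single_app, CellPath.single_app]
  exact .rel _ _ (stepPath_sendReceive _ _ _ _ _ _ _ _ _ _ _ _)

/-- The communication `stepPath_receiveSend` with the path split between the two terms that take
part. -/
theorem convPath_receiveSend {U V V' V'' W : Exch M.Ob}
    {Δ Γ Ψ Ξ Φ Θ Θ₁ Θ₂ Λ Λ' Ω As Bs Bs' Cs : List M.Ob} {A B C : M.Ob} (h₀ : Λ ++ Δ = Θ)
    (h₁ : Γ ++ Φ = Ψ) (h₂ : Ψ ++ Ξ = Θ₁) (h₃ : Θ ++ Θ₁ = Ω) (h₄ : Φ ++ Ξ = Θ₂)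
    (h₅ : Λ ++ (Δ ++ Γ) = Λ') (h₆ : Λ' ++ Θ₂ = Ω) (hA : Bs ++ [B] = Bs')
    (hA' : Bs' ++ C :: As = Cs) (a : CellPath (Term M) U Λ Bs V'')
    (v : M.Hom Γ A) (t : Term M V'' (Δ ++ [A]) B V) (s : Term M V Φ C V')
    (b : CellPath (Term M) V' Ξ As W) :
    ConvPath ((a.app h₀ hA (.single (.getR t))).app h₃ hA' (.cons h₂ (.putL h₁ v s) b))
      ((a.app h₅ hA (.single (substLast v t))).app h₆ hA' (.cons h₄ s b)) := by
  subst h₀ h₁ h₂ h₃ h₄ h₅ hA hA'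
  rw [CellPath.app_assoc (h₂ := rfl) (hA₂ := rfl) (h₃ := by simp) (hA₃ := by simp),
    CellPath.app_assoc (Γ₃ := Δ ++ (Γ ++ Φ ++ Ξ)) (h₂ := by simp) (hA₂ := rfl) (h₃ := by simp)
      (hA₃ := by simp),
    CellPath.single_app, CellPath.single_app]
  exact .rel _ _ (stepPath_receiveSend _ _ _ _ _ _ _ _ _ _ _ _)

/-- If the first entry of a path sends a message to the left, then so does, up to convertibility,
the first entry of any composite of the path, which is otherwise that of the path without the
message. When the first entries of `gs` bind empty paths, they compose to terms that forward the
message. -/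
theorem exists_compPath_putL {U V W P Q : Exch M.Ob}
    {Φ Δ Γ Ξ Θ Ψ As Cs : List M.Ob} {A B C : M.Ob}
    (h₁ : Φ ++ Δ = Γ) (h₂ : Γ ++ Ξ = Θ) (h₃ : Δ ++ Ξ = Ψ)
    (v : M.Hom Φ A) (t : Term M U Δ B V) (ts : CellPath (Term M) V Ξ As W)
    (gs : CellPath (Term M) P (B :: As) (C :: Cs) Q) :
    ∃ (V' : Exch M.Ob) (Δ' Ξ' : List M.Ob) (h₄ : Δ' ++ Ξ' = Ψ)
      (s : Term M (U ++ P) Δ' C V') (q : CellPath (Term M) V' Ξ' Cs (W ++ Q)),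
      compPath (.cons h₃ t ts) gs = .cons h₄ s q ∧
      ∀ (Γ' : List M.Ob) (h₅ : Φ ++ Δ' = Γ') (h₆ : Γ' ++ Ξ' = Θ), ConvPath
        (compPath (.cons h₂ (.putL h₁ v t) ts) gs) (.cons h₆ (.putL h₅ v s) q) := by
  obtain ⟨Bs, hBs⟩ : ∃ Bs, C :: Cs = Bs := ⟨_, rfl⟩
  induction Bs generalizing P C Cs with
  | nil => cases hBs
  | cons C₁ Bs ih =>
    obtain ⟨rfl, rfl⟩ : C = C₁ ∧ Cs = Bs := by simpa using hBs
    cases gs with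
    | @cons _ P' _ Γ₁ Δ₁ _ _ _ hg g gs =>
    cases Γ₁ with
    | nil =>
      obtain rfl : Δ₁ = B :: As := hg
      cases Cs with
      | nil => cases gs
      | cons C' Cs =>
        obtain ⟨V', Δ', Ξ', h₄, s, q, e, ih⟩ := ih gs rfl
        refine ⟨_, [], Ψ, rfl, idHor g U, .cons h₄ s q, ?_, ?_⟩
        · rw [compPath_cons_nil, e]
        · intro Γ' h₅ h₆
          obtain rfl : Φ = Γ' := (List.append_nil Φ).symm.trans h₅
          rw [compPath_cons_nil]
          refine .trans _ _ _ (ConvPath.cons _ (.refl _) (ih _ rfl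
            (by rw [← h₆, ← h₄, List.append_assoc]))) ?_
          refine .trans _ _ _ (.rel _ _ (.r2 _ _ _ h₄ h₆ _ _ _ _)) ?_
          rw [substLast_putL_one]
          exact .refl _
    | cons B' Γ₁ =>
      obtain ⟨rfl, rfl⟩ : B' = B ∧ Γ₁ ++ Δ₁ = As := by simpa using hg
      obtain ⟨Ξ₁, Ξ₂, V', hΞ, ts₁, ts₂, rfl⟩ := CellPath.exists_app ts Γ₁ rfl
      refine ⟨_, Δ ++ Ξ₁, Ξ₂, by rw [← h₃, ← hΞ, List.append_assoc],
        compose rfl rfl (.cons rfl t ts₁) g, compPath ts₂ gs, ?_, ?_⟩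
      · rw [CellPath.cons_app (h₃ := rfl), compPath_cons]
      · intro Γ' h₅ h₆
        rw [CellPath.cons_app (Γ := Γ') (h₃ := by rw [← h₅, ← h₁, List.append_assoc]),
          compPath_cons]
        exact ConvPath.cons _ (conv_letIn_putL rfl rfl rfl (by simp) (by simp) _ _ _ _ _ _ _ _)
          (.refl _)

/-- A message that is sent to the right by a term `t₀` in front of a composite of a path reaches the
first entry of the path. -/
theorem convPath_putR_compPath_getL {U₀ U V W P Q : Exch M.Ob}
    {Δ₀ Ψ₀ T Φ Γ Ξ Θ Θ' As Bs : List M.Ob} {A B B₀ : M.Ob}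
    (k₀ : Δ₀ ++ Φ = Ψ₀) (k₁ : Ψ₀ ++ Θ = T) (k₂ : Δ₀ ++ Θ' = T) (h : Γ ++ Ξ = Θ)
    (h' : Φ ++ Γ ++ Ξ = Θ') (v : M.Hom Φ A) (t₀ : Term M U₀ Δ₀ B₀ (U ++ P))
    (s : Term M U (A :: Γ) B V) (ts : CellPath (Term M) V Ξ As W)
    (gs : CellPath (Term M) P (B :: As) Bs Q) :
    ConvPath (.cons k₁ (.putR k₀ v t₀) (compPath (.cons h (.getL s) ts) gs))
      (.cons k₂ t₀ (compPath (.cons h' (substFirst v s) ts) gs)) := by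
  induction Bs generalizing P U₀ Δ₀ Ψ₀ T B₀ with
  | nil => cases gs
  | cons C Bs ih =>
    cases gs with
    | @cons _ P' _ Γ₁ Δ₁ _ _ _ hg g gs =>
    cases Γ₁ with
    | nil =>
      obtain rfl : Δ₁ = B :: As := hg
      rw [compPath_cons_nil, compPath_cons_nil]
      refine .trans _ _ _ (.rel _ _ (.r1 _ _ _ (h' ▸ by simp [← h]) k₂ _ _ _ _)) ?_
      refine ConvPath.cons _ (.refl _) ?_
      rw [substFirst_putR_one (by simp)]
      exact ih (by simp) _ _ _ _
    | cons B' Γ₁ =>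
      obtain ⟨rfl, rfl⟩ : B' = B ∧ Γ₁ ++ Δ₁ = As := by simpa using hg
      obtain ⟨Ξ₁, Ξ₂, V', hΞ, ts₁, ts₂, rfl⟩ := CellPath.exists_app ts Γ₁ rfl
      rw [CellPath.cons_app (h₃ := rfl), compPath_cons,
        CellPath.cons_app (Γ := Φ ++ (Γ ++ Ξ₁)) (h₃ := List.append_assoc _ _ _), compPath_cons]
      refine .trans _ _ _ (ConvPath.cons _ (.refl _) (.cons _
        (conv_letIn_getL rfl rfl rfl (by simp) (by simp) rfl rfl s ts₁ g) (.refl _))) ?_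
      refine .trans _ _ _ (.rel _ _ (.r1 _ _ _ (by simp [← h', ← hΞ]) k₂ _ _ _ _)) ?_
      rw [substFirst_letIn (h' := List.append_assoc _ _ _)]
      exact .refl _

theorem cons_putR_nil {U W : Exch M.Ob} {Φ Ψ Θ : List M.Ob} {A B : M.Ob} (h : [] ++ Φ = Ψ)
    (h' : Ψ ++ [] = Θ) (h'' : [] ++ Φ = Θ) (v : M.Hom Φ A) (t : Term M U [] B W) :
    CellPath.cons h' (Term.putR h v t) (.nil _) = CellPath.single (Term.putR h'' v t) := by
  subst h h''; rfl

/-- If the last entry of a path sends a message to the right, then so does, up to convertibility,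
the last entry of any composite of the path, which is otherwise that of the path without the
message. When the last entries of `gs` bind empty paths, they compose to terms that forward the
message. -/
theorem exists_compPath_putR {U V W P Q : Exch M.Ob}
    {Φ Δ Γ Ξ Θ Ψ As Bs Ds : List M.Ob} {A B : M.Ob}
    (h₁ : Δ ++ Φ = Γ) (h₂ : Ξ ++ Γ = Θ) (h₃ : Ξ ++ Δ = Ψ) (hA : As ++ [B] = Bs)
    (ts : CellPath (Term M) U Ξ As V) (v : M.Hom Φ A) (t : Term M V Δ B W)
    (gs : CellPath (Term M) P Bs Ds Q) :
    ∃ (V' : Exch M.Ob) (Δ' Ξ' Cs : List M.Ob) (C : M.Ob) (hD : Cs ++ [C] = Ds)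
      (h₄ : Ξ' ++ Δ' = Ψ) (q : CellPath (Term M) (U ++ P) Ξ' Cs V') (s : Term M V' Δ' C (W ++ Q)),
      compPath (ts.app h₃ hA (.single t)) gs = q.app h₄ hD (.single s) ∧
      ∀ (Γ' : List M.Ob) (h₅ : Δ' ++ Φ = Γ') (h₆ : Ξ' ++ Γ' = Θ), ConvPath
        (compPath (ts.app h₂ hA (.single (.putR h₁ v t))) gs)
        (q.app h₆ hD (.single (.putR h₅ v s))) := by
  induction gs using CellPath.snocInduction with
  | nil => simp at hA
  | @snoc P P' Q Γ₁ Δ₁ Bs Ds₁ Ds D hg hD gs g ih =>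
    rcases List.eq_nil_or_concat' Δ₁ with rfl | ⟨Δ₁, B', rfl⟩
    · obtain rfl : Γ₁ = Bs := (List.append_nil _).symm.trans hg
      obtain ⟨V', Δ', Ξ', Cs, C, hC, h₄, q, s, e, ih⟩ := ih hA
      refine ⟨_, [], Ψ, Ds₁, D, hD, List.append_nil _, q.app h₄ hC (.single s), idHor g W, ?_, ?_⟩
      · rw [compPath_snoc_nil, e]
      · intro Γ' h₅ h₆
        obtain rfl : Φ = Γ' := h₅
        rw [compPath_snoc_nil]
        refine .trans _ _ _ (ConvPath.app _ _ (ih _ rfl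
          (by rw [← h₆, ← h₄, List.append_assoc])) (.refl _)) ?_
        refine .trans _ _ _ (convPath_sendReceive (Θ₂ := Φ) _ _ _ _ (by simp) h₄ h₆
          _ _ _ _ _ _ _) ?_
        rw [substFirst_putR_one (by simp)]
        exact ConvPath.of_eq (congrArg _ (cons_putR_nil _ _ _ _ _))
    · obtain ⟨rfl, rfl⟩ : Γ₁ ++ Δ₁ = As ∧ B' = B := by
        have := List.append_inj' ((List.append_assoc _ _ _).trans (hg.trans hA.symm)) rfl
        exact ⟨this.1, List.singleton_inj.1 this.2⟩
      obtain ⟨Ξ₁, Ξ₂, V', hΞ, ts₁, ts₂, rfl⟩ := CellPath.exists_app ts Γ₁ rfl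
      refine ⟨_, Ξ₂ ++ Δ, Ξ₁, Ds₁, D, hD, by rw [← h₃, ← hΞ, List.append_assoc],
        compPath ts₁ gs, compose rfl rfl (ts₂.app rfl rfl (.single t)) g, ?_, ?_⟩
      · rw [CellPath.app_assoc (h₂ := rfl) (hA₂ := rfl)
          (h₃ := by rw [← h₃, ← hΞ, List.append_assoc]) (hA₃ := hg), compPath_app, compPath_single]
      · intro Γ' h₅ h₆
        rw [CellPath.app_assoc (Γ₃ := Γ') (h₂ := by rw [← h₅, ← h₁, List.append_assoc]) (hA₂ := rfl)
          (h₃ := h₆) (hA₃ := hg), compPath_app, compPath_single]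
        refine ConvPath.app _ _ (.refl _) (ConvPath.cons _ ?_ (.refl _))
        rw [compose_eq_letIn _ _ (by simp), compose_eq_letIn _ _ (by simp)]
        exact conv_letIn_putR rfl rfl rfl (by simp) (by simp) _ _ _ _ _ _ _ _ _

/-- A message that is sent to the left by a term `s₀` behind a composite of a path reaches the last
entry of the path. -/
theorem convPath_compPath_getR_putL {U V W W' P Q Q' : Exch M.Ob}
    {Δ₀ Ψ₀ Ξ₀ T₀ T₀' T Φ Γ Ξ Θ Θ' As Bs Ds Es Fs : List M.Ob} {A B B₀ : M.Ob}
    (k₀ : Φ ++ Δ₀ = Ψ₀) (k : Ψ₀ ++ Ξ₀ = T₀) (k₁ : Θ ++ T₀ = T) (k' : Δ₀ ++ Ξ₀ = T₀')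
    (k₂ : Θ' ++ T₀' = T) (h : Ξ ++ Γ = Θ) (h' : Ξ ++ (Γ ++ Φ) = Θ') (hA : As ++ [B] = Bs)
    (hE : Ds ++ B₀ :: Es = Fs)
    (ts : CellPath (Term M) U Ξ As V) (v : M.Hom Φ A) (t : Term M V (Γ ++ [A]) B W)
    (gs : CellPath (Term M) P Bs Ds Q) (s₀ : Term M (W ++ Q) Δ₀ B₀ W')
    (b : CellPath (Term M) W' Ξ₀ Es Q') :
    ConvPath ((compPath (ts.app h hA (.single (.getR t))) gs).app k₁ hE (.cons k (.putL k₀ v s₀) b))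
      ((compPath (ts.app h' hA (.single (substLast v t))) gs).app k₂ hE (.cons k' s₀ b)) := by
  induction gs using CellPath.snocInduction generalizing Δ₀ Ψ₀ Ξ₀ T₀ T₀' T Es Fs B₀ W' Q' with
  | nil => simp at hA
  | @snoc P P' Q Γ₁ Δ₁ Bs Ds₁ Ds D hg hD gs g ih =>
    rcases List.eq_nil_or_concat' Δ₁ with rfl | ⟨Δ₁, B', rfl⟩
    · obtain rfl : Γ₁ = Bs := (List.append_nil _).symm.trans hg
      rw [compPath_snoc_nil, compPath_snoc_nil]
      refine .trans _ _ _ (convPath_receiveSend (Δ := []) (Λ' := Θ ++ Φ) _ _ _ _ k' rfl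
        (by rw [← k₁, ← k, ← k', ← k₀]; simp) _ _ _ _ _ _ _) ?_
      rw [substLast_putL_one]
      rw [CellPath.app_assoc (h₂ := rfl) (hA₂ := rfl) (h₃ := by rw [← k₁, ← k, ← k', ← k₀]; simp)
        (hA₃ := by rw [← hE, ← hD]; simp), CellPath.single_app]
      refine .trans _ _ _ (ih (by simp) _ _ rfl (by rw [← k₂]; rfl) hA _ _ _) ?_
      rw [CellPath.app_assoc (h₂ := rfl) (hA₂ := rfl) (h₃ := by rw [← k₂]; rfl)
        (hA₃ := by rw [← hE, ← hD]; simp), CellPath.single_app]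
      exact .refl _
    · obtain ⟨rfl, rfl⟩ : Γ₁ ++ Δ₁ = As ∧ B' = B := by
        have := List.append_inj' ((List.append_assoc _ _ _).trans (hg.trans hA.symm)) rfl
        exact ⟨this.1, List.singleton_inj.1 this.2⟩
      obtain ⟨Ξ₁, Ξ₂, V', hΞ, ts₁, ts₂, rfl⟩ := CellPath.exists_app ts Γ₁ rfl
      rw [CellPath.app_assoc (h₂ := rfl) (hA₂ := rfl) (h₃ := by rw [← h, ← hΞ, List.append_assoc])
        (hA₃ := hg), compPath_app, compPath_single,
        CellPath.app_assoc (Γ₃ := Ξ₂ ++ Γ ++ Φ) (h₂ := by simp) (hA₂ := rfl)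
        (h₃ := by rw [← h', ← hΞ]; simp) (hA₃ := hg), compPath_app, compPath_single,
        compose_eq_letIn _ _ (by simp), compose_eq_letIn _ _ (by simp)]
      refine .trans _ _ _ (ConvPath.app _ _ (.app _ _ (.refl _) (.cons _
        (conv_letIn_getR (Θ := Ξ₂ ++ Γ) rfl rfl rfl (by simp) (by simp) rfl (by simp) rfl ts₂ t g)
        (.refl _))) (.refl _)) ?_
      refine .trans _ _ _ (convPath_receiveSend (Λ' := Θ') _ _ _ _ k' (by rw [← h', ← hΞ]; simp) k₂
        _ _ _ _ _ _ _) ?_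
      rw [substLast_letIn (h' := by simp)]
      exact .refl _

/-- Composites of convertible paths are convertible when the paths differ only inside the part that
is bound by one entry `g`. -/
theorem convPath_compPath_of_middle {U V₁ V₂ V₃ V₄ W P P₁ P₂ Q : Exch M.Ob}
    {Γ₁ Γ₂ Γ₁₂ Θ Δ₁ Δ₂ Δ₁₂ Θ' Ω As₁ As₂ As₁₂ Ms Bs₁ Bs₂ Bs₁₂ Ms' Cs Ds₁ Ds₂ Ds X X' : List M.Ob}
    {D : M.Ob} (h₁ : Γ₁ ++ Γ₂ = Γ₁₂) (hA₁ : As₁ ++ As₂ = As₁₂) (h₂ : Δ₁ ++ Δ₂ = Δ₁₂)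
    (hA₂ : Bs₁ ++ Bs₂ = Bs₁₂) (h₃ : Θ ++ Δ₁₂ = Θ') (hA₃ : Ms ++ Bs₁₂ = Ms') (h₄ : Γ₁₂ ++ Θ' = Ω)
    (hA₄ : As₁₂ ++ Ms' = Cs) (hX : As₂ ++ (Ms ++ Bs₁) = X) (hX' : X ++ Bs₂ = X')
    (hC : As₁ ++ X' = Cs) (hD : Ds₁ ++ D :: Ds₂ = Ds) (hMs : Ms ≠ [])
    (a₁ : CellPath (Term M) U Γ₁ As₁ V₁) (a₂ : CellPath (Term M) V₁ Γ₂ As₂ V₂)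
    {m m' : CellPath (Term M) V₂ Θ Ms V₃} (b₁ : CellPath (Term M) V₃ Δ₁ Bs₁ V₄)
    (b₂ : CellPath (Term M) V₄ Δ₂ Bs₂ W) (g₁ : CellPath (Term M) P As₁ Ds₁ P₁)
    (g : Term M P₁ X D P₂) (g₂ : CellPath (Term M) P₂ Bs₂ Ds₂ Q) (hm : ConvPath m m') :
    ConvPath
      (compPath ((a₁.app h₁ hA₁ a₂).app h₄ hA₄ (m.app h₃ hA₃ (b₁.app h₂ hA₂ b₂)))
        (g₁.app hC hD (.cons hX' g g₂)))
      (compPath ((a₁.app h₁ hA₁ a₂).app h₄ hA₄ (m'.app h₃ hA₃ (b₁.app h₂ hA₂ b₂)))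
        (g₁.app hC hD (.cons hX' g g₂))) := by
  subst h₁ hA₁ h₂ hA₂ h₃ hA₃ h₄ hA₄ hX
  have key : ∀ m : CellPath (Term M) V₂ Θ Ms V₃,
      (a₁.app rfl rfl a₂).app rfl rfl (m.app rfl rfl (b₁.app rfl rfl b₂)) =
      a₁.app (by simp) hC (CellPath.app rfl hX'
        (a₂.app rfl rfl (m.app rfl rfl b₁)) b₂) := by
    intro m
    subst hX'
    conv_rhs =>
      rw [CellPath.app_assoc (Γ₃ := Θ ++ (Δ₁ ++ Δ₂)) (As₃ := Ms ++ (Bs₁ ++ Bs₂)) (h₂ := by simp)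
          (hA₂ := by simp) (h₃ := by simp) (hA₃ := by simp),
        CellPath.app_assoc (h₂ := rfl) (hA₂ := rfl) (h₃ := by simp) (hA₃ := by simp)]
    rw [CellPath.app_assoc (Γ₃ := Γ₂ ++ (Θ ++ Δ₁) ++ Δ₂) (h₂ := by simp) (hA₂ := by simp)
      (h₃ := by simp) (hA₃ := hC)]
  rw [key, key, compPath_app, compPath_app, compPath_cons, compPath_cons,
    compose_eq_letIn _ _ (by simp [hMs]), compose_eq_letIn _ _ (by simp [hMs])]
  exact ConvPath.app _ _ (.refl _) (.cons _ (Conv.letIn_args _ _ _ _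
    (.app _ _ (.refl _) (.app _ _ hm (.refl _)))) (.refl _))

/-- The position of two neighbours `B`, `C` in a block `X ++ Y` of a list that is cut between `X`
and `Y`, and between `B` and `C`: `X` ends in `B`, and `Y` starts with `C`. -/
theorem exists_append_of_cut {α : Type u} {Ξ X Y Φ Bs As : List α} {B C : α}
    (h : Ξ ++ X = Bs ++ [B]) (h' : Y ++ Φ = C :: As) (hX : X ≠ []) (hY : Y ≠ []) :
    ∃ X' Y', X = X' ++ [B] ∧ Y = C :: Y' ∧ Ξ ++ X' = Bs ∧ Y' ++ Φ = As := by
  obtain ⟨X', B', rfl⟩ := (List.eq_nil_or_concat' X).resolve_left hX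
  obtain ⟨C', Y', rfl⟩ := List.exists_cons_of_ne_nil hY
  rw [← List.append_assoc] at h
  obtain ⟨h₁, h₂⟩ := List.append_inj' h rfl
  obtain ⟨h₃, h₄⟩ := List.cons.inj h'
  exact ⟨X', Y', by rw [List.singleton_inj.1 h₂], by rw [h₃], h₁, h₄⟩

/-- A communication from a term to its right neighbour is also a communication of any composite of
the path. -/
theorem convPath_compPath_sendReceive {U V V' V'' W P Q : Exch M.Ob}
    {Δ Γ Ψ Ξ Φ Θ Θ₁ Θ₂ Λ Ω As Bs Cs Ds : List M.Ob} {A B C : M.Ob} (h₀ : Λ ++ Θ = Ω)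
    (h₁ : Δ ++ Γ = Ψ) (h₂ : Φ ++ Ξ = Θ₁) (h₃ : Ψ ++ Θ₁ = Θ) (h₄ : Γ ++ Φ ++ Ξ = Θ₂)
    (h₅ : Δ ++ Θ₂ = Θ) (hA : Bs ++ B :: C :: As = Cs) (a : CellPath (Term M) U Λ Bs V'')
    (v : M.Hom Γ A) (t : Term M V'' Δ B V) (s : Term M V (A :: Φ) C V')
    (b : CellPath (Term M) V' Ξ As W) (gs : CellPath (Term M) P Cs Ds Q) :
    ConvPath (compPath (a.app h₀ hA (.cons h₃ (.putR h₁ v t) (.cons h₂ (.getL s) b))) gs)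
      (compPath (a.app h₀ hA (.cons h₅ t (.cons h₄ (substFirst v s) b))) gs) := by
  rcases gs.exists_cut (Δ₁ := Bs ++ [B]) (Δ₂ := C :: As) (by rw [← hA]; simp) with
    ⟨Ds₁, Ds₂, P', hD, g₁, g₂, rfl⟩ |
    ⟨Ξ', X, Y, Φ', Ψ', Ψ'', Ds₁, Ds₂, D, P₁, P₂, hX, hY, k₁, k₂, hΨ, hD, g₁, g, g₂, hX', hY', rfl⟩
  · obtain ⟨V₁, Δ', Ξ₁, Cs', C', hC, k₄, q, s', e, hq⟩ :=
      exists_compPath_putR h₁ (Ξ := Λ) rfl rfl rfl a v t g₁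
    rw [← CellPath.single_app h₃ rfl, ← CellPath.single_app h₅ rfl,
      ← CellPath.app_assoc (h := by rw [← h₀, ← h₃, ← List.append_assoc]) (hA := by rw [← hA]; simp)
        (h₁ := rfl) (hA₁ := rfl),
      ← CellPath.app_assoc (h := by rw [← h₀, ← h₅, ← List.append_assoc]) (hA := by rw [← hA]; simp)
        (h₁ := rfl) (hA₁ := rfl), compPath_app, compPath_app, e]
    have k₅ : Ξ₁ ++ (Δ' ++ Γ) = Λ ++ Ψ := by rw [← List.append_assoc, k₄, ← h₁, List.append_assoc]
    refine .trans _ _ _ (ConvPath.app _ _ (hq _ rfl k₅) (.refl _)) ?_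
    rw [CellPath.app_assoc (h₂ := rfl) (hA₂ := rfl)
        (h₃ := by rw [← h₀, ← h₃, ← List.append_assoc, ← List.append_assoc, ← List.append_assoc,
          List.append_assoc _ Δ', k₅])
        (hA₃ := by rw [← hD, ← hC]; simp),
      CellPath.app_assoc (Γ₃ := Δ' ++ Γ ++ Θ₁) (h₂ := by rw [← h₂, ← h₄]; simp) (hA₂ := rfl)
        (h₃ := by rw [← h₀, ← h₃, ← List.append_assoc, ← List.append_assoc, ← List.append_assoc,
          List.append_assoc _ Δ', k₅])
        (hA₃ := by rw [← hD, ← hC]; simp), CellPath.single_app, CellPath.single_app]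
    exact ConvPath.app _ _ (.refl _) (convPath_putR_compPath_getL _ _ _ _ _ _ _ _ _ _)
  · obtain ⟨X', Y', rfl, rfl, rfl, rfl⟩ := exists_append_of_cut hX hY hX' hY'
    obtain ⟨Λ₁, Λ₂, U₁, hΛ, a₁, a₂, rfl⟩ := a.exists_app Ξ' rfl
    obtain ⟨Ξ₁, Ξ₂, W₁, hΞ, b₁, b₂, rfl⟩ := b.exists_app Y' rfl
    have hm : Δ ++ (Γ ++ Φ) ++ Ξ = Θ := by rw [← h₅, ← h₄, List.append_assoc]
    rw [CellPath.cons_cons_eq_app h₃ h₂ (by rw [← h₁, List.append_assoc]) hm,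
      CellPath.cons_cons_eq_app h₅ h₄ rfl hm]
    exact convPath_compPath_of_middle _ _ _ _ _ _ _ _ (by rw [← hΨ]; simp) _ _ _ (by simp)
      _ _ _ _ _ _ _ (.rel _ _ (.r1 _ _ _ _ _ _ _ _ _))

/-- A communication from a term to its left neighbour is also a communication of any composite of
the path. -/
theorem convPath_compPath_receiveSend {U V V' V'' W P Q : Exch M.Ob}
    {Δ Γ Ψ Ξ Φ Θ Θ₁ Θ₂ Λ Ω As Bs Cs Ds : List M.Ob} {A B C : M.Ob} (h₀ : Λ ++ Θ = Ω)
    (h₁ : Γ ++ Φ = Ψ) (h₂ : Ψ ++ Ξ = Θ₁) (h₃ : Δ ++ Θ₁ = Θ) (h₄ : Φ ++ Ξ = Θ₂)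
    (h₅ : Δ ++ Γ ++ Θ₂ = Θ) (hA : Bs ++ B :: C :: As = Cs) (a : CellPath (Term M) U Λ Bs V'')
    (v : M.Hom Γ A) (t : Term M V'' (Δ ++ [A]) B V) (s : Term M V Φ C V')
    (b : CellPath (Term M) V' Ξ As W) (gs : CellPath (Term M) P Cs Ds Q) :
    ConvPath (compPath (a.app h₀ hA (.cons h₃ (.getR t) (.cons h₂ (.putL h₁ v s) b))) gs)
      (compPath (a.app h₀ hA (.cons h₅ (substLast v t) (.cons h₄ s b))) gs) := by
  rcases gs.exists_cut (Δ₁ := Bs ++ [B]) (Δ₂ := C :: As) (by rw [← hA]; simp) with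
    ⟨Ds₁, Ds₂, P', hD, g₁, g₂, rfl⟩ |
    ⟨Ξ', X, Y, Φ', Ψ', Ψ'', Ds₁, Ds₂, D, P₁, P₂, hX, hY, k₁, k₂, hΨ, hD, g₁, g, g₂, hX', hY', rfl⟩
  · cases Ds₂ with
    | nil => cases g₂
    | cons D Ds₂ =>
    obtain ⟨V₁, Δ', Ξ₁, k₄, s', q, e, hq⟩ := exists_compPath_putL h₁ h₂ h₄ v s b g₂
    rw [← CellPath.single_app h₃ rfl, ← CellPath.single_app h₅ rfl,
      ← CellPath.app_assoc (h := by rw [← h₀, ← h₃, ← List.append_assoc]) (hA := by rw [← hA]; simp)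
        (h₁ := rfl) (hA₁ := rfl),
      ← CellPath.app_assoc (h := by rw [← h₀, ← h₅, List.append_assoc]) (hA := by rw [← hA]; simp)
        (h₁ := rfl) (hA₁ := rfl), compPath_app, compPath_app, e]
    have k₅ : Γ ++ Δ' ++ Ξ₁ = Θ₁ := by
      rw [List.append_assoc, k₄, ← h₂, ← h₁, ← h₄, List.append_assoc]
    refine .trans _ _ _ (ConvPath.app _ _ (.refl _) (hq _ rfl k₅)) ?_
    exact convPath_compPath_getR_putL _ _ _ _ _ _ _ _ _ _ _ _ _ _ _
  · obtain ⟨X', Y', rfl, rfl, rfl, rfl⟩ := exists_append_of_cut hX hY hX' hY'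
    obtain ⟨Λ₁, Λ₂, U₁, hΛ, a₁, a₂, rfl⟩ := a.exists_app Ξ' rfl
    obtain ⟨Ξ₁, Ξ₂, W₁, hΞ, b₁, b₂, rfl⟩ := b.exists_app Y' rfl
    have hm : Δ ++ Γ ++ Φ ++ Ξ = Θ := by rw [← h₅, ← h₄, List.append_assoc]
    rw [CellPath.cons_cons_eq_app h₃ h₂ (by rw [← h₁, List.append_assoc]) hm,
      CellPath.cons_cons_eq_app h₅ h₄ rfl hm]
    exact convPath_compPath_of_middle _ _ _ _ _ _ _ _ (by rw [← hΨ]; simp) _ _ _ (by simp)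
      _ _ _ _ _ _ _ (.rel _ _ (.r2 _ _ _ _ _ _ _ _ _))

/-! ### Composites of the empty path -/

/-- The composite of the empty path at `A^∘ U` with `gs` forwards a message from left to right: if
the term `t` in front of it sends `v` to the right, then the last entry of the composite of the
empty path at `U`, with `t` in front, sends `v` to the right instead. -/
theorem exists_putR_compPath_nil {U V P Q : Exch M.Ob} {Γ Φ Θ : List M.Ob} {A B : M.Ob}
    {Bs : List M.Ob} (h : [] ++ Φ = Γ) (k : Γ ++ [] = Θ) (k' : [] ++ Φ = Θ) (v : M.Hom Φ A)
    (t : Term M V [] B (U ++ P)) (gs : CellPath (Term M) P [] Bs Q) :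
    ∃ (V' : Exch M.Ob) (Cs : List M.Ob) (C : M.Ob) (hC : Cs ++ [C] = B :: Bs)
      (q : CellPath (Term M) V [] Cs V') (s : Term M V' [] C (U ++ Q)),
      CellPath.cons rfl t (compPath (.nil U) gs) = q.app rfl hC (.single s) ∧
      ConvPath (.cons k (.putR h v t) (compPath (.nil ((A, Polarity.circ) :: U)) gs))
        (q.app k' hC (.single (.putR rfl v s))) := by
  induction Bs generalizing P V B Γ Θ with
  | nil =>
    cases gs
    exact ⟨V, [], B, rfl, .nil V, t, rfl, .of_eq (by
      subst h; obtain rfl : Φ = Θ := k'; rfl)⟩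
  | cons C Bs ih =>
    cases gs with
    | @cons _ P' _ Γ₁ Δ₁ _ _ _ hg g gs =>
    obtain ⟨rfl, rfl⟩ := List.append_eq_nil_iff.1 hg
    obtain ⟨V', Cs, C', hC, q, s, e, hq⟩ := ih (Γ := Φ ++ []) (by simp) (by simpa using k') k'
      (idHor g U) gs
    refine ⟨V', B :: Cs, C', congrArg (B :: ·) hC, .cons rfl t q, s, ?_, ?_⟩
    · rw [compPath_cons_nil, e, CellPath.cons_app (h₃ := rfl)]
    · rw [compPath_cons_nil]
      refine .trans _ _ _ (.rel _ _ (.r1 (Φ := []) (Ξ := []) _ _ _ (Θ₂ := Θ)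
        (by simpa using k') rfl v t (.putR (Δ := []) rfl (M.one A) (idHor g U)) _)) ?_
      rw [← CellPath.cons_app (h₁ := k') (h₂ := rfl) (hA := hC) (Ξ := Θ),
        substFirst_putR_one (by simp)]
      exact ConvPath.cons _ (.refl _) hq

/-- The composite of the empty path at `A^• U` with `gs` forwards a message from right to left: if
the term `t` behind it sends `v` to the left, then the first entry of the composite of the empty
path at `U`, with `t` behind, sends `v` to the left instead. -/
theorem exists_putL_compPath_nil {U V P Q : Exch M.Ob} {Γ Φ Θ : List M.Ob} {A B : M.Ob}
    {Bs Bs' : List M.Ob} (h : Φ ++ [] = Γ) (k : [] ++ Γ = Θ) (k' : Φ ++ [] = Θ)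
    (hB : Bs ++ [B] = Bs') (v : M.Hom Φ A)
    (gs : CellPath (Term M) P [] Bs Q) (t : Term M (U ++ Q) [] B V) :
    ∃ (V' : Exch M.Ob) (Cs : List M.Ob) (C : M.Ob) (hC : C :: Cs = Bs')
      (s : Term M (U ++ P) [] C V') (q : CellPath (Term M) V' [] Cs V),
      (compPath (.nil U) gs).app rfl hB (.single t) = CellPath.app rfl hC (.single s) q ∧
      ConvPath ((compPath (.nil ((A, Polarity.bullet) :: U)) gs).app k hB (.single (.putL h v t)))
        (CellPath.app k' hC (.single (.putL (List.append_nil Φ) v s)) q) := by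
  obtain rfl : Γ = Θ := k
  obtain rfl : Φ = Γ := (List.append_nil Φ).symm.trans h
  induction Bs generalizing P Bs' with
  | nil =>
    cases gs
    subst hB
    exact ⟨V, [], B, rfl, t, .nil V, rfl, .of_eq (CellPath.app_nil _).symm⟩
  | cons C Bs ih =>
    obtain ⟨Bs'', rfl⟩ : ∃ Bs'', Bs' = C :: Bs'' := ⟨Bs ++ [B], hB.symm⟩
    have hB' : Bs ++ [B] = Bs'' := by simpa using hB
    cases gs with
    | @cons _ P' _ Γ₁ Δ₁ _ _ _ hg g gs =>
    obtain ⟨rfl, rfl⟩ := List.append_eq_nil_iff.1 hg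
    obtain ⟨V', Cs, C', rfl, s, q, e, hq⟩ := ih hB' gs
    refine ⟨_, C' :: Cs, C, rfl, idHor g U, (compPath (.nil U) gs).app rfl hB' (.single t), ?_, ?_⟩
    · rw [compPath_cons_nil, CellPath.single_app]
      exact CellPath.app_cons (Γ₁ := []) (Γ₂ := []) (Ξ := []) _ _ _ rfl rfl hB' _ _ _
    · rw [compPath_cons_nil, e]
      refine .trans _ _ _ (ConvPath.of_eq
        (CellPath.app_cons (Γ₁ := []) (Γ₂ := []) (Ξ := Φ) _ _ _ rfl rfl hB' _ _ _)) ?_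
      refine .trans _ _ _ (ConvPath.cons _ (.refl _) hq) ?_
      rw [CellPath.single_app, CellPath.single_app, CellPath.single_app]
      refine .trans _ _ _ (.rel _ _ (.r2 (Δ := []) (Φ := []) (Ξ := []) _ _ _ rfl (by simp) v
        (.putL (Γ := [A]) rfl (M.one A) (idHor g U)) s q)) ?_
      rw [substLast_putL_one]
      exact .refl _

theorem ne_nil_of_cons {U W : Exch M.Ob} {Γ As : List M.Ob} {B : M.Ob}
    (gs : CellPath (Term M) U (B :: Γ) As W) : As ≠ [] := by
  rintro rfl; cases gs

/-! ### Associativity of composition -/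

/-- The rewrite that pulls a `putL` out of a let, for the composites of a path. The next three
lemmas do the same for the other actions. -/
theorem conv_letIn_compPath_putL {U V W P Q P' Q' R S : Exch M.Ob}
    {Φ Δ Γ Ξ Θ Ψ As Ds : List M.Ob} {A B C : M.Ob}
    (hU : U ++ P ++ P' = R) (hU' : (A, Polarity.bullet) :: U ++ P ++ P' = (A, Polarity.bullet) :: R)
    (hW : W ++ Q ++ Q' = S) (hn hn')
    (h₁ : Φ ++ Δ = Γ) (h₂ : Γ ++ Ξ = Θ) (h₃ : Δ ++ Ξ = Ψ) (h₄ : Φ ++ Ψ = Θ)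
    (v : M.Hom Φ A) (t : Term M U Δ B V) (ts : CellPath (Term M) V Ξ As W)
    (gs : CellPath (Term M) P (B :: As) Ds Q) (f : Term M P' Ds C Q') :
    Conv (.letIn hU' hW hn (compPath (.cons h₂ (.putL h₁ v t) ts) gs) f)
      (.putL h₄ v (.letIn hU hW hn' (compPath (.cons h₃ t ts) gs) f)) := by
  obtain ⟨D, Ds, rfl⟩ := List.exists_cons_of_ne_nil (ne_nil_of_cons gs)
  obtain ⟨V', Δ', Ξ', k, s, q, e, hq⟩ := exists_compPath_putL h₁ h₂ h₃ v t ts gs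
  have k' : Φ ++ Δ' ++ Ξ' = Θ := by rw [List.append_assoc, k, h₄]
  refine .trans _ _ _ (Conv.letIn_args _ _ _ _ (hq _ rfl k')) ?_
  rw [e]
  exact conv_letIn_putL _ _ _ _ _ _ _ _ _ _ _ _ _

theorem conv_letIn_compPath_putR {U V W P Q P' Q' R S : Exch M.Ob}
    {Φ Δ Γ Ξ Θ Ψ As Bs Ds : List M.Ob} {A B C : M.Ob}
    (hU : U ++ P ++ P' = R) (hW : W ++ Q ++ Q' = S)
    (hW' : (A, Polarity.circ) :: W ++ Q ++ Q' = (A, Polarity.circ) :: S) (hn hn')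
    (h₁ : Δ ++ Φ = Γ) (h₂ : Ξ ++ Γ = Θ) (h₃ : Ξ ++ Δ = Ψ) (h₄ : Ψ ++ Φ = Θ) (hA : As ++ [B] = Bs)
    (ts : CellPath (Term M) U Ξ As V) (v : M.Hom Φ A) (t : Term M V Δ B W)
    (gs : CellPath (Term M) P Bs Ds Q) (f : Term M P' Ds C Q') :
    Conv (.letIn hU hW' hn (compPath (ts.app h₂ hA (.single (.putR h₁ v t))) gs) f)
      (.putR h₄ v (.letIn hU hW hn' (compPath (ts.app h₃ hA (.single t)) gs) f)) := by
  obtain ⟨V', Δ', Ξ', Cs, D, hD, k, q, s, e, hq⟩ := exists_compPath_putR h₁ h₂ h₃ hA ts v t gs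
  have k' : Ξ' ++ (Δ' ++ Φ) = Θ := by rw [← List.append_assoc, k, h₄]
  refine .trans _ _ _ (Conv.letIn_args _ _ _ _ (hq _ rfl k')) ?_
  rw [e]
  exact conv_letIn_putR _ _ _ _ _ _ _ _ _ _ _ _ _ _

theorem conv_letIn_compPath_getL {U V W P Q P' Q' R S : Exch M.Ob}
    {Γ Ξ Θ As Ds : List M.Ob} {A B C : M.Ob}
    (hU : U ++ P ++ P' = R) (hU' : (A, Polarity.circ) :: U ++ P ++ P' = (A, Polarity.circ) :: R)
    (hW : W ++ Q ++ Q' = S) (hn hn') (h : Γ ++ Ξ = Θ) (h' : A :: Γ ++ Ξ = A :: Θ)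
    (t : Term M U (A :: Γ) B V) (ts : CellPath (Term M) V Ξ As W)
    (gs : CellPath (Term M) P (B :: As) Ds Q) (f : Term M P' Ds C Q') :
    Conv (.letIn hU' hW hn (compPath (.cons h (.getL t) ts) gs) f)
      (.getL (.letIn hU hW hn' (compPath (.cons h' t ts) gs) f)) := by
  cases gs with
  | @cons _ P₁ _ Γ₁ Δ₁ _ _ _ hg g gs =>
  cases Γ₁ with
  | nil =>
    obtain rfl : Δ₁ = B :: As := hg
    rw [compPath_cons_nil, compPath_cons_nil]
    refine .trans _ _ _ (conv_letIn_getL hU hU' hW _ (by simp) rfl rfl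
      (.putR (Δ := []) rfl (M.one A) (idHor g U)) _ f) (Conv.getL (Conv.letIn_args _ _ _ _ ?_))
    refine .trans _ _ _ (convPath_putR_compPath_getL (Δ₀ := []) (Φ := [A]) rfl rfl rfl h h'
      (M.one A) (idHor g U) t ts gs) ?_
    rw [substFirst_one]
    exact .refl _
  | cons B' Γ₁ =>
    obtain ⟨rfl, rfl⟩ : B' = B ∧ Γ₁ ++ Δ₁ = As := by simpa using hg
    obtain ⟨Ξ₁, Ξ₂, V', hΞ, ts₁, ts₂, rfl⟩ := CellPath.exists_app ts Γ₁ rfl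
    rw [CellPath.cons_app (h₃ := rfl), compPath_cons,
      CellPath.cons_app (Γ := A :: (Γ ++ Ξ₁)) (h₃ := rfl), compPath_cons]
    refine .trans _ _ _ (Conv.letIn_args _ _ _ _ (ConvPath.cons _
      (conv_letIn_getL rfl rfl rfl (by simp) (by simp) rfl rfl t ts₁ g) (.refl _))) ?_
    exact conv_letIn_getL _ _ _ _ _ _ _ _ _ _

theorem conv_letIn_compPath_getR {U V W P Q P' Q' R S : Exch M.Ob}
    {Γ Ξ Θ As Bs Ds : List M.Ob} {A B C : M.Ob}
    (hU : U ++ P ++ P' = R) (hW : W ++ Q ++ Q' = S)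
    (hW' : (A, Polarity.bullet) :: W ++ Q ++ Q' = (A, Polarity.bullet) :: S) (hn hn')
    (h₁ : Ξ ++ Γ = Θ) (h₂ : Ξ ++ (Γ ++ [A]) = Θ ++ [A]) (hA : As ++ [B] = Bs)
    (ts : CellPath (Term M) U Ξ As V) (t : Term M V (Γ ++ [A]) B W)
    (gs : CellPath (Term M) P Bs Ds Q) (f : Term M P' Ds C Q') :
    Conv (.letIn hU hW' hn (compPath (ts.app h₁ hA (.single (.getR t))) gs) f)
      (.getR (.letIn hU hW hn' (compPath (ts.app h₂ hA (.single t)) gs) f)) := by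
  obtain ⟨Γ₁, Δ₁, Ds₁, D, P₁, hg, hD, gs, g, rfl⟩ :=
    gs.exists_snoc (by rintro rfl; cases gs; simp at hA)
  rcases List.eq_nil_or_concat' Δ₁ with rfl | ⟨Δ₁, B', rfl⟩
  · obtain rfl : Γ₁ = Bs := (List.append_nil _).symm.trans hg
    rw [compPath_snoc_nil, compPath_snoc_nil]
    refine .trans _ _ _ (conv_letIn_getR (Γ := []) hU hW hW' _ (by simp [← hD]) (by simp) rfl _ _
      (.putL (Γ := [A]) rfl (M.one A) (idHor g W)) f) (Conv.getR (Conv.letIn_args _ _ _ _ ?_))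
    refine .trans _ _ _ (convPath_compPath_getR_putL (Θ' := Θ ++ [A]) _ _ _ rfl (by simp)
      h₁ h₂ _ _ _ _ _ _ _ _) ?_
    rw [substLast_one]
    exact .refl _
  · obtain ⟨rfl, rfl⟩ : Γ₁ ++ Δ₁ = As ∧ B' = B := by
      have := List.append_inj' ((List.append_assoc _ _ _).trans (hg.trans hA.symm)) rfl
      exact ⟨this.1, List.singleton_inj.1 this.2⟩
    obtain ⟨Ξ₁, Ξ₂, V', hΞ, ts₁, ts₂, rfl⟩ := CellPath.exists_app ts Γ₁ rfl
    rw [CellPath.app_assoc (h₂ := rfl) (hA₂ := rfl) (h₃ := by rw [← h₁, ← hΞ, List.append_assoc])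
        (hA₃ := hg), compPath_app, compPath_single,
      CellPath.app_assoc (Γ₃ := Ξ₂ ++ Γ ++ [A]) (h₂ := by simp) (hA₂ := rfl)
        (h₃ := by rw [← h₁, ← hΞ]; simp) (hA₃ := hg), compPath_app, compPath_single,
      compose_eq_letIn _ _ (by simp), compose_eq_letIn _ _ (by simp)]
    refine .trans _ _ _ (Conv.letIn_args _ _ _ _ (ConvPath.app _ _ (.refl _) (ConvPath.cons _
      (conv_letIn_getR (Θ := Ξ₂ ++ Γ) rfl rfl rfl (by simp) (by simp) rfl (by simp) rfl ts₂ t g)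
      (.refl _)))) ?_
    exact conv_letIn_getR _ _ _ _ _ _ _ _ _ _ _

/-- Associativity of composition, for a nonempty path of terms without lets. -/
theorem LetFreePath.conv_letIn_compPath {n : ℕ} {U W : Exch M.Ob} {Γ Δ : List M.Ob}
    {hs : CellPath (Term M) U Γ Δ W} (hhs : LetFreePath n hs) (hΔ : Δ ≠ [])
    {P Q P' Q' R S : Exch M.Ob} {Ds : List M.Ob} {C : M.Ob}
    (gs : CellPath (Term M) P Δ Ds Q) (f : Term M P' Ds C Q')
    (hU : U ++ P ++ P' = R) (hW : W ++ Q ++ Q' = S) (hU' : U ++ (P ++ P') = R)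
    (hW' : W ++ (Q ++ Q') = S) (hn : Ds = [] → U ++ P = []) (hn₁ : Δ = [] → U = [])
    (hn₂ : Ds = [] → P = []) :
    Conv (.letIn hU hW hn (compPath hs gs) f)
      (.letIn hU' hW' hn₁ hs (.letIn rfl rfl hn₂ gs f)) := by
  refine LetFreePath.induction (motive := fun {U W Γ Δ} hs => Δ ≠ [] →
    ∀ {P Q P' Q' R S : Exch M.Ob} {Ds : List M.Ob} {C : M.Ob}
    (gs : CellPath (Term M) P Δ Ds Q) (f : Term M P' Ds C Q')
    (hU : U ++ P ++ P' = R) (hW : W ++ Q ++ Q' = S) (hU' : U ++ (P ++ P') = R)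
    (hW' : W ++ (Q ++ Q') = S) (hn : Ds = [] → U ++ P = []) (hn₂ : Ds = [] → P = [])
    (hn₁ : Δ = [] → U = []),
    Conv (.letIn hU hW hn (compPath hs gs) f)
      (.letIn hU' hW' hn₁ hs (.letIn rfl rfl hn₂ gs f))) ?_ ?_ ?_ ?_ ?_ ?_ ?_ hhs
    (fun h => absurd h hΔ) hΔ gs f hU hW hU' hW' hn hn₂ hn₁
  · intro Γ Δ vs hΔ P Q P' Q' R S Ds C gs f hU hW hU' hW' hn hn₂ hn₁
    subst hU' hW'
    refine .trans _ _ _ (Conv.letIn_args _ _ _ _ (convPath_compPath_neutrals vs gs)) ?_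
    exact .symm _ _ (.rel _ _ (.r0 vs (.letIn rfl rfl hn₂ gs f)))
  · intro U V W Φ Δ Γ Ξ Θ Ψ As A B h₁ h₂ h₃ v t ts ih hΔ P Q P' Q' R S Ds C gs f
      hU hW hU' hW' hn hn₂ hn₁
    subst hU
    have h₄ : Φ ++ Ψ = Θ := by rw [← h₂, ← h₃, ← h₁, List.append_assoc]
    have hDs : Ds ≠ [] := ne_nil_of_cons gs
    refine .trans _ _ _ (conv_letIn_compPath_putL rfl _ _ _ (by simp [hDs]) _ _ h₃ h₄ _ _ _ _ _) ?_
    refine .trans _ _ _ (Conv.putL _ _ (ih (by simp) gs f rfl hW (by simp) hW' _ hn₂ (by simp))) ?_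
    exact .symm _ _ (conv_letIn_putL _ _ _ _ _ _ _ _ _ _ _ _ _)
  · intro U V W Γ Ξ Θ As A B h t ts ih hΔ P Q P' Q' R S Ds C gs f hU hW hU' hW' hn hn₂ hn₁
    subst hU
    have hDs : Ds ≠ [] := ne_nil_of_cons gs
    refine .trans _ _ _ (conv_letIn_compPath_getL rfl _ _ _ (by simp [hDs]) _ (by simp [h])
      _ _ _ _) ?_
    refine .trans _ _ _ (Conv.getL (ih (by simp) gs f rfl hW (by simp) hW' _ hn₂ (by simp))) ?_
    exact .symm _ _ (conv_letIn_getL _ _ _ _ _ _ _ _ _ _)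
  · intro U V W Φ Δ Γ Ξ Θ Ψ As Bs A B h₁ h₂ h₃ hA ts v t ih hΔ P Q P' Q' R S Ds C gs f
      hU hW hU' hW' hn hn₂ hn₁
    subst hW
    have h₄ : Ψ ++ Φ = Θ := by rw [← h₂, ← h₃, ← h₁, List.append_assoc]
    refine .trans _ _ _ (conv_letIn_compPath_putR _ rfl _ _ hn _ _ h₃ h₄ _ _ _ _ _ _) ?_
    refine .trans _ _ _ (Conv.putR _ _ (ih hΔ gs f hU rfl hU' (by simp) hn hn₂ hn₁)) ?_
    exact .symm _ _ (conv_letIn_putR _ _ _ _ _ _ _ _ _ _ _ _ _ _)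
  · intro U V W Γ Ξ Θ As Bs A B h₁ h₂ hA ts t ih hΔ P Q P' Q' R S Ds C gs f hU hW hU' hW' hn hn₂ hn₁
    subst hW
    refine .trans _ _ _ (conv_letIn_compPath_getR _ rfl _ _ hn _ h₂ _ _ _ _ _) ?_
    refine .trans _ _ _ (Conv.getR (ih hΔ gs f hU rfl hU' (by simp) hn hn₂ hn₁)) ?_
    exact .symm _ _ (conv_letIn_getR _ _ _ _ _ _ _ _ _ _ _)
  · intro U V V' V'' W Δ Γ Ψ Ξ Φ Θ Θ₁ Θ₂ Λ Ω As Bs Cs A B C h₀ h₁ h₂ h₃ h₄ h₅ hA a v t s b ih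
      hΔ P Q P' Q' R S Ds D gs f hU hW hU' hW' hn hn₂ hn₁
    refine .trans _ _ _ (Conv.letIn_args _ _ _ _
      (convPath_compPath_sendReceive _ _ _ _ h₄ h₅ _ _ _ _ _ _ _)) ?_
    refine .trans _ _ _ (ih hΔ gs f hU hW hU' hW' hn hn₂ hn₁) ?_
    exact .symm _ _ (.rel _ _ (.letIn_args _ _ _ _ (stepPath_sendReceive _ _ _ _ _ _ _ _ _ _ _ _)))
  · intro U V V' V'' W Δ Γ Ψ Ξ Φ Θ Θ₁ Θ₂ Λ Ω As Bs Cs A B C h₀ h₁ h₂ h₃ h₄ h₅ hA a v t s b ih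
      hΔ P Q P' Q' R S Ds D gs f hU hW hU' hW' hn hn₂ hn₁
    refine .trans _ _ _ (Conv.letIn_args _ _ _ _
      (convPath_compPath_receiveSend _ _ _ _ h₄ h₅ _ _ _ _ _ _ _)) ?_
    refine .trans _ _ _ (ih hΔ gs f hU hW hU' hW' hn hn₂ hn₁) ?_
    exact .symm _ _ (.rel _ _ (.letIn_args _ _ _ _ (stepPath_receiveSend _ _ _ _ _ _ _ _ _ _ _ _)))

theorem compPath_nil_left {P Q : Exch M.Ob} {Γ As : List M.Ob} (h : Γ = [])
    (gs : CellPath (Term M) P Γ As Q) : compPath (.nil []) (h ▸ gs) = h ▸ gs := by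
  induction gs with
  | nil => rfl
  | cons k g gs ih =>
    subst h
    obtain ⟨rfl, rfl⟩ := List.append_eq_nil_iff.1 k
    rw [compPath_cons_nil]
    exact congrArg _ (ih rfl)

theorem cast_idHor_circ {P Q R S : Exch M.Ob} {A B : M.Ob} (f : Term M P [] B Q) (U : Exch M.Ob)
    (hU : U ++ P = R) (hW : U ++ Q = S)
    (hU' : (A, Polarity.circ) :: U ++ P = (A, Polarity.circ) :: R)
    (hW' : (A, Polarity.circ) :: U ++ Q = (A, Polarity.circ) :: S) :
    (idHor f ((A, .circ) :: U)).cast hU' hW' =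
      .getL (.putR (Δ := []) rfl (M.one A) ((idHor f U).cast hU hW)) := by
  subst hU hW; rfl

theorem cast_idHor_bullet {P Q R S : Exch M.Ob} {A B : M.Ob} (f : Term M P [] B Q) (U : Exch M.Ob)
    (hU : U ++ P = R) (hW : U ++ Q = S)
    (hU' : (A, Polarity.bullet) :: U ++ P = (A, Polarity.bullet) :: R)
    (hW' : (A, Polarity.bullet) :: U ++ Q = (A, Polarity.bullet) :: S) :
    (idHor f ((A, .bullet) :: U)).cast hU' hW' =
      .getR (Γ := []) (.putL (Γ := [A]) rfl (M.one A) ((idHor f U).cast hU hW)) := by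
  subst hU hW; rfl

/-- The terms `id_U(f)` are compatible with concatenation of exchanges. This is associativity of
composition for two empty paths. -/
theorem idHor_append {P Q R S : Exch M.Ob} {B : M.Ob} (f : Term M P [] B Q) (U V : Exch M.Ob)
    (hU : U ++ V ++ P = R) (hW : U ++ V ++ Q = S) (hU' : U ++ (V ++ P) = R)
    (hW' : U ++ (V ++ Q) = S) :
    (idHor f (U ++ V)).cast hU hW = (idHor (idHor f V) U).cast hU' hW' := by
  induction U generalizing R S with
  | nil => subst hU hW; rfl
  | cons a U ih =>
    subst hU hW
    obtain ⟨A, _ | _⟩ := a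
    · exact congrArg (fun t => Term.getL (.putR (Δ := []) rfl (M.one A) t))
        (ih rfl rfl (by simp) (by simp)) |>.trans (cast_idHor_circ _ _ _ _ _ _).symm
    · exact congrArg (fun t => Term.getR (Γ := []) (.putL (Γ := [A]) rfl (M.one A) t))
        (ih rfl rfl (by simp) (by simp)) |>.trans (cast_idHor_bullet _ _ _ _ _ _).symm

/-- Associativity of composition, for the empty path at `U`. -/
theorem conv_letIn_compPath_nil {U P Q P' Q' R S : Exch M.Ob} {As : List M.Ob} {B : M.Ob}
    (hAs : As ≠ []) (gs : CellPath (Term M) P [] As Q) (f : Term M P' As B Q')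
    (hU : U ++ P ++ P' = R) (hW : U ++ Q ++ Q' = S) (hU' : U ++ (P ++ P') = R)
    (hW' : U ++ (Q ++ Q') = S) (hn : As = [] → U ++ P = []) (hn' : As = [] → P = []) :
    Conv (.letIn hU hW hn (compPath (.nil U) gs) f)
      ((idHor (.letIn rfl rfl hn' gs f) U).cast hU' hW') := by
  induction U generalizing R S with
  | nil =>
    subst hU hW
    exact .of_eq (congrArg (fun ts => Term.letIn rfl rfl hn ts f) (compPath_nil_left rfl gs))
  | cons a U ih =>
    obtain ⟨A, _ | _⟩ := a
    · subst hU hW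
      rw [cast_idHor_circ (R := U ++ P ++ P') (S := U ++ Q ++ Q') _ _ (by simp) (by simp)]
      cases gs with
      | nil => exact absurd rfl hAs
      | @cons _ P₁ _ Γ₁ Δ₁ _ _ _ hg g gs =>
      obtain ⟨rfl, rfl⟩ := List.append_eq_nil_iff.1 hg
      obtain ⟨V', Cs, C, hC, q, s, e, hq⟩ := exists_putR_compPath_nil rfl (Γ := [A]) rfl rfl
        (M.one A) (idHor g U) gs
      rw [compPath_cons_nil]
      refine .trans _ _ _ (conv_letIn_getL rfl _ rfl _ (by simp) rfl rfl
        (.putR (Δ := []) rfl (M.one A) (idHor g U)) _ f) (Conv.getL ?_)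
      refine .trans _ _ _ (Conv.letIn_args _ _ _ _ hq) ?_
      refine .trans _ _ _ (conv_letIn_putR (W := U ++ Q) (W' := U ++ Q ++ Q') (Δ := []) (Ξ := [])
        (Ψ := []) rfl rfl _ _ (by simp [← hC]) _ _ rfl rfl hC q (M.one A) s f) (Conv.putR _ _ ?_)
      rw [← e]
      have := ih rfl rfl (by simp) (by simp) (by simp)
      rw [compPath_cons_nil] at this
      exact this
    · subst hU hW
      rw [cast_idHor_bullet (R := U ++ P ++ P') (S := U ++ Q ++ Q') _ _ (by simp) (by simp)]
      obtain ⟨Γ₁, Δ₁, Ds₁, D, P₁, hg, hD, gs, g, rfl⟩ := gs.exists_snoc hAs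
      obtain ⟨rfl, rfl⟩ := List.append_eq_nil_iff.1 hg
      obtain ⟨V', Cs, C, rfl, s, q, e, hq⟩ := exists_putL_compPath_nil (Γ := [A]) rfl rfl rfl hD
        (M.one A) gs (idHor g U)
      rw [compPath_snoc_nil]
      refine .trans _ _ _ (conv_letIn_getR (U := (A, .bullet) :: (U ++ P)) (W := U ++ Q)
        (W' := U ++ Q ++ Q') (Γ := []) (Ξ := []) rfl rfl _ _ (by simp [← hD]) rfl rfl hD _
        (.putL (Γ := [A]) rfl (M.one A) (idHor g U)) f) (Conv.getR ?_)
      refine .trans _ _ _ (Conv.letIn_args _ _ _ _ hq) ?_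
      rw [CellPath.single_app]
      refine .trans _ _ _ (conv_letIn_putL (U := U ++ P) (U' := U ++ P ++ P') (Φ := [A]) (Δ := [])
        (Ξ := []) (Ψ := []) rfl _ _ _ (by simp) _ _ rfl rfl (M.one A) s q f) (Conv.putL _ _ ?_)
      have := ih rfl rfl (by simp) (by simp) (by simp)
      rw [compPath_snoc_nil] at this
      rw [CellPath.single_app] at e
      rw [← e]
      exact this

/-- Composition of paths of terms is associative up to convertibility. -/
theorem conv_compose_compPath {U W P Q P' Q' R S : Exch M.Ob} {Γ Δ As : List M.Ob} {B : M.Ob}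
    {n : ℕ} {hs : CellPath (Term M) U Γ Δ W} (hhs : LetFreePath n hs)
    (gs : CellPath (Term M) P Δ As Q) (f : Term M P' As B Q')
    (hU : U ++ P ++ P' = R) (hW : W ++ Q ++ Q' = S) (hU' : U ++ (P ++ P') = R)
    (hW' : W ++ (Q ++ Q') = S) :
    Conv (compose hU hW (compPath hs gs) f) (compose hU' hW' hs (compose rfl rfl gs f)) := by
  cases hs with
  | nil =>
    cases As with
    | nil => cases gs; exact .of_eq (idHor_append f U P hU hW hU' hW')
    | cons A As =>
      rw [compose_eq_letIn hU hW (List.cons_ne_nil A As),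
        compose_eq_letIn rfl rfl (List.cons_ne_nil A As)]
      exact conv_letIn_compPath_nil (by simp) _ _ _ _ _ _ _ _
  | cons h t ts =>
    have hAs : As ≠ [] := ne_nil_of_cons gs
    rw [compose_eq_letIn _ _ hAs, compose_eq_letIn _ _ hAs, compose_eq_letIn _ _ (by simp)]
    exact hhs.conv_letIn_compPath (by simp) _ _ _ _ _ _ _ _ _

/-! ### Units -/

/-- The unit law for a path with one entry: by induction on a term without lets, its actions are
pulled out of the let one by one. -/
theorem LetFree.conv_letIn_one {n : ℕ} {U W U' W' : Exch M.Ob} {Γ : List M.Ob} {B : M.Ob}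
    {t : Term M U Γ B W} (ht : LetFree n t) (hU : U ++ [] = U') (hW : W ++ [] = W') (hn) :
    Conv (.letIn hU hW hn (.single t) (.neutral (M.one B)))
      (t.cast (by simpa using hU) (by simpa using hW)) := by
  induction ht generalizing U' W' with
  | neutral v =>
    subst hU hW
    refine .trans _ _ _ (.rel _ _ (.r0 (.single v) (.neutral (M.one _)))) ?_
    exact Conv.of_eq (congrArg Term.neutral (M.comp_one v))
  | @putR n U W Δ Γ Θ A B h v t _ ih =>
    obtain rfl : U = U' := by simpa using hU
    obtain rfl : (A, Polarity.circ) :: W = W' := by simpa using hW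
    exact .trans _ _ _ (conv_letIn_putR (Ξ := []) hU (List.append_nil _) hW hn (by simp) h rfl rfl
      h rfl (.nil _) v t _) ((ih hU (List.append_nil _) (by simp)).putR _ _)
  | @getR n U W Γ A B t _ ih =>
    obtain rfl : U = U' := by simpa using hU
    obtain rfl : (A, Polarity.bullet) :: W = W' := by simpa using hW
    exact .trans _ _ _ (conv_letIn_getR (Γ := Γ) (Θ := Γ) (Ξ := []) hU (List.append_nil _) hW hn
      (by simp) rfl rfl rfl (.nil _) t _) (ih hU (List.append_nil _) (by simp)).getR
  | @putL n U W Γ Δ Θ A B h v t _ ih =>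
    obtain rfl : (A, Polarity.bullet) :: U = U' := by simpa using hU
    obtain rfl : W = W' := by simpa using hW
    exact .trans _ _ _ (conv_letIn_putL (Ξ := []) (List.append_nil _) hU hW hn (by simp) h _
      (List.append_nil _) h v t (.nil _) _) ((ih (List.append_nil _) hW (by simp)).putL _ _)
  | @getL n U W Γ A B t _ ih =>
    obtain rfl : (A, Polarity.circ) :: U = U' := by simpa using hU
    obtain rfl : W = W' := by simpa using hW
    exact .trans _ _ _ (conv_letIn_getL (Ξ := []) (List.append_nil _) hU hW hn (by simp) _
      (List.append_nil _) t (.nil _) _) (ih (List.append_nil _) hW (by simp)).getL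

/-! ### The virtual double category of terms -/

/-- The unit law for the path of identities. -/
theorem conv_compose_ids {U W : Exch M.Ob} {As : List M.Ob} {B : M.Ob} (hU : [] ++ U = U)
    (hW : [] ++ W = W) (f : Term M U As B W) :
    Conv (compose hU hW (neutrals (HomSeq.ids M.one As)) f) f := by
  cases As with
  | nil => exact .refl _
  | cons A As =>
    rw [compose_eq_letIn _ _ (by simp)]
    exact .trans _ _ _ (.rel _ _ (.r0 _ f)) (Conv.of_eq (subst_ids f))

/-- The path of the classes of the entries of a path of terms. -/
def mkPath {U W : Exch M.Ob} {Γ As : List M.Ob} : CellPath (Term M) U Γ As W →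
    CellPath (Class M) U Γ As W
  | .nil U => .nil U
  | .cons h t ts => .cons h (mk t) (mkPath ts)

/-- Every path of classes is represented by a path of terms without lets. -/
theorem exists_mkPath {U W : Exch M.Ob} {Γ As : List M.Ob} (p : CellPath (Class M) U Γ As W) :
    ∃ (n : ℕ) (ts : CellPath (Term M) U Γ As W), LetFreePath n ts ∧ mkPath ts = p := by
  induction p with
  | nil U => exact ⟨0, _, .nil U, rfl⟩
  | cons h t p ih =>
    obtain ⟨n, ts, hts, rfl⟩ := ih
    obtain ⟨t, rfl⟩ := Quotient.exists_rep t
    obtain ⟨m, t', ht', hc⟩ := exists_letFree_conv t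
    exact ⟨m + n, .cons h t' ts, .cons h rfl ht' hts,
      congrArg (fun x => CellPath.cons h x (mkPath ts)) (Quotient.sound hc).symm⟩

theorem pathClass_mkPath {U W : Exch M.Ob} {Γ As : List M.Ob} (ts : CellPath (Term M) U Γ As W) :
    pathClass (mkPath ts) = Quotient.mk _ ts := by
  induction ts with
  | nil => rfl
  | cons h t ts ih => simp only [mkPath, pathClass, ih]; rfl

theorem mkPath_app {U V W : Exch M.Ob} {Γ Δ Θ As Bs Cs : List M.Ob} (h : Γ ++ Δ = Θ)
    (hA : As ++ Bs = Cs) (p : CellPath (Term M) U Γ As V) (q : CellPath (Term M) V Δ Bs W) :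
    mkPath (p.app h hA q) = (mkPath p).app h hA (mkPath q) := by
  subst hA
  induction p generalizing Θ with
  | nil => subst h; rfl
  | cons k t p ih => subst h k; exact congrArg _ (ih _ _)

theorem mkPath_neutrals_ids (As : List M.Ob) :
    mkPath (neutrals (HomSeq.ids M.one As)) =
      CellPath.ids (fun A => mk (.neutral (M.one A))) As := by
  induction As with
  | nil => rfl
  | cons A As ih => exact congrArg (CellPath.cons _ _) ih

theorem map₂_pathClass_mkPath {U P U' W Q W' : Exch M.Ob} {Γ As : List M.Ob} {B : M.Ob}
    (hU : U ++ P = U') (hW : W ++ Q = W') (gs : CellPath (Term M) U Γ As W) (f : Term M P As B Q)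
    (h) : Quotient.map₂ (compose hU hW) h (pathClass (mkPath gs)) (mk f) =
      mk (compose hU hW gs f) := by
  rw [pathClass_mkPath]
  rfl

theorem comp_mkPath {U P U' W Q W' : Exch M.Ob} {Γ As : List M.Ob} {B : M.Ob} (hU : U ++ P = U')
    (hW : W ++ Q = W') (gs : CellPath (Term M) U Γ As W) (f : Term M P As B Q) :
    (termVirtual M).comp hU hW (mkPath gs) (mk f) = mk (compose hU hW gs f) :=
  map₂_pathClass_mkPath hU hW gs f fun _ _ hg _ _ hf =>
    .trans _ _ _ (conv_compose_args hU hW _ hg) (conv_compose_body hU hW _ hf)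

theorem comp_mkPath_mkPath {U W P Q : Exch M.Ob} {Γ Δ As : List M.Ob}
    (hs : CellPath (Term M) U Γ Δ W) (gs : CellPath (Term M) P Δ As Q) :
    CellPath.comp ((termVirtual M).comp rfl rfl) (mkPath hs) (mkPath gs) =
      mkPath (compPath hs gs) := by
  induction gs generalizing U Γ with
  | nil => cases hs; rfl
  | cons h g gs ih =>
    obtain ⟨Γ₁, Γ₂, V, hΓ, p, q, rfl⟩ := hs.exists_app _ h
    rw [compPath_cons, mkPath_app]
    refine (CellPath.comp_cons _ _ _ _ _ _ _).trans ?_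
    rw [ih]
    exact congrArg (fun x => CellPath.cons _ x _) (comp_mkPath rfl rfl p g)

end Term

open Term in
/-- Terms modulo convertibility form a virtual double category. -/
theorem isVirtualDoubleCategory_termVirtual (M : Multicategory.{u, v}) :
    IsVirtualDoubleCategory (termVirtual M) where
  assoc hs gs f := by
    obtain ⟨_, hs, hhs, rfl⟩ := exists_mkPath hs
    obtain ⟨_, gs, -, rfl⟩ := exists_mkPath gs
    obtain ⟨f, rfl⟩ := Quotient.exists_rep f
    exact (congrArg (fun p => (termVirtual M).comp _ _ p (mk f)) (comp_mkPath_mkPath hs gs)).trans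
      ((comp_mkPath _ _ _ _).trans ((Quotient.sound (conv_compose_compPath hhs gs f _ _ _ _)).trans
        ((congrArg ((termVirtual M).comp rfl rfl (mkPath hs)) (comp_mkPath rfl rfl gs f)).trans
          (comp_mkPath rfl rfl hs _)).symm))
  ones_comp {_ _ As _} f := by
    obtain ⟨f, rfl⟩ := Quotient.exists_rep f
    exact (congrArg (fun p => (termVirtual M).comp _ _ p (mk f))
      (mkPath_neutrals_ids As).symm).trans ((comp_mkPath _ _ _ f).trans
        (Quotient.sound (conv_compose_ids _ _ f)))
  comp_one f := by
    obtain ⟨f, rfl⟩ := Quotient.exists_rep f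
    obtain ⟨_, f', hf', hc⟩ := exists_letFree_conv f
    rw [Quotient.sound hc]
    exact (comp_mkPath _ _ (.single f') (.neutral (M.one _))).trans
      (Quotient.sound (hf'.conv_letIn_one _ _ _))

/-! ### The interpretation functor -/

namespace DoubleCat

variable {X : DoubleCat.{w, u₁, u₂}}

theorem castTop_heq {U W : X.Vert} {A A' B : X.Hor} (h : A = A') (a : X.Cell U A B W) :
    HEq (X.castTop h a) a := by
  subst h; rfl

theorem hcomp_heq {U V W : X.Vert} {A A' A'' B B' B'' C C' C'' D D' D'' : X.Hor}
    {hA : A * A' = A''} {hB : B * B' = B''} {hC : C * C' = C''} {hD : D * D' = D''}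
    {a : X.Cell U A B V} {b : X.Cell V A' B' W} {c : X.Cell U C D V} {d : X.Cell V C' D' W}
    (h₁ : A = C) (h₂ : A' = C') (h₃ : B = D) (h₄ : B' = D') (hac : HEq a c) (hbd : HEq b d) :
    HEq (X.hcomp hA hB a b) (X.hcomp hC hD c d) := by
  subst h₁ h₂ h₃ h₄ hA hB
  cases hac
  cases hbd
  subst hC hD
  rfl

theorem vcomp_heq {U U' U'' W W' W'' : X.Vert} {A B C A' B' : X.Hor} {hU : U * U' = U''}
    {hW : W * W' = W''} {a : X.Cell U A B W} {b : X.Cell U' B C W'} {a' : X.Cell U A' B' W}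
    {b' : X.Cell U' B' C W'} (h₁ : A = A') (h₂ : B = B') (ha : HEq a a') (hb : HEq b b') :
    HEq (X.vcomp hU hW a b) (X.vcomp hU hW a' b') := by
  subst h₁ h₂
  cases ha
  cases hb
  rfl

/-- Receiving on the left and sending on the right is a horizontal identity. -/
theorem vcomp_receiveL_sendR {a P P₁ P' Q Q₁ Q' : X.Vert} {A B F : X.Hor} (hP : 1 * P = P₁)
    (hQ : a * Q = Q₁) (hP' : a * P₁ = P') (hQ' : 1 * Q₁ = Q') (hP'' : a * P = P')
    (hQ'' : a * Q = Q') (h₁ : (1 : X.Hor) * 1 = 1) (h₂ : A * 1 = F) (h₃ : 1 * A = F)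
    (hs : 1 * 1 = (1 : X.Vert)) (hs' : 1 * a = a) (r : X.Cell a 1 A 1) (s : X.Cell 1 A 1 a)
    (hrs : X.vcomp (mul_one a) (one_mul a) r s = X.hid a) (g : X.Cell P 1 B Q) :
    X.vcomp hP' hQ' (X.hcomp h₁ h₂ r (X.vid 1))
      (X.vcomp hP hQ (X.hcomp h₃ h₁ (X.vid 1) (X.vcomp hs hs' (X.vid A) s)) g) =
      X.vcomp hP'' hQ'' (X.hid a) g := by
  obtain rfl : A = F := (mul_one A).symm.trans h₂
  rw [X.vid_vcomp, ← X.hid_one, X.hcomp_hid, X.hid_hcomp, ← hrs,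
    vcomp_assoc' _ _ _ _ hP hQ hP' hQ']

/-- Receiving on the right and sending on the left is a horizontal identity. -/
theorem vcomp_receiveR_sendL {a P P₁ P' Q Q₁ Q' : X.Vert} {A B F : X.Hor} (hP : a * P = P₁)
    (hQ : 1 * Q = Q₁) (hP' : 1 * P₁ = P') (hQ' : a * Q₁ = Q') (hP'' : a * P = P')
    (hQ'' : a * Q = Q') (h₁ : (1 : X.Hor) * 1 = 1) (h₂ : 1 * A = F) (h₃ : A * 1 = F)
    (hs : 1 * 1 = (1 : X.Vert)) (hs' : 1 * a = a) (r : X.Cell 1 1 A a) (s : X.Cell a A 1 1)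
    (hrs : X.vcomp (one_mul a) (mul_one a) r s = X.hid a) (g : X.Cell P 1 B Q) :
    X.vcomp hP' hQ' (X.hcomp h₁ h₂ (X.vid 1) r)
      (X.vcomp hP hQ (X.hcomp h₃ h₁ (X.vcomp hs' hs (X.vid A) s) (X.vid 1)) g) =
      X.vcomp hP'' hQ'' (X.hid a) g := by
  obtain rfl : A = F := (mul_one A).symm.trans h₃
  rw [X.vid_vcomp, ← X.hid_one, X.hcomp_hid, X.hid_hcomp, ← hrs,
    vcomp_assoc' _ _ _ _ hP hQ hP' hQ']

theorem hid_vcomp_hid_vcomp {U W V P P₁ P' Q Q₁ Q' : X.Vert} {B : X.Hor} (h : U * W = V)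
    (hP : W * P = P₁) (hQ : W * Q = Q₁) (hP' : U * P₁ = P') (hQ' : U * Q₁ = Q') (hP'' : V * P = P')
    (hQ'' : V * Q = Q') (g : X.Cell P 1 B Q) :
    X.vcomp hP' hQ' (X.hid U) (X.vcomp hP hQ (X.hid W) g) = X.vcomp hP'' hQ'' (X.hid V) g := by
  subst h
  rw [← X.hid_mul, vcomp_assoc' _ _ _ _ hP hQ hP' hQ']

end DoubleCat

namespace Term

variable {M : Multicategory.{u, v}}

/-- The terms `id_U(f)` are interpreted by the horizontal identities. -/
theorem interp_idHor {P Q : Exch M.Ob} {B : M.Ob} (f : Term M P [] B Q) (U : Exch M.Ob) :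
    interp (idHor f U) = (Cornering M).vcomp List.map_append.symm List.map_append.symm
      ((Cornering M).hid U.single) (interp f) := by
  induction U with
  | nil =>
    exact ((Cornering M).vid_vcomp (interp f)).symm.trans
      (congrArg (fun c => (Cornering M).vcomp _ _ c (interp f)) (Cornering M).hid_one.symm)
  | cons a U ih =>
    obtain ⟨A, _ | _⟩ := a
    · have h := DoubleCat.vcomp_receiveL_sendR (X := Cornering M) (a := Exch.circ [A]) (A := [A])
        rfl rfl rfl rfl rfl rfl rfl rfl rfl rfl rfl (receiveLCell A) (sendRCell A)
        (Quotient.sound (.yank_circ_vert (𝔸 := freeMonoidal M) [A])) (interp (idHor f U))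
      rw [← seqCell_ids [A]] at h
      refine h.trans ((congrArg ((Cornering M).vcomp _ _ _) ih).trans ?_)
      exact DoubleCat.hid_vcomp_hid_vcomp (X := Cornering M) (U := Exch.circ [A])
        (W := Exch.single U) rfl _ _ _ _ _ _ (interp f)
    · have h := DoubleCat.vcomp_receiveR_sendL (X := Cornering M) (a := Exch.bullet [A]) (A := [A])
        rfl rfl rfl rfl rfl rfl rfl rfl rfl rfl rfl (receiveRCell A) (sendLCell A)
        (Quotient.sound (.yank_bullet_vert (𝔸 := freeMonoidal M) [A])) (interp (idHor f U))
      rw [← seqCell_ids [A]] at h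
      refine h.trans ((congrArg ((Cornering M).vcomp _ _ _) ih).trans ?_)
      exact DoubleCat.hid_vcomp_hid_vcomp (X := Cornering M) (U := Exch.bullet [A])
        (W := Exch.single U) rfl _ _ _ _ _ _ (interp f)

/-- The interpretation respects composition. -/
theorem interp_compose {U P U' W Q W' : Exch M.Ob} {Γ As : List M.Ob} {B : M.Ob}
    (hU : U ++ P = U') (hW : W ++ Q = W') (gs : CellPath (Term M) U Γ As W) (f : Term M P As B Q) :
    interp (compose hU hW gs f) = (Cornering M).vcomp (hU ▸ List.map_append.symm)
      (hW ▸ List.map_append.symm) (interpPath gs) (interp f) := by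
  cases gs with
  | nil => subst hU hW; exact interp_idHor f U
  | cons h g gs => rfl

/-- The images of the entries of a path of terms compose horizontally to the interpretation of the
path. The boundaries agree only up to the equality `prod_map_single`, whence the heterogeneous
equality. -/
theorem hcompPath_map_heq
    (coherent : ∀ {U W : Exch M.Ob} {Γ : List M.Ob} {B : M.Ob} (t t' : Term M U Γ B W),
      Conv t t' → interp t = interp t')
    {U W : Exch M.Ob} {Γ As : List M.Ob} (ts : CellPath (Term M) U Γ As W) :
    HEq ((Cornering M).hcompPath ((mkPath ts).map (Cell' := (Cornering M).VirtualCell)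
        Exch.single (fun A => [A]) fun c => interpClass coherent c)) (interpPath ts) := by
  induction ts with
  | nil => rfl
  | cons h t ts ih =>
    refine DoubleCat.hcomp_heq (prod_map_single _) (prod_map_single _) rfl (prod_map_single _) ?_ ih
    exact DoubleCat.castTop_heq _ _

/-- The interpretation is a functor of virtual double categories. -/
theorem isVirtualDoubleFunctor_interpClass
    (coherent : ∀ {U W : Exch M.Ob} {Γ : List M.Ob} {B : M.Ob} (t t' : Term M U Γ B W),
      Conv t t' → interp t = interp t') :
    IsVirtualDoubleFunctor (termVirtual M) (Cornering M).toVirtual (fun A => [A]) Exch.single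
      (fun c => interpClass coherent c) where
  ver_one := rfl
  ver_mul _ _ := List.map_append
  map_one A := by
    refine (DoubleCat.castTop_heq _ _).trans (HEq.trans ?_ (DoubleCat.castTop_heq
      (X := Cornering M) List.prod_singleton.symm ((Cornering M).vid [A])).symm)
    exact heq_of_eq (seqCell_ids [A])
  map_comp hU hW gs f := by
    obtain ⟨_, gs, -, rfl⟩ := exists_mkPath gs
    obtain ⟨f, rfl⟩ := Quotient.exists_rep f
    apply eq_of_heq
    refine (heq_of_eq (congrArg _ (comp_mkPath hU hW gs f))).trans ?_
    refine (DoubleCat.castTop_heq _ _).trans ?_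
    refine (heq_of_eq (interp_compose hU hW gs f)).trans ?_
    exact DoubleCat.vcomp_heq (prod_map_single _).symm (prod_map_single _).symm
      (hcompPath_map_heq coherent gs).symm (DoubleCat.castTop_heq _ _).symm

end Term

end ProcessCalculus

theorem mainTheorem5 (M : ProcessCalculus.Multicategory.{u, v}) :
    ProcessCalculus.IsVirtualDoubleCategory (ProcessCalculus.termVirtual M) ∧
    ProcessCalculus.IsVirtualDoubleCategory
      (ProcessCalculus.freeCornering (ProcessCalculus.freeMonoidal M)).toVirtual ∧
    ∃ coherent : ∀ {U W : ProcessCalculus.Exch M.Ob} {Γ : List M.Ob} {B : M.Ob}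
        (t t' : ProcessCalculus.Term M U Γ B W), t.Conv t' → t.interp = t'.interp,
      ProcessCalculus.IsVirtualDoubleFunctor
        (ProcessCalculus.termVirtual M)
        (ProcessCalculus.freeCornering (ProcessCalculus.freeMonoidal M)).toVirtual
        (fun A => [A])
        ProcessCalculus.Exch.single
        (fun c => ProcessCalculus.Term.interpClass coherent c) :=
  ⟨ProcessCalculus.isVirtualDoubleCategory_termVirtual M,
    ProcessCalculus.DoubleCat.isVirtualDoubleCategory _,
    fun _ _ h => ProcessCalculus.Term.interp_eq_of_conv h,
    ProcessCalculus.Term.isVirtualDoubleFunctor_interpClass fun _ _ h =>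
      ProcessCalculus.Term.interp_eq_of_conv h⟩
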